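/- **Conventions.** 2-categories and 2-functors are strict. A 2-category is *small* if its objects, 1-cells and 2-cells form (small) sets, and *locally small* if its hom-categories are small. $\mathcal{C}at$ is the 2-category of small categories. For a locally small 2-category $\mathcal{C}$, $\mathcal{H}om(\mathcal{C},\mathcal{C}at)$ is the 2-category of 2-functors $\mathcal{C}\to\mathcal{C}at$, 2-natural transformations and modifications. A *pseudocone* with vertex $E$ on a 2-functor $F:\mathcal{I}\to\mathcal{A}$ is a pseudonatural transformation from $F$ to the 2-functor constant at $E$; pseudocones with vertex $E$ and their modifications form a category $PC(F,E)$. A *pseudocolimit* of $F$ is an object $L$ with a pseudocone on $F$ with vertex $L$ such that, for every object $E$ of $\mathcal{A}$, composition with this pseudocone is an isomorphism of categories $\mathcal{A}(L,E)\to PC(F,E)$. *Pseudolimits* are defined dually, by pseudonatural transformations from the 2-functor constant at $E$ to $F$. A 2-category $\mathcal{I}$ is *2-filtered* if: (F0) for all objects $i,j$ there are an object $k$ and 1-cells $i\to k$, $j\to k$; (F1) for all 1-cells $f,g:i\to j$ there are a 1-cell $h:j\to k$ and an invertible 2-cell $hf\cong hg$; (F2) for all 2-cells $\alpha,\beta:f\Rightarrow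 g$ between 1-cells $f,g:i\to j$ there is a 1-cell $h:j\to k$ with $h\alpha=h\beta$. It is *2-cofiltered* if the 2-category $\mathcal{I}^{op}$ obtained by reversing the 1-cells is 2-filtered. The 2-category $2\text{-}\mathcal{P}ro(\mathcal{C})$ has as objects the 2-functors $X=(X_i)_{i\in\mathcal{I}}:\mathcal{I}^{op}\to\mathcal{C}$ with $\mathcal{I}$ a small 2-filtered 2-category. For such $X$ let $LX:\mathcal{C}\to\mathcal{C}at$ be the pseudocolimit in $\mathcal{H}om(\mathcal{C},\mathcal{C}at)$ of the diagram $i\mapsto\mathcal{C}(X_i,-)$ of representable 2-functors. The hom-categories are $2\text{-}\mathcal{P}ro(\mathcal{C})(X,Y)=\mathcal{H}om(\mathcal{C},\mathcal{C}at)(LY,LX)$, with composition as in $\mathcal{H}om(\mathcal{C},\mathcal{C}at)^{op}$. Let $\mathcal{H}om(\mathcal{C},\mathcal{C}at)_{fc}$ be the full sub-2-category of $\mathcal{H}om(\mathcal{C},\mathcal{C}at)$ on the 2-functors that are pseudocolimits of some diagram $i\mapsto\mathcal{C}(X_i,-)$ with $X:\mathcal{I}^{op}\to\mathcal{C}$ a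 2-functor and $\mathcal{I}$ small and 2-filtered. **Statement.** Let $\mathcal{C}$ be a locally small 2-category. 1. $2\text{-}\mathcal{P}ro(\mathcal{C})$ is closed under small 2-cofiltered pseudolimits: for every small 2-filtered 2-category $\mathcal{J}$, every 2-functor $\mathcal{J}^{op}\to 2\text{-}\mathcal{P}ro(\mathcal{C})$ has a pseudolimit in $2\text{-}\mathcal{P}ro(\mathcal{C})$. 2. The inclusion $\mathcal{H}om(\mathcal{C},\mathcal{C}at)_{fc}\subset\mathcal{H}om(\mathcal{C},\mathcal{C}at)$ is closed under small 2-filtered pseudocolimits: for every small 2-filtered 2-category $\mathcal{J}$ and every 2-functor $F:\mathcal{J}\to\mathcal{H}om(\mathcal{C},\mathcal{C}at)$ with all values in $\mathcal{H}om(\mathcal{C},\mathcal{C}at)_{fc}$, a pseudocolimit of $F$ in $\mathcal{H}om(\mathcal{C},\mathcal{C}at)$ exists, and every pseudocolimit of $F$ in $\mathcal{H}om(\mathcal{C},\mathcal{C}at)$ belongs to $\mathcal{H}om(\mathcal{C},\mathcal{C}at)_{fc}$. -/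

import Mathlib

open CategoryTheory Bicategory Opposite
open scoped Pseudofunctor.StrongTrans

universe w v u w₁ v₁ u₁ w₂ v₂ u₂

/-! 2-categories are Mathlib's strict bicategories, 2-functors are `StrictPseudofunctor`s,
pseudonatural transformations are strong transformations, and modifications are Mathlib's. -/

namespace TwoPro

set_option linter.unusedSectionVars false

section Opp
variable {B : Type u} [Bicategory.{w, v} B]

theorem op2_eqToHom {a b : B} {f g : a ⟶ b} (h : f = g) :
    Bicategory.Opposite.op2 (eqToHom h) = eqToHom (congrArg Quiver.Hom.op h) := by
  subst h; rfl

/-- The opposite of a 2-category (1-cells reversed, 2-cells kept) is a 2-category. -/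
instance [Strict B] : Strict Bᵒᵖ where
  id_comp f := congrArg Quiver.Hom.op (Strict.comp_id f.unop)
  comp_id f := congrArg Quiver.Hom.op (Strict.id_comp f.unop)
  assoc f g h := congrArg Quiver.Hom.op (Strict.assoc h.unop g.unop f.unop).symm
  leftUnitor_eqToIso f := by
    ext
    change Bicategory.Opposite.op2 (ρ_ f.unop).hom = _
    rw [Strict.rightUnitor_eqToIso, eqToIso.hom, op2_eqToHom]; rfl
  rightUnitor_eqToIso f := by
    ext
    change Bicategory.Opposite.op2 (λ_ f.unop).hom = _
    rw [Strict.leftUnitor_eqToIso, eqToIso.hom, op2_eqToHom]; rfl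
  associator_eqToIso f g h := by
    ext
    change Bicategory.Opposite.op2 (α_ h.unop g.unop f.unop).inv = _
    rw [Strict.associator_eqToIso, eqToIso.inv, op2_eqToHom]; rfl
end Opp

section HomTwoCat
variable {C : Type u₁} [Bicategory.{w₁, v₁} C] {D : Type u₂} [Bicategory.{w₂, v₂} D]

/-- A pseudonatural transformation is 2-natural if its structure 2-cells are identities. -/
def IsTwoNatural {F G : Pseudofunctor C D} (θ : F ⟶ G) : Prop :=
  ∀ ⦃a b : C⦄ (f : a ⟶ b), ∃ h : F.map f ≫ θ.app b = θ.app a ≫ G.map f,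
    θ.naturality f = eqToIso h

/-- 2-natural transformations between 2-functors. -/
structure TwoNatTrans (F G : StrictPseudofunctor C D) where
  trans : F.toPseudofunctor ⟶ G.toPseudofunctor
  isTwoNatural : IsTwoNatural trans


@[ext]
theorem TwoNatTrans.ext' {F G : StrictPseudofunctor C D} {θ η : TwoNatTrans F G}
    (h : ∀ a, θ.trans.app a = η.trans.app a) : θ = η := by
  obtain ⟨⟨θa, θn, _, _, _⟩, hθ⟩ := θ
  obtain ⟨⟨ηa, ηn, _, _, _⟩, hη⟩ := η
  obtain rfl : θa = ηa := funext h
  congr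
  funext a b f
  obtain ⟨h₁, e₁⟩ := hθ f
  obtain ⟨h₂, e₂⟩ := hη f
  exact e₁.trans e₂.symm

variable [Strict D]

theorem isTwoNatural_id (F : Pseudofunctor C D) : IsTwoNatural (𝟙 F) := fun a b f =>
  ⟨by change _ ≫ 𝟙 _ = 𝟙 _ ≫ _; rw [Strict.comp_id, Strict.id_comp], by
    change ρ_ _ ≪≫ (λ_ _).symm = _
    rw [Strict.rightUnitor_eqToIso, Strict.leftUnitor_eqToIso]
    exact eqToIso_trans (Strict.comp_id _) (Strict.id_comp _).symm⟩

theorem isTwoNatural_comp {F G H : Pseudofunctor C D} {θ : F ⟶ G} {η : G ⟶ H}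
    (hθ : IsTwoNatural θ) (hη : IsTwoNatural η) : IsTwoNatural (θ ≫ η) := fun a b f => by
  obtain ⟨h₁, e₁⟩ := hθ f
  obtain ⟨h₂, e₂⟩ := hη f
  refine ⟨?_, ?_⟩
  · change F.map f ≫ θ.app b ≫ η.app b = (θ.app a ≫ η.app a) ≫ H.map f
    rw [← Strict.assoc, h₁, Strict.assoc, h₂, Strict.assoc]
  · ext
    rw [Pseudofunctor.StrongTrans.categoryStruct_comp_naturality_hom]
    simp only [e₁, e₂, Strict.associator_eqToIso, eqToIso.hom, eqToIso.inv, eqToHom_whiskerRight,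
      whiskerLeft_eqToHom]
    erw [eqToHom_trans, eqToHom_trans, eqToHom_trans, eqToHom_trans]
    rfl

/-! The 2-category `Hom(C, D)`: 2-functors, 2-natural transformations, modifications. -/

instance : CategoryStruct (StrictPseudofunctor C D) where
  Hom F G := TwoNatTrans F G
  id F := ⟨𝟙 F.toPseudofunctor, isTwoNatural_id _⟩
  comp θ η := ⟨θ.trans ≫ η.trans, isTwoNatural_comp θ.isTwoNatural η.isTwoNatural⟩

/-- 2-cells of `Hom(C, D)` are the modifications. -/
instance (F G : StrictPseudofunctor C D) : Category (F ⟶ G) where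
  Hom θ η := θ.trans ⟶ η.trans
  id θ := 𝟙 θ.trans
  comp ρ σ := Pseudofunctor.StrongTrans.homCategory.comp ρ σ

/-- An invertible modification, seen as an isomorphism in `Hom(C, D)(F, G)`. -/
def isoOfTrans {F G : StrictPseudofunctor C D} {θ η : F ⟶ G} (e : θ.trans ≅ η.trans) : θ ≅ η where
  hom := e.hom
  inv := e.inv
  hom_inv_id := e.hom_inv_id
  inv_hom_id := e.inv_hom_id

instance : Bicategory (StrictPseudofunctor C D) where
  whiskerLeft θ _ _ ρ := Bicategory.whiskerLeft (B := Pseudofunctor C D) θ.trans ρ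
  whiskerRight ρ η := Bicategory.whiskerRight (B := Pseudofunctor C D) ρ η.trans
  associator θ η μ := isoOfTrans (Bicategory.associator (B := Pseudofunctor C D) θ.trans η.trans μ.trans)
  leftUnitor θ := isoOfTrans (Bicategory.leftUnitor (B := Pseudofunctor C D) θ.trans)
  rightUnitor θ := isoOfTrans (Bicategory.rightUnitor (B := Pseudofunctor C D) θ.trans)
  whiskerLeft_id θ η := Bicategory.whiskerLeft_id (B := Pseudofunctor C D) _ _
  whiskerLeft_comp θ _ _ _ ρ σ := Bicategory.whiskerLeft_comp (B := Pseudofunctor C D) _ _ _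
  id_whiskerLeft ρ := Bicategory.id_whiskerLeft (B := Pseudofunctor C D) _
  comp_whiskerLeft θ η _ _ ρ := Bicategory.comp_whiskerLeft (B := Pseudofunctor C D) _ _ _
  id_whiskerRight θ η := Bicategory.id_whiskerRight (B := Pseudofunctor C D) _ _
  comp_whiskerRight ρ σ η := Bicategory.comp_whiskerRight (B := Pseudofunctor C D) _ _ _
  whiskerRight_id ρ := Bicategory.whiskerRight_id (B := Pseudofunctor C D) _
  whiskerRight_comp ρ _ _ := Bicategory.whiskerRight_comp (B := Pseudofunctor C D) _ _ _
  whisker_assoc _ _ _ _ _ := Bicategory.whisker_assoc (B := Pseudofunctor C D) _ _ _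
  whisker_exchange _ _ := Bicategory.whisker_exchange (B := Pseudofunctor C D) _ _
  pentagon _ _ _ _ := Bicategory.pentagon (B := Pseudofunctor C D) _ _ _ _
  triangle _ _ := Bicategory.triangle (B := Pseudofunctor C D) _ _

theorem eqToHom_as_app {F G : StrictPseudofunctor C D} {θ η : F ⟶ G} (h : θ = η) (a : C) :
    Pseudofunctor.StrongTrans.Modification.app
      (Pseudofunctor.StrongTrans.Hom.as (eqToHom h : θ ⟶ η)) a =
      eqToHom (by rw [h]) := by
  subst h; rfl

theorem modification_ext {F G : StrictPseudofunctor C D} {θ η : F ⟶ G} {ρ σ : θ ⟶ η}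
    (h : ∀ a, Pseudofunctor.StrongTrans.Modification.app
      (Pseudofunctor.StrongTrans.Hom.as ρ) a = Pseudofunctor.StrongTrans.Modification.app
      (Pseudofunctor.StrongTrans.Hom.as σ) a) : ρ = σ :=
  Pseudofunctor.StrongTrans.homCategory.ext h

instance : Strict (StrictPseudofunctor C D) where
  id_comp θ := TwoNatTrans.ext' fun a => Strict.id_comp _
  comp_id θ := TwoNatTrans.ext' fun a => Strict.comp_id _
  assoc θ η μ := TwoNatTrans.ext' fun a => Strict.assoc _ _ _
  leftUnitor_eqToIso θ := by
    ext; refine modification_ext fun a => ?_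
    rw [eqToIso.hom, eqToHom_as_app]
    exact congrArg Iso.hom (Strict.leftUnitor_eqToIso (θ.trans.app a))
  rightUnitor_eqToIso θ := by
    ext; refine modification_ext fun a => ?_
    rw [eqToIso.hom, eqToHom_as_app]
    exact congrArg Iso.hom (Strict.rightUnitor_eqToIso (θ.trans.app a))
  associator_eqToIso θ η μ := by
    ext; refine modification_ext fun a => ?_
    rw [eqToIso.hom, eqToHom_as_app]
    exact congrArg Iso.hom (Strict.associator_eqToIso (θ.trans.app a) (η.trans.app a) (μ.trans.app a))


/-- A 2-natural transformation from its components, `nat` being strict naturality for 1-cells and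
`nat₂` naturality for 2-cells. -/
def TwoNatTrans.mk' {F G : StrictPseudofunctor C D} (app : ∀ a, F.obj a ⟶ G.obj a)
    (nat : ∀ {a b : C} (f : a ⟶ b), F.map f ≫ app b = app a ≫ G.map f)
    (nat₂ : ∀ {a b : C} {f g : a ⟶ b} (η : f ⟶ g), F.map₂ η ▷ app b =
      eqToHom (nat f) ≫ app a ◁ G.map₂ η ≫ eqToHom (nat g).symm) : TwoNatTrans F G where
  trans :=
    { app := app
      naturality := fun f => eqToIso (nat f)
      naturality_naturality := fun η => by rw [nat₂]; simp
      naturality_id := fun a => by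
        simp only [StrictlyUnitaryPseudofunctor.mapId_eq_eqToIso, Strict.leftUnitor_eqToIso,
          Strict.rightUnitor_eqToIso, eqToIso.hom, eqToIso.inv, eqToHom_whiskerRight,
          whiskerLeft_eqToHom, eqToHom_trans]
      naturality_comp := fun f g => by
        simp only [StrictPseudofunctor.mapComp_eq_eqToIso, Strict.associator_eqToIso,
          eqToIso.hom, eqToIso.inv, eqToHom_whiskerRight,
          whiskerLeft_eqToHom, eqToHom_trans] }
  isTwoNatural _ _ f := ⟨nat f, rfl⟩

/-- A modification between 2-natural transformations from its components. -/
def TwoNatTrans.homMk {F G : StrictPseudofunctor C D} {θ η : F ⟶ G}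
    (app : ∀ a, θ.trans.app a ⟶ η.trans.app a)
    (nat : ∀ {a b : C} (f : a ⟶ b), F.map f ◁ app b =
      eqToHom (θ.isTwoNatural f).1 ≫ app a ▷ G.map f ≫ eqToHom (η.isTwoNatural f).1.symm) :
    θ ⟶ η :=
  Pseudofunctor.StrongTrans.Hom.of (η := θ.trans) (θ := η.trans)
    { app := app
      naturality := fun f => by
        obtain ⟨h₁, e₁⟩ := θ.isTwoNatural f
        obtain ⟨h₂, e₂⟩ := η.isTwoNatural f
        rw [e₁, e₂, nat f]
        simp }

/-- An invertible modification between 2-natural transformations from its components. -/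
def TwoNatTrans.isoMk {F G : StrictPseudofunctor C D} {θ η : F ⟶ G}
    (app : ∀ a, θ.trans.app a ≅ η.trans.app a)
    (nat : ∀ {a b : C} (f : a ⟶ b), F.map f ◁ (app b).hom =
      eqToHom (θ.isTwoNatural f).1 ≫ (app a).hom ▷ G.map f ≫
        eqToHom (η.isTwoNatural f).1.symm) : θ ≅ η :=
  isoOfTrans <| Pseudofunctor.StrongTrans.isoMk app
    (Pseudofunctor.StrongTrans.Modification.naturality (Pseudofunctor.StrongTrans.Hom.as
      (TwoNatTrans.homMk (fun a => (app a).hom) nat)))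

theorem comp_as_app {F G : StrictPseudofunctor C D} {θ η μ : F ⟶ G} (ρ : θ ⟶ η) (σ : η ⟶ μ) (a : C) :
    Pseudofunctor.StrongTrans.Modification.app
      (Pseudofunctor.StrongTrans.Hom.as (ρ ≫ σ)) a =
    Pseudofunctor.StrongTrans.Modification.app (Pseudofunctor.StrongTrans.Hom.as ρ) a ≫
    Pseudofunctor.StrongTrans.Modification.app (Pseudofunctor.StrongTrans.Hom.as σ) a := rfl

end HomTwoCat

section Pseudolimits
variable {I : Type u₁} [Bicategory.{w₁, v₁} I] {A : Type u₂} [Bicategory.{w₂, v₂} A]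

/-- The 2-functor constant at `Z`. -/
@[simps]
def const (I : Type u₁) [Bicategory.{w₁, v₁} I] (Z : A) : Pseudofunctor I A where
  obj _ := Z
  map _ := 𝟙 Z
  map₂ _ := 𝟙 (𝟙 Z)
  mapId _ := Iso.refl _
  mapComp _ _ := (λ_ (𝟙 Z)).symm
  map₂_associator f g h := by simp

/-- The functor sending `f : Y ⟶ Z` to the constant transformation at `f`. -/
@[simps]
def constFunctor (I : Type u₁) [Bicategory.{w₁, v₁} I] (Y Z : A) :
    (Y ⟶ Z) ⥤ (const I Y ⟶ const I Z) where
  obj f :=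
    { app := fun _ => f
      naturality := fun _ => λ_ f ≪≫ (ρ_ f).symm
      naturality_naturality := fun _ => by
        change 𝟙 (𝟙 Y) ▷ f ≫ (λ_ f).hom ≫ (ρ_ f).inv =
          ((λ_ f).hom ≫ (ρ_ f).inv) ≫ f ◁ 𝟙 (𝟙 Z)
        simp
      naturality_id := fun _ => by
        change ((λ_ f).hom ≫ (ρ_ f).inv) ≫ f ◁ 𝟙 (𝟙 Z) =
          𝟙 (𝟙 Y) ▷ f ≫ (λ_ f).hom ≫ (ρ_ f).inv
        simp
      naturality_comp := fun _ _ => by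
        change ((λ_ f).hom ≫ (ρ_ f).inv) ≫ f ◁ (λ_ (𝟙 Z)).inv =
          (λ_ (𝟙 Y)).inv ▷ f ≫ (α_ (𝟙 Y) (𝟙 Y) f).hom ≫ 𝟙 Y ◁ ((λ_ f).hom ≫ (ρ_ f).inv) ≫
            (α_ (𝟙 Y) f (𝟙 Z)).inv ≫ ((λ_ f).hom ≫ (ρ_ f).inv) ▷ 𝟙 Z ≫ (α_ f (𝟙 Z) (𝟙 Z)).hom
        simp }
  map α := ⟨{ app := fun _ => α
              naturality := fun _ => by
                change 𝟙 Y ◁ α ≫ (λ_ _).hom ≫ (ρ_ _).inv = ((λ_ _).hom ≫ (ρ_ _).inv) ≫ α ▷ 𝟙 Z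
                simp }⟩
  map_id _ := rfl
  map_comp _ _ := rfl

/-- The functor `F` is an isomorphism of categories. -/
def IsIsoOfCategories {X : Type u₁} [Category.{v₁} X] {Y : Type u₂} [Category.{v₂} Y]
    (F : X ⥤ Y) : Prop :=
  ∃ G : Y ⥤ X, F ⋙ G = 𝟭 X ∧ G ⋙ F = 𝟭 Y

/-- A pseudocone `l` from `F` with vertex `L` is a pseudocolimit if, for every `Z`, composition with
`l` is an isomorphism of categories from `A(L, Z)` to the category of pseudocones from `F` with
vertex `Z` and their morphisms. -/
def IsPseudocolimit {F : Pseudofunctor I A} {L : A} (l : F ⟶ const I L) : Prop :=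
  ∀ Z : A, IsIsoOfCategories (constFunctor I L Z ⋙ precomp (const I Z) l)

/-- A pseudocone `p` to `F` with vertex `L` is a pseudolimit if, for every `Z`, composition with `p`
is an isomorphism of categories from `A(Z, L)` to the category of pseudocones to `F` with
vertex `Z` and their morphisms. -/
def IsPseudolimit {F : Pseudofunctor I A} {L : A} (p : const I L ⟶ F) : Prop :=
  ∀ Z : A, IsIsoOfCategories (constFunctor I Z L ⋙ postcomp (const I Z) p)

end Pseudolimits

/-- 2-filtered 2-categories. `f0`: any two objects map to a common one. `f1`: any two parallel
1-cells become isomorphic after composition with some 1-cell. `f2`: any two parallel 2-cells become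
equal after whiskering with some 1-cell. -/
structure IsTwoFiltered (I : Type u) [Bicategory.{w, v} I] : Prop where
  f0 : ∀ a b : I, ∃ c : I, Nonempty (a ⟶ c) ∧ Nonempty (b ⟶ c)
  f1 : ∀ {a b : I} (f g : a ⟶ b), ∃ (c : I) (h : b ⟶ c), Nonempty (f ≫ h ≅ g ≫ h)
  f2 : ∀ {a b : I} {f g : a ⟶ b} (α β : f ⟶ g), ∃ (c : I) (h : b ⟶ c), α ▷ h = β ▷ h

section Representables
variable {C : Type u} [Bicategory.{w, w} C] [Strict C]

theorem whiskerRight_id_eq {a b : C} {f g : a ⟶ b} (η : f ⟶ g) :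
    η ▷ 𝟙 b = eqToHom (Strict.comp_id f) ≫ η ≫ eqToHom (Strict.comp_id g).symm := by
  simp [whiskerRight_id, Strict.rightUnitor_eqToIso]

theorem whiskerRight_comp_eq {a b c d : C} {f g : a ⟶ b} (η : f ⟶ g) (h : b ⟶ c) (k : c ⟶ d) :
    η ▷ (h ≫ k) = eqToHom (Strict.assoc f h k).symm ≫ (η ▷ h) ▷ k ≫
      eqToHom (Strict.assoc g h k) := by
  simp [Strict.associator_eqToIso]

theorem whiskerLeft_whiskerLeft_eq {a b c d : C} (h : a ⟶ b) (f : b ⟶ c) {g g' : c ⟶ d}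
    (η : g ⟶ g') : h ◁ (f ◁ η) = eqToHom (Strict.assoc h f g).symm ≫ (h ≫ f) ◁ η ≫
      eqToHom (Strict.assoc h f g') := by
  simp [Strict.associator_eqToIso]

theorem whiskerLeft_whiskerRight_eq {a b c d : C} (k : a ⟶ b) {f g : b ⟶ c} (η : f ⟶ g)
    (h : c ⟶ d) : k ◁ (η ▷ h) = eqToHom (Strict.assoc k f h).symm ≫ (k ◁ η) ▷ h ≫
      eqToHom (Strict.assoc k g h) := by
  simp [Strict.associator_eqToIso]

/-- The representable 2-functor `C(A, -)`. -/
def repr (A : C) : StrictPseudofunctor C Cat.{w, w} := StrictPseudofunctor.mk''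
  { obj := fun D => Cat.of (A ⟶ D)
    map := fun f => (postcomp A f).toCatHom
    map₂ := fun α => ((postcomposing A _ _).map α).toCatHom₂
    map₂_id := fun f => congrArg NatTrans.toCatHom₂ ((postcomposing A _ _).map_id f)
    map₂_comp := fun α β => congrArg NatTrans.toCatHom₂ ((postcomposing A _ _).map_comp α β)
    map_id := fun X => Cat.Hom.ext
      (CategoryTheory.Functor.ext (fun f => Strict.comp_id f) fun _ _ η => whiskerRight_id_eq η)
    map_comp := fun h k => Cat.Hom.ext
      (CategoryTheory.Functor.ext (fun f => (Strict.assoc f h k).symm) fun _ _ η => whiskerRight_comp_eq η h k)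
    map₂_whisker_left := fun f g g' η => by
      ext h
      rw [Cat.Hom₂.comp_app, Cat.Hom₂.comp_app, Cat.eqToHom_app, Cat.eqToHom_app]
      exact whiskerLeft_whiskerLeft_eq h f η
    map₂_whisker_right := fun η h => by
      ext k
      rw [Cat.Hom₂.comp_app, Cat.Hom₂.comp_app, Cat.eqToHom_app, Cat.eqToHom_app]
      exact whiskerLeft_whiskerRight_eq k η h }


/-- The 2-natural transformation `C(B, -) ⟶ C(A, -)` given by precomposition with `f : A ⟶ B`. -/
def reprMap {A B : C} (f : A ⟶ B) : repr B ⟶ repr A :=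
  TwoNatTrans.mk' (fun D => (precomp D f).toCatHom)
    (fun g => Cat.Hom.ext <|
        CategoryTheory.Functor.ext (fun h => (Strict.assoc f h g).symm) fun _ _ η =>
          whiskerLeft_whiskerRight_eq f η g)
    (fun η => by
      ext k
      rw [Cat.Hom₂.comp_app, Cat.Hom₂.comp_app, Cat.eqToHom_app, Cat.eqToHom_app]
      exact whiskerLeft_whiskerLeft_eq f k η)

theorem comp_whiskerRight_eq {a b c d : C} {f g : a ⟶ b} (η : f ⟶ g) (h : b ⟶ c) (k : c ⟶ d) :
    η ▷ (h ≫ k) = eqToHom (Strict.assoc f h k).symm ≫ (η ▷ h) ▷ k ≫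
      eqToHom (Strict.assoc g h k) := by
  simp [Strict.associator_eqToIso]


theorem whiskerRight_comp_eq' {a b c d : C} (f : a ⟶ b) (h : b ⟶ c) {k l : c ⟶ d} (η : k ⟶ l) :
    (f ≫ h) ◁ η = eqToHom (Strict.assoc f h k) ≫ f ◁ h ◁ η ≫
      eqToHom (Strict.assoc f h l).symm := by
  simp [Strict.associator_eqToIso]

theorem whiskerRight_whiskerRight_eq {a b c d : C} {f g : a ⟶ b} (η : f ⟶ g) (h : b ⟶ c)
    (k : c ⟶ d) : (η ▷ h) ▷ k = eqToHom (Strict.assoc f h k) ≫ η ▷ (h ≫ k) ≫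
      eqToHom (Strict.assoc g h k).symm := by
  simp [Strict.associator_eqToIso]

theorem whiskerLeft_whiskerRight_eq' {a b c d : C} (k : a ⟶ b) {f g : b ⟶ c} (η : f ⟶ g)
    (h : c ⟶ d) : (k ◁ η) ▷ h = eqToHom (Strict.assoc k f h) ≫ k ◁ (η ▷ h) ≫
      eqToHom (Strict.assoc k g h).symm := by
  simp [Strict.associator_eqToIso]

theorem id_whiskerLeft_eq {a b : C} {f g : a ⟶ b} (η : f ⟶ g) :
    𝟙 a ◁ η = eqToHom (Strict.id_comp f) ≫ η ≫ eqToHom (Strict.id_comp g).symm := by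
  simp [Strict.leftUnitor_eqToIso]

/-- The modification given by precomposition with a 2-cell. -/
def reprMap₂ {A B : C} {f g : A ⟶ B} (α : f ⟶ g) : reprMap f ⟶ reprMap g :=
  TwoNatTrans.homMk (fun D => ((precomposing A B D).map α).toCatHom₂) (fun k => by
    ext h
    rw [Cat.Hom₂.comp_app, Cat.Hom₂.comp_app, Cat.eqToHom_app, Cat.eqToHom_app]
    exact comp_whiskerRight_eq α h k)

/-- The Yoneda 2-functor `A ↦ C(A, -)` from `Cᵒᵖ` to `Hom(C, Cat)`. -/
def yoneda₂ (C : Type u) [Bicategory.{w, w} C] [Strict C] :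
    StrictPseudofunctor Cᵒᵖ (StrictPseudofunctor C Cat.{w, w}) := StrictPseudofunctor.mk''
  { obj := fun A => repr A.unop
    map := fun f => reprMap f.unop
    map₂ := fun α => reprMap₂ α.unop2
    map₂_id := fun f => modification_ext fun D =>
      congrArg NatTrans.toCatHom₂ ((precomposing _ _ D).map_id f.unop)
    map₂_comp := fun α β => modification_ext fun D =>
      congrArg NatTrans.toCatHom₂ ((precomposing _ _ D).map_comp α.unop2 β.unop2)
    map_id := fun A => TwoNatTrans.ext' fun D => Cat.Hom.ext
      (CategoryTheory.Functor.ext (fun f => Strict.id_comp f) fun _ _ η => id_whiskerLeft_eq η)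
    map_comp := fun f g => TwoNatTrans.ext' fun D => Cat.Hom.ext
      (CategoryTheory.Functor.ext (fun h => Strict.assoc g.unop f.unop h) fun _ _ η =>
        whiskerRight_comp_eq' g.unop f.unop η)
    map₂_whisker_left := fun f g g' η => modification_ext fun D => by
      rw [comp_as_app, comp_as_app, eqToHom_as_app, eqToHom_as_app]
      ext k
      rw [Cat.Hom₂.comp_app, Cat.Hom₂.comp_app, Cat.eqToHom_app, Cat.eqToHom_app]
      exact whiskerRight_whiskerRight_eq η.unop2 f.unop k
    map₂_whisker_right := fun η h => modification_ext fun D => by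
      rw [comp_as_app, comp_as_app, eqToHom_as_app, eqToHom_as_app]
      ext k
      rw [Cat.Hom₂.comp_app, Cat.Hom₂.comp_app, Cat.eqToHom_app, Cat.eqToHom_app]
      exact whiskerLeft_whiskerRight_eq' h.unop η.unop2 k }

end Representables

section RightOp
variable {I : Type u₁} [Bicategory.{w₁, v₁} I] [Strict I]
  {C : Type u₂} [Bicategory.{w₂, v₂} C] [Strict C]

/-- The 2-functor `I ⥤ Cᵒᵖ` with the same values as `X : Iᵒᵖ ⥤ C`. -/
def rightOp (X : StrictPseudofunctor Iᵒᵖ C) : StrictPseudofunctor I Cᵒᵖ :=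
  StrictPseudofunctor.mk''
  { obj := fun i => op (X.obj (op i))
    map := fun u => (X.map u.op).op
    map₂ := fun α => Bicategory.Opposite.op2 (X.map₂ (Bicategory.Opposite.op2 α))
    map₂_id := fun f => congrArg Bicategory.Opposite.op2 (X.map₂_id f.op)
    map₂_comp := fun α β => congrArg Bicategory.Opposite.op2 (X.map₂_comp
      (Bicategory.Opposite.op2 α) (Bicategory.Opposite.op2 β))
    map_id := fun i => congrArg Quiver.Hom.op (X.map_id (op i))
    map_comp := fun f g => congrArg Quiver.Hom.op (X.map_comp g.op f.op)
    map₂_whisker_left := fun f g g' η => by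
      rw [Bicategory.Opposite.op2_whiskerLeft, X.map₂_whisker_right]
      simp [X.mapComp_eq_eqToIso, op2_eqToHom]
    map₂_whisker_right := fun {a b c} {f f'} η h => by
      rw [Bicategory.Opposite.op2_whiskerRight, X.map₂_whisker_left]
      simp [X.mapComp_eq_eqToIso, op2_eqToHom] }
end RightOp

/-- A 2-pro-object of `C`: a small 2-filtered 2-category `I` and a 2-functor `Iᵒᵖ ⥤ C`. -/
structure TwoProObj (C : Type u) [Bicategory.{w, w} C] : Type (max u (w+1)) where
  Index : Type w
  [bicategory : Bicategory.{w, w} Index]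
  [strict : Strict Index]
  isTwoFiltered : IsTwoFiltered Index
  diagram : StrictPseudofunctor Indexᵒᵖ C

attribute [instance] TwoProObj.bicategory TwoProObj.strict

section Colim
variable {C : Type u} [Bicategory.{w, w} C] {I : Type w} [Bicategory.{w, w} I]

/-! For a 2-functor `X : Iᵒᵖ ⥤ C`, the 2-functor `colim X : C ⥤ Cat`, which is the pseudocolimit of
the representables `C(X_i, -)` over `i` in `I`. Its value at `D` is the category presented by
generators and relations below; for the universal property see
`TwoProObj.isPseudocolimit_cocone`. -/

namespace Colim

/-- Objects over `D`: pairs `(i, f)` with `f : X_i ⟶ D`. -/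
structure Obj (X : StrictPseudofunctor Iᵒᵖ C) (D : C) : Type w where
  idx : I
  hom : X.obj (op idx) ⟶ D

/-- Formal composites of the generating arrows: the 2-cells `f ⟶ g` of `C(X_i, D)`, and for each
`u : i ⟶ j` arrows in both directions between `(i, f)` and its translate `(j, X_u ≫ f)`. -/
inductive Word (X : StrictPseudofunctor Iᵒᵖ C) (D : C) : Obj X D → Obj X D → Type w
  | id (a : Obj X D) : Word X D a a
  | comp {a b c : Obj X D} (p : Word X D a b) (q : Word X D b c) : Word X D a c
  | incl (i : I) {f g : X.obj (op i) ⟶ D} (α : f ⟶ g) : Word X D ⟨i, f⟩ ⟨i, g⟩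
  | glue {i j : I} (u : i ⟶ j) (f : X.obj (op i) ⟶ D) : Word X D ⟨i, f⟩ ⟨j, X.map u.op ≫ f⟩
  | glueInv {i j : I} (u : i ⟶ j) (f : X.obj (op i) ⟶ D) : Word X D ⟨j, X.map u.op ≫ f⟩ ⟨i, f⟩

/-- The congruence generated by: the category laws, functoriality of `incl`, `glueInv` being inverse
to `glue`, naturality of `glue u` in `f`, and coherence of `glue` with identities, composites and
2-cells of `I`. -/
inductive Rel (X : StrictPseudofunctor Iᵒᵖ C) (D : C) :
    ∀ {a b : Obj X D}, Word X D a b → Word X D a b → Prop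
  | refl {a b : Obj X D} (p : Word X D a b) : Rel X D p p
  | symm {a b : Obj X D} {p q : Word X D a b} : Rel X D p q → Rel X D q p
  | trans {a b : Obj X D} {p q r : Word X D a b} : Rel X D p q → Rel X D q r → Rel X D p r
  | comp {a b c : Obj X D} {p p' : Word X D a b} {q q' : Word X D b c} :
      Rel X D p p' → Rel X D q q' → Rel X D (p.comp q) (p'.comp q')
  | id_comp {a b : Obj X D} (p : Word X D a b) : Rel X D ((Word.id a).comp p) p
  | comp_id {a b : Obj X D} (p : Word X D a b) : Rel X D (p.comp (Word.id b)) p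
  | assoc {a b c d : Obj X D} (p : Word X D a b) (q : Word X D b c) (r : Word X D c d) :
      Rel X D ((p.comp q).comp r) (p.comp (q.comp r))
  | incl_id (i : I) (f : X.obj (op i) ⟶ D) : Rel X D (Word.incl i (𝟙 f)) (Word.id ⟨i, f⟩)
  | incl_comp (i : I) {f g h : X.obj (op i) ⟶ D} (α : f ⟶ g) (β : g ⟶ h) :
      Rel X D (Word.incl i (α ≫ β)) ((Word.incl i α).comp (Word.incl i β))
  | glue_glueInv {i j : I} (u : i ⟶ j) (f : X.obj (op i) ⟶ D) :
      Rel X D ((Word.glue u f).comp (Word.glueInv u f)) (Word.id _)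
  | glueInv_glue {i j : I} (u : i ⟶ j) (f : X.obj (op i) ⟶ D) :
      Rel X D ((Word.glueInv u f).comp (Word.glue u f)) (Word.id _)
  | glue_naturality {i j : I} (u : i ⟶ j) {f g : X.obj (op i) ⟶ D} (α : f ⟶ g) :
      Rel X D ((Word.incl i α).comp (Word.glue u g))
        ((Word.glue u f).comp (Word.incl j (X.map u.op ◁ α)))
  | glue_id (i : I) (f : X.obj (op i) ⟶ D) :
      Rel X D ((Word.glue (𝟙 i) f).comp
        (Word.incl i ((X.mapId (op i)).hom ▷ f ≫ (λ_ f).hom))) (Word.id _)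
  | glue_comp {i j k : I} (u : i ⟶ j) (v : j ⟶ k) (f : X.obj (op i) ⟶ D) :
      Rel X D ((Word.glue (u ≫ v) f).comp
          (Word.incl k ((X.mapComp v.op u.op).hom ▷ f ≫ (α_ _ _ f).hom)))
        ((Word.glue u f).comp (Word.glue v (X.map u.op ≫ f)))
  | glue_two_cell {i j : I} {u v : i ⟶ j} (η : u ⟶ v) (f : X.obj (op i) ⟶ D) :
      Rel X D ((Word.glue u f).comp
        (Word.incl j (X.map₂ (Bicategory.Opposite.op2 η) ▷ f))) (Word.glue v f)

instance setoid (X : StrictPseudofunctor Iᵒᵖ C) (D : C) (a b : Obj X D) :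
    Setoid (Word X D a b) where
  r := Rel X D
  iseqv := ⟨Rel.refl, Rel.symm, Rel.trans⟩

instance (X : StrictPseudofunctor Iᵒᵖ C) (D : C) : Category.{w} (Obj X D) where
  Hom a b := Quotient (setoid X D a b)
  id a := Quotient.mk _ (Word.id a)
  comp := Quotient.map₂ Word.comp fun _ _ h _ _ h' => Rel.comp h h'
  id_comp := by rintro a b ⟨p⟩; exact Quotient.sound (Rel.id_comp p)
  comp_id := by rintro a b ⟨p⟩; exact Quotient.sound (Rel.comp_id p)
  assoc := by rintro a b c d ⟨p⟩ ⟨q⟩ ⟨r⟩; exact Quotient.sound (Rel.assoc p q r)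

variable {X : StrictPseudofunctor Iᵒᵖ C}

section Gen
variable (X) {D : C}

/-- The canonical functor from `C(X_i, D)`. -/
def incl (i : I) (D : C) : (X.obj (op i) ⟶ D) ⥤ Obj X D where
  obj f := ⟨i, f⟩
  map α := Quotient.mk _ (Word.incl i α)
  map_id f := Quotient.sound (Rel.incl_id i f)
  map_comp α β := Quotient.sound (Rel.incl_comp i α β)

/-- The canonical isomorphism from `(i, f)` to `(j, X_u ≫ f)`. -/
def glue {i j : I} (u : i ⟶ j) (f : X.obj (op i) ⟶ D) :
    (incl X i D).obj f ≅ (incl X j D).obj (X.map u.op ≫ f) where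
  hom := Quotient.mk _ (Word.glue u f)
  inv := Quotient.mk _ (Word.glueInv u f)
  hom_inv_id := Quotient.sound (Rel.glue_glueInv u f)
  inv_hom_id := Quotient.sound (Rel.glueInv_glue u f)

theorem glue_naturality' {i j : I} (u : i ⟶ j) {f g : X.obj (op i) ⟶ D} (α : f ⟶ g) :
    (incl X i D).map α ≫ (glue X u g).hom =
      (glue X u f).hom ≫ (incl X j D).map (X.map u.op ◁ α) :=
  Quotient.sound (Rel.glue_naturality u α)

theorem glue_id' (i : I) (f : X.obj (op i) ⟶ D) :
    (glue X (𝟙 i) f).hom ≫ (incl X i D).map ((X.mapId (op i)).hom ▷ f ≫ (λ_ f).hom) = 𝟙 _ :=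
  Quotient.sound (Rel.glue_id i f)

theorem glue_comp' {i j k : I} (u : i ⟶ j) (v : j ⟶ k) (f : X.obj (op i) ⟶ D) :
    (glue X (u ≫ v) f).hom ≫ (incl X k D).map ((X.mapComp v.op u.op).hom ▷ f ≫ (α_ _ _ f).hom) =
      (glue X u f).hom ≫ (glue X v (X.map u.op ≫ f)).hom :=
  Quotient.sound (Rel.glue_comp u v f)

theorem glue_two_cell' {i j : I} {u v : i ⟶ j} (η : u ⟶ v) (f : X.obj (op i) ⟶ D) :
    (glue X u f).hom ≫ (incl X j D).map (X.map₂ (Bicategory.Opposite.op2 η) ▷ f) =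
      (glue X v f).hom :=
  Quotient.sound (Rel.glue_two_cell η f)

theorem hom_induction {P : ∀ {a b : Obj X D}, (a ⟶ b) → Prop}
    (id : ∀ a, P (𝟙 a))
    (comp : ∀ {a b c : Obj X D} (p : a ⟶ b) (q : b ⟶ c), P p → P q → P (p ≫ q))
    (incl : ∀ (i : I) {f g : X.obj (op i) ⟶ D} (α : f ⟶ g), P ((incl X i D).map α))
    (glue : ∀ {i j : I} (u : i ⟶ j) (f : X.obj (op i) ⟶ D), P (glue X u f).hom)
    (glueInv : ∀ {i j : I} (u : i ⟶ j) (f : X.obj (op i) ⟶ D), P (Colim.glue X u f).inv)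
    {a b : Obj X D} (p : a ⟶ b) : P p := by
  revert p
  refine Quotient.ind fun p => ?_
  induction p with
  | id a => exact id a
  | comp p q hp hq => exact comp _ _ hp hq
  | incl i α => exact incl i α
  | glue u f => exact glue u f
  | glueInv u f => exact glueInv u f

/-- `glue` followed by the image of a 2-cell. -/
def ginc {i j : I} (u : i ⟶ j) (f : X.obj (op i) ⟶ D) {g : X.obj (op j) ⟶ D}
    (α : X.map u.op ≫ f ⟶ g) : (incl X i D).obj f ⟶ (incl X j D).obj g :=
  (glue X u f).hom ≫ (incl X j D).map α

theorem ginc_incl {i j : I} (u : i ⟶ j) (f : X.obj (op i) ⟶ D) {g k : X.obj (op j) ⟶ D}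
    (α : X.map u.op ≫ f ⟶ g) (β : g ⟶ k) :
    ginc X u f α ≫ (incl X j D).map β = ginc X u f (α ≫ β) := by
  simp [ginc]

theorem incl_ginc {i j : I} (u : i ⟶ j) {f f' : X.obj (op i) ⟶ D} {g : X.obj (op j) ⟶ D}
    (β : f ⟶ f') (α : X.map u.op ≫ f' ⟶ g) :
    (incl X i D).map β ≫ ginc X u f' α = ginc X u f (X.map u.op ◁ β ≫ α) := by
  rw [ginc, ← Category.assoc, glue_naturality', ginc, Functor.map_comp, Category.assoc]

theorem ginc_ginc {i j k : I} (u : i ⟶ j) (v : j ⟶ k) {f : X.obj (op i) ⟶ D}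
    {g : X.obj (op j) ⟶ D} {h : X.obj (op k) ⟶ D} (α : X.map u.op ≫ f ⟶ g)
    (β : X.map v.op ≫ g ⟶ h) :
    ginc X u f α ≫ ginc X v g β = ginc X (u ≫ v) f
      ((X.mapComp v.op u.op).hom ▷ f ≫ (α_ _ _ f).hom ≫ X.map v.op ◁ α ≫ β) := by
  have h₁ : ginc X (u ≫ v) f ((X.mapComp v.op u.op).hom ▷ f ≫ (α_ _ _ f).hom) =
    (glue X u f).hom ≫ (glue X v (X.map u.op ≫ f)).hom := glue_comp' X u v f
  calc ginc X u f α ≫ ginc X v g β = (glue X u f).hom ≫ (incl X j D).map α ≫ ginc X v g β :=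
        Category.assoc _ _ _
    _ = (glue X u f).hom ≫ (glue X v _).hom ≫ (incl X k D).map (X.map v.op ◁ α ≫ β) := by
        rw [incl_ginc]; rfl
    _ = ginc X (u ≫ v) f ((X.mapComp v.op u.op).hom ▷ f ≫ (α_ _ _ f).hom) ≫
          (incl X k D).map (X.map v.op ◁ α ≫ β) := by rw [h₁, Category.assoc]
    _ = _ := by
        rw [ginc_incl]
        exact congrArg (ginc X (u ≫ v) f) (by simp only [Category.assoc])

theorem ginc_id (i : I) (f : X.obj (op i) ⟶ D) :
    ginc X (𝟙 i) f ((X.mapId (op i)).hom ▷ f ≫ (λ_ f).hom) = 𝟙 _ :=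
  glue_id' X i f

theorem ginc_two {i j : I} {u v : i ⟶ j} (η : u ⟶ v) (f : X.obj (op i) ⟶ D)
    {g : X.obj (op j) ⟶ D} (α : X.map v.op ≫ f ⟶ g) :
    ginc X u f (X.map₂ (Bicategory.Opposite.op2 η) ▷ f ≫ α) = ginc X v f α := by
  rw [ginc, Functor.map_comp, ← Category.assoc, glue_two_cell', ginc]

end Gen

section Desc
variable {D : C} {E : Type u₁} [Category.{v₁} E]
  (H : ∀ i : I, (X.obj (op i) ⟶ D) ⥤ E)
  (σ : ∀ {i j : I} (u : i ⟶ j) (f : X.obj (op i) ⟶ D), (H i).obj f ≅ (H j).obj (X.map u.op ≫ f))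

/-- Object part of `desc`. -/
def evalObj (a : Obj X D) : E := (H a.idx).obj a.hom

/-- Interpretation of formal composites in `E`. -/
def Word.eval : ∀ {a b : Obj X D}, Word X D a b → (evalObj H a ⟶ evalObj H b)
  | _, _, .id a => 𝟙 _
  | _, _, .comp p q => Word.eval p ≫ Word.eval q
  | _, _, .incl i α => (H i).map α
  | _, _, .glue u f => (σ u f).hom
  | _, _, .glueInv u f => (σ u f).inv

/-- The functor out of the presented category determined by the images of the generators. -/
def desc
    (hnat : ∀ {i j : I} (u : i ⟶ j) {f g : X.obj (op i) ⟶ D} (α : f ⟶ g),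
      (H i).map α ≫ (σ u g).hom = (σ u f).hom ≫ (H j).map (X.map u.op ◁ α))
    (hid : ∀ (i : I) (f : X.obj (op i) ⟶ D),
      (σ (𝟙 i) f).hom ≫ (H i).map ((X.mapId (op i)).hom ▷ f ≫ (λ_ f).hom) = 𝟙 _)
    (hcomp : ∀ {i j k : I} (u : i ⟶ j) (v : j ⟶ k) (f : X.obj (op i) ⟶ D),
      (σ (u ≫ v) f).hom ≫ (H k).map ((X.mapComp v.op u.op).hom ▷ f ≫ (α_ _ _ f).hom) =
        (σ u f).hom ≫ (σ v (X.map u.op ≫ f)).hom)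
    (htwo : ∀ {i j : I} {u v : i ⟶ j} (η : u ⟶ v) (f : X.obj (op i) ⟶ D),
      (σ u f).hom ≫ (H j).map (X.map₂ (Bicategory.Opposite.op2 η) ▷ f) = (σ v f).hom) :
    Obj X D ⥤ E where
  obj := evalObj H
  map := Quotient.lift (Word.eval H σ) fun p q h => by
    induction h with
    | refl p => rfl
    | symm _ h => exact h.symm
    | trans _ _ h h' => exact h.trans h'
    | comp _ _ h h' => exact congrArg₂ (· ≫ ·) h h'
    | id_comp p => exact Category.id_comp _
    | comp_id p => exact Category.comp_id _
    | assoc p q r => exact Category.assoc _ _ _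
    | incl_id i f => exact (H i).map_id f
    | incl_comp i α β => exact (H i).map_comp α β
    | glue_glueInv u f => exact (σ u f).hom_inv_id
    | glueInv_glue u f => exact (σ u f).inv_hom_id
    | glue_naturality u α => exact hnat u α
    | glue_id i f => exact hid i f
    | glue_comp u v f => exact hcomp u v f
    | glue_two_cell η f => exact htwo η f
  map_id _ := rfl
  map_comp := by rintro a b c ⟨p⟩ ⟨q⟩; rfl

end Desc

section Ext
variable {D : C} {E : Type u₁} [Category.{v₁} E] {F G : Obj X D ⥤ E}

/-- Natural transformations may be checked on generators. -/
def natTransMk (app : ∀ a, F.obj a ⟶ G.obj a)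
    (hincl : ∀ (i : I) {f g : X.obj (op i) ⟶ D} (α : f ⟶ g),
      F.map ((incl X i D).map α) ≫ app _ = app _ ≫ G.map ((incl X i D).map α))
    (hglue : ∀ {i j : I} (u : i ⟶ j) (f : X.obj (op i) ⟶ D),
      F.map (glue X u f).hom ≫ app _ = app _ ≫ G.map (glue X u f).hom) : F ⟶ G where
  app := app
  naturality a b p := by
    induction p using hom_induction with
    | id a => simp
    | comp p q hp hq => simp [reassoc_of% hp, hq]
    | incl i α => exact hincl i α
    | glue u f => exact hglue u f
    | glueInv u f =>
      rw [← cancel_epi (F.map (glue X u f).hom), ← Category.assoc, ← F.map_comp, Iso.hom_inv_id,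
        reassoc_of% (hglue u f), ← G.map_comp, Iso.hom_inv_id]
      simp

theorem functor_ext (hobj : ∀ a, F.obj a = G.obj a)
    (hincl : ∀ (i : I) {f g : X.obj (op i) ⟶ D} (α : f ⟶ g),
      F.map ((incl X i D).map α) ≫ eqToHom (hobj _) =
        eqToHom (hobj _) ≫ G.map ((incl X i D).map α))
    (hglue : ∀ {i j : I} (u : i ⟶ j) (f : X.obj (op i) ⟶ D),
      F.map (glue X u f).hom ≫ eqToHom (hobj _) = eqToHom (hobj _) ≫ G.map (glue X u f).hom) :
    F = G :=
  CategoryTheory.Functor.ext hobj fun a b p => by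
    have h : F.map p ≫ eqToHom (hobj b) = eqToHom (hobj a) ≫ G.map p :=
      (natTransMk (fun a => eqToHom (hobj a)) hincl hglue).naturality p
    rw [← reassoc_of% h]
    simp

end Ext

section Functoriality
variable [Strict C] (X)

/-- The functor `(i, f) ↦ (i, f ≫ h)`. -/
def postcompose {D E : C} (h : D ⟶ E) : Obj X D ⥤ Obj X E :=
  desc (fun i => postcomp _ h ⋙ incl X i E)
    (fun {i j} u f => glue X u (f ≫ h) ≪≫ (incl X j E).mapIso (α_ _ f h).symm)
    (fun {i j} u f g α => (incl_ginc X u (α ▷ h) (α_ _ g h).inv).trans <|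
      (congrArg (ginc X u (f ≫ h)) (by simp)).trans
        (ginc_incl X u (f ≫ h) (α_ _ f h).inv ((X.map u.op ◁ α) ▷ h)).symm)
    (fun i f => (ginc_incl X (𝟙 i) (f ≫ h) (α_ _ f h).inv
        (((X.mapId (op i)).hom ▷ f ≫ (λ_ f).hom) ▷ h)).trans <|
      (congrArg (ginc X (𝟙 i) (f ≫ h)) (by simp)).trans (ginc_id X i (f ≫ h)))
    (fun {i j k} u v f => (ginc_incl X (u ≫ v) (f ≫ h) (α_ _ f h).inv
        (((X.mapComp v.op u.op).hom ▷ f ≫ (α_ _ _ f).hom) ▷ h)).trans <|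
      (congrArg (ginc X (u ≫ v) (f ≫ h)) (by simp)).trans
        (ginc_ginc X u v (α_ _ f h).inv (α_ _ _ h).inv).symm)
    (fun {i j u v} η f => (ginc_incl X u (f ≫ h) (α_ _ f h).inv
        ((X.map₂ (Bicategory.Opposite.op2 η) ▷ f) ▷ h)).trans <|
      (congrArg (ginc X u (f ≫ h)) (by simp)).trans (ginc_two X η (f ≫ h) (α_ _ f h).inv))


theorem postcompose_ginc {D E : C} (h : D ⟶ E) {i j : I} (u : i ⟶ j) (f : X.obj (op i) ⟶ D)
    {g : X.obj (op j) ⟶ D} (α : X.map u.op ≫ f ⟶ g) :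
    (postcompose X h).map (ginc X u f α) =
      ginc X u (f ≫ h) ((α_ _ f h).inv ≫ α ▷ h) :=
  ginc_incl X u (f ≫ h) (α_ _ f h).inv (α ▷ h)

/-- The natural transformation given at `(i, f)` by `f ◁ β`. -/
def postcompose₂ {D E : C} {h k : D ⟶ E} (β : h ⟶ k) : postcompose X h ⟶ postcompose X k :=
  natTransMk (fun a => (incl X a.idx E).map (a.hom ◁ β))
    (fun i f g α => by
      exact ((incl X i E).map_comp _ _).symm.trans
        ((congrArg (incl X i E).map (whisker_exchange α β).symm).trans
          ((incl X i E).map_comp _ _)))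
    (fun {i j} u f => by
      exact (ginc_incl X u (f ≫ h) (α_ _ f h).inv ((X.map u.op ≫ f) ◁ β)).trans <|
        (congrArg (ginc X u (f ≫ h)) (by simp)).trans
        (incl_ginc X u (f ◁ β) (α_ _ f k).inv).symm)

theorem glue_eq_ginc {D : C} {i j : I} (u : i ⟶ j) (f : X.obj (op i) ⟶ D) :
    (glue X u f).hom = ginc X u f (𝟙 _) := by
  simp [ginc]

theorem incl_eqToHom {D : C} {i : I} {f g : X.obj (op i) ⟶ D} (h : f = g) :
    (incl X i D).map (eqToHom h) = eqToHom (congrArg (Obj.mk i) h) := by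
  subst h; exact (incl X i D).map_id f

theorem incl_square {D : C} {i : I} {f g f' g' : X.obj (op i) ⟶ D} (α : f ⟶ g) (α' : f' ⟶ g')
    (hf : f = f') (hg : g = g') (h : α ≫ eqToHom hg = eqToHom hf ≫ α') :
    (incl X i D).map α ≫ eqToHom (congrArg (Obj.mk i) hg) =
      eqToHom (congrArg (Obj.mk i) hf) ≫ (incl X i D).map α' := by
  subst hf hg
  obtain rfl : α = α' := by simpa using h
  exact (Category.comp_id _).trans (Category.id_comp _).symm

theorem incl_conj {D : C} {i : I} {f g f' g' : X.obj (op i) ⟶ D} (α : f ⟶ g) (α' : f' ⟶ g')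
    (hf : f = f') (hg : g = g') (h : α = eqToHom hf ≫ α' ≫ eqToHom hg.symm) :
    (incl X i D).map α = eqToHom (congrArg (Obj.mk i) hf) ≫ (incl X i D).map α' ≫
      eqToHom (congrArg (Obj.mk i) hg.symm) := by
  subst hf hg
  obtain rfl : α = α' := by simpa using h
  exact ((Category.id_comp _).trans (Category.comp_id _)).symm

theorem ginc_square {D : C} {i j : I} (u : i ⟶ j) {f f' : X.obj (op i) ⟶ D}
    {g g' : X.obj (op j) ⟶ D} (α : X.map u.op ≫ f ⟶ g) (α' : X.map u.op ≫ f' ⟶ g')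
    (hf : f = f') (hg : g = g')
    (h : α ≫ eqToHom hg = eqToHom (congrArg (X.map u.op ≫ ·) hf) ≫ α') :
    ginc X u f α ≫ eqToHom (congrArg (Obj.mk j) hg) =
      eqToHom (congrArg (Obj.mk i) hf) ≫ ginc X u f' α' := by
  subst hf hg
  obtain rfl : α = α' := by simpa using h
  exact (Category.comp_id _).trans (Category.id_comp _).symm

/-- The 2-functor `D ↦ Obj X D`. -/
def colim : StrictPseudofunctor C Cat.{w, w} := StrictPseudofunctor.mk''
  { obj := fun D => Cat.of (Obj X D)
    map := fun h => (postcompose X h).toCatHom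
    map₂ := fun β => (postcompose₂ X β).toCatHom₂
    map₂_id := fun h => by
      ext a
      exact (congrArg (incl X a.idx _).map (whiskerLeft_id _ _)).trans ((incl X a.idx _).map_id _)
    map₂_comp := fun β γ => by
      ext a
      exact (congrArg (incl X a.idx _).map (whiskerLeft_comp _ _ _)).trans
        ((incl X a.idx _).map_comp _ _)
    map_id := fun D => Cat.Hom.ext <| functor_ext
      (fun a => congrArg (Obj.mk a.idx) (Strict.comp_id a.hom))
      (fun i f g α => by
        exact incl_square X (α ▷ 𝟙 D) α (Strict.comp_id f) (Strict.comp_id g)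
          (by simp [whiskerRight_id, Strict.rightUnitor_eqToIso]))
      (fun u f => by
        rw [glue_eq_ginc]
        refine (congrArg (· ≫ _) (postcompose_ginc X (𝟙 D) u f (𝟙 _))).trans ?_
        exact ginc_square X u _ (𝟙 _) (Strict.comp_id f) (Strict.comp_id _)
          (by simp [Strict.associator_eqToIso]))
    map_comp := fun h k => Cat.Hom.ext <| functor_ext
      (fun a => congrArg (Obj.mk a.idx) (Strict.assoc a.hom h k).symm)
      (fun i f g α => by
        exact incl_square X (α ▷ (h ≫ k)) ((α ▷ h) ▷ k) (Strict.assoc f h k).symm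
          (Strict.assoc g h k).symm (by simp [Strict.associator_eqToIso]))
      (fun u f => by
        rw [glue_eq_ginc]
        refine (congrArg (· ≫ _) (postcompose_ginc X (h ≫ k) u f (𝟙 _))).trans ?_
        refine Eq.trans ?_ (congrArg (_ ≫ ·) ((congrArg (postcompose X k).map
          (postcompose_ginc X h u f (𝟙 _))).trans (postcompose_ginc X k u (f ≫ h) _)).symm)
        exact ginc_square X u _ _ (Strict.assoc f h k).symm (Strict.assoc _ h k).symm
          (by simp [Strict.associator_eqToIso]))
    map₂_whisker_left := fun f g g' η => by
      ext a
      rw [Cat.Hom₂.comp_app, Cat.Hom₂.comp_app, Cat.eqToHom_app, Cat.eqToHom_app]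
      exact incl_conj X _ _ (Strict.assoc _ _ _).symm (Strict.assoc _ _ _).symm
        (whiskerLeft_whiskerLeft_eq a.hom f η)
    map₂_whisker_right := fun η h => by
      ext a
      rw [Cat.Hom₂.comp_app, Cat.Hom₂.comp_app, Cat.eqToHom_app, Cat.eqToHom_app]
      exact incl_conj X _ _ (Strict.assoc _ _ _).symm (Strict.assoc _ _ _).symm
        (whiskerLeft_whiskerRight_eq a.hom η h) }

end Functoriality

end Colim
end Colim

section
variable (C : Type u) [Bicategory.{w, w} C] [Strict C]

/-- The diagram `i ↦ C(X_i, -)` of representable 2-functors. -/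
def TwoProObj.reprDiagram {C : Type u} [Bicategory.{w, w} C] [Strict C] (X : TwoProObj C) :
    StrictPseudofunctor X.Index (StrictPseudofunctor C Cat.{w, w}) :=
  (rightOp X.diagram).comp (yoneda₂ C)

/-- The 2-functor `L X : C ⥤ Cat`, the pseudocolimit of `C(X_i, -)` over the index `i`. -/
def TwoProObj.L {C : Type u} [Bicategory.{w, w} C] [Strict C] (X : TwoProObj C) :
    StrictPseudofunctor C Cat.{w, w} := Colim.colim X.diagram

/-- The 2-category `2-Pro(C)`: its objects are the 2-pro-objects, and its hom-category from `X` to `Y`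
is `Hom(C, Cat)(L Y, L X)`, with the composition of `Hom(C, Cat)ᵒᵖ`. -/
abbrev TwoProCat :=
  InducedBicategory (StrictPseudofunctor C Cat.{w, w})ᵒᵖ fun X : TwoProObj C => op X.L

/-- The objects of `Hom(C, Cat)_fc`: the 2-functors `C ⥤ Cat` which are pseudocolimits of a small
2-filtered diagram `i ↦ C(X_i, -)` of representable 2-functors. -/
def IsFC {C : Type u} [Bicategory.{w, w} C] [Strict C] (G : StrictPseudofunctor C Cat.{w, w}) :
    Prop :=
  ∃ (X : TwoProObj C) (l : X.reprDiagram.toPseudofunctor ⟶ const X.Index G), IsPseudocolimit l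

end

/-! The universal property of `L X`. -/

section Universal

theorem isIsoOfCategories_of {X : Type u₁} [Category.{v₁} X] {Y : Type u₂} [Category.{v₂} Y]
    (F : X ⥤ Y) [F.Full] [F.Faithful] (h : Function.Bijective F.obj) : IsIsoOfCategories F := by
  obtain ⟨g, hg₁, hg₂⟩ := Function.bijective_iff_has_inverse.1 h
  refine ⟨{ obj := g
            map := fun {a b} f => F.preimage (eqToHom (hg₂ a) ≫ f ≫ eqToHom (hg₂ b).symm)
            map_id := fun a => F.map_injective (by simp)
            map_comp := fun f f' => F.map_injective (by simp) }, ?_, ?_⟩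
  · exact CategoryTheory.Functor.ext hg₁ fun a b f => F.map_injective (by simp [eqToHom_map])
  · exact CategoryTheory.Functor.ext hg₂ fun a b f => by simp

variable {C : Type u} [Bicategory.{w, w} C] [Strict C]

theorem comp_cancel {E : Type u₁} [Category.{v₁} E] {a b c : E} (e : a ≅ b) (e' : b ≅ c) :
    (e.hom ≫ e'.hom) ≫ 𝟙 c ≫ e'.inv ≫ 𝟙 b ≫ e.inv = 𝟙 a := by simp

theorem square_of_inv {E : Type u₁} [Category.{v₁} E] {E' : Type u₂} [Category.{v₂} E']
    (F G : E ⥤ E') {a b : E} (e : a ≅ b) {p : F.obj a ⟶ G.obj a} {q : F.obj b ⟶ G.obj b}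
    (h : q ≫ G.map e.inv = F.map e.inv ≫ p) : F.map e.hom ≫ q = p ≫ G.map e.hom := by
  rw [← cancel_mono (G.map e.inv), Category.assoc, h, Category.assoc, ← F.map_comp_assoc,
    ← G.map_comp]
  simp

theorem square_of_inv_eq {E : Type u₁} [Category.{v₁} E] {E' : Type u₂} [Category.{v₂} E']
    (F G : E ⥤ E') {a b : E} (e : a ≅ b) (ha : F.obj a = G.obj a) (hb : F.obj b = G.obj b)
    (h : F.map e.inv = eqToHom hb ≫ G.map e.inv ≫ eqToHom ha.symm) :
    F.map e.hom ≫ eqToHom hb = eqToHom ha ≫ G.map e.hom :=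
  square_of_inv F G e (by rw [h]; simp)

theorem square_of_conj {E : Type u₁} [Category.{v₁} E] {a b a' b' : E} {p : a ⟶ b} {q : a' ⟶ b'}
    {ha : a = a'} {hb : b' = b} (h : p = eqToHom ha ≫ q ≫ eqToHom hb) :
    p ≫ eqToHom hb.symm = eqToHom ha ≫ q := by
  rw [h]; simp

theorem congr_three {E : Type u₁} [Category.{v₁} E] {a b : E} (p : a ⟶ b) :
    p ≫ 𝟙 b ≫ 𝟙 b = p := by simp

theorem comp_aux {E : Type u₁} [Category.{v₁} E] {a b c c' : E} (e : a ≅ c') (e₁ : a ≅ b)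
    (e₂ : b ≅ c) {p : c' ⟶ c} (h : e.inv ≫ 𝟙 a = p ≫ 𝟙 c ≫ e₂.inv ≫ 𝟙 b ≫ e₁.inv ≫ 𝟙 a) :
    e.hom ≫ p = e₁.hom ≫ e₂.hom := by
  simp only [Category.comp_id, Category.id_comp] at h
  rw [← cancel_mono e₂.inv, ← cancel_mono e₁.inv]
  simp [← h]

theorem two_aux {E : Type u₁} [Category.{v₁} E] {a b c : E} (e : a ≅ b) (e' : a ≅ c)
    {p : b ⟶ c} (h : p ≫ e'.inv = e.inv ≫ 𝟙 a) : e.hom ≫ p = e'.hom := by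
  rw [← cancel_mono e'.inv, Category.assoc, h]
  simp

theorem lift_aux {E : Type u₁} [Category.{v₁} E] {a b c a' d' : E} {p : a ⟶ b} {q : b ⟶ c}
    {r : a' ⟶ d'} {h₁ : a = a'} {h₂ : d' = b} {h₃ : b = c} {h₄ : c = d'} (hp : p = eqToHom h₁ ≫ r ≫ eqToHom h₂)
    (hq : q = eqToHom h₃) : (p ≫ q) ≫ eqToHom h₄ = eqToHom h₁ ≫ r := by
  rw [hp, hq]; simp

/-- The component of a modification at an object `x` of `F D`. -/
abbrev comp₂ {F G : StrictPseudofunctor C Cat.{w, w}} {θ η : F ⟶ G} (ρ : θ ⟶ η) (D : C)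
    (x : F.obj D) : (θ.trans.app D).toFunctor.obj x ⟶ (η.trans.app D).toFunctor.obj x :=
  (Pseudofunctor.StrongTrans.Modification.app
    (Pseudofunctor.StrongTrans.Hom.as ρ) D).toNatTrans.app x

theorem comp₂_ext {F G : StrictPseudofunctor C Cat.{w, w}} {θ η : F ⟶ G} {ρ σ : θ ⟶ η}
    (h : ∀ D x, comp₂ ρ D x = comp₂ σ D x) : ρ = σ :=
  modification_ext fun D => by ext x; exact h D x

theorem comp₂_eqToHom {F G : StrictPseudofunctor C Cat.{w, w}} {θ η : F ⟶ G} (h : θ = η) (D : C)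
    (x : F.obj D) : comp₂ (eqToHom h) D x = eqToHom (by rw [h]) := by
  subst h; rfl

theorem comp₂_of_eq {F G : StrictPseudofunctor C Cat.{w, w}} {θ η : F ⟶ G} {e : θ ≅ η}
    {h : θ = η} (he : e = eqToIso h) (D : C) (x : F.obj D) :
    comp₂ e.hom D x = eqToHom (by rw [h]) := by
  subst h he; rfl

theorem twoNat_obj {F G : StrictPseudofunctor C Cat.{w, w}} (θ : F ⟶ G) {D E : C} (h : D ⟶ E)
    (x : F.obj D) : (θ.trans.app E).toFunctor.obj ((F.map h).toFunctor.obj x) =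
      (G.map h).toFunctor.obj ((θ.trans.app D).toFunctor.obj x) :=
  congrArg (fun t => t.toFunctor.obj x) (θ.isTwoNatural h).1

theorem twoNat_map {F G : StrictPseudofunctor C Cat.{w, w}} (θ : F ⟶ G) {D E : C} (h : D ⟶ E)
    {x y : F.obj D} (p : x ⟶ y) : (θ.trans.app E).toFunctor.map ((F.map h).toFunctor.map p) =
      eqToHom (twoNat_obj θ h x) ≫ (G.map h).toFunctor.map ((θ.trans.app D).toFunctor.map p) ≫
        eqToHom (twoNat_obj θ h y).symm :=
  CategoryTheory.Functor.congr_hom (congrArg (fun t => t.toFunctor) (θ.isTwoNatural h).1) p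

theorem twoNat_map₂ {F G : StrictPseudofunctor C Cat.{w, w}} (θ : F ⟶ G) {D E : C} {h k : D ⟶ E}
    (β : h ⟶ k) (x : F.obj D) :
    (θ.trans.app E).toFunctor.map ((F.map₂ β).toNatTrans.app x) =
      eqToHom (twoNat_obj θ h x) ≫ (G.map₂ β).toNatTrans.app ((θ.trans.app D).toFunctor.obj x) ≫
        eqToHom (twoNat_obj θ k x).symm := by
  obtain ⟨h₁, e₁⟩ := θ.isTwoNatural h
  obtain ⟨h₂, e₂⟩ := θ.isTwoNatural k
  have e := congrArg (fun ρ => ρ.toNatTrans.app x) (θ.trans.naturality_naturality β)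
  rw [e₁, e₂, eqToIso.hom, eqToIso.hom, Cat.Hom₂.comp_app, Cat.Hom₂.comp_app, Cat.eqToHom_app,
    Cat.eqToHom_app] at e
  change (θ.trans.app E).toFunctor.map ((F.map₂ β).toNatTrans.app x) ≫ _ =
    _ ≫ (G.map₂ β).toNatTrans.app ((θ.trans.app D).toFunctor.obj x) at e
  rw [← reassoc_of% e]
  simp

theorem comp₂_naturality {F G : StrictPseudofunctor C Cat.{w, w}} {θ η : F ⟶ G} (ρ : θ ⟶ η)
    {D E : C} (h : D ⟶ E) (x : F.obj D) :
    comp₂ ρ E ((F.map h).toFunctor.obj x) = eqToHom (twoNat_obj θ h x) ≫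
      (G.map h).toFunctor.map (comp₂ ρ D x) ≫ eqToHom (twoNat_obj η h x).symm := by
  obtain ⟨h₁, e₁⟩ := θ.isTwoNatural h
  obtain ⟨h₂, e₂⟩ := η.isTwoNatural h
  have e := congrArg (fun ρ => ρ.toNatTrans.app x)
    (Pseudofunctor.StrongTrans.Modification.naturality (Pseudofunctor.StrongTrans.Hom.as ρ) h)
  rw [e₁, e₂, eqToIso.hom, eqToIso.hom, Cat.Hom₂.comp_app, Cat.Hom₂.comp_app, Cat.eqToHom_app,
    Cat.eqToHom_app] at e
  change comp₂ ρ E _ ≫ _ = _ ≫ (G.map h).toFunctor.map (comp₂ ρ D x) at e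
  rw [← reassoc_of% e]
  simp

namespace TwoProObj
variable (X : TwoProObj C)

/-- The canonical transformation `C(X_i, -) ⟶ L X`. -/
def coconeApp (i : X.Index) : X.reprDiagram.obj i ⟶ X.L :=
  TwoNatTrans.mk' (fun D => (Colim.incl X.diagram i D).toCatHom) (fun f => rfl) (fun η => by
    ext k
    exact ((Category.id_comp _).trans (Category.comp_id _)).symm)

theorem postcompose_glue_inv {D E : C} (h : D ⟶ E) {i j : X.Index} (u : i ⟶ j)
    (f : X.diagram.obj (op i) ⟶ D) :
    (Colim.glue X.diagram u (f ≫ h)).inv =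
      eqToHom (congrArg (Colim.Obj.mk j) (Strict.assoc _ f h).symm) ≫
        (Colim.postcompose X.diagram h).map (Colim.glue X.diagram u f).inv := by
  have e : (Colim.postcompose X.diagram h).map (Colim.glue X.diagram u f).hom =
      (Colim.glue X.diagram u (f ≫ h)).hom ≫
        eqToHom (congrArg (Colim.Obj.mk j) (Strict.assoc _ f h).symm) := by
    refine (congrArg (Colim.postcompose X.diagram h).map
      (Colim.glue_eq_ginc X.diagram u f)).trans ?_
    refine (Colim.postcompose_ginc X.diagram h u f (𝟙 _)).trans ?_
    refine Eq.trans ?_ (congrArg ((Colim.glue X.diagram u (f ≫ h)).hom ≫ ·)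
      (Colim.incl_eqToHom X.diagram (Strict.assoc (X.diagram.map u.op) f h).symm))
    exact congrArg (Colim.ginc X.diagram u (f ≫ h)) (by simp [Strict.associator_eqToIso])
  refine Iso.inv_ext ?_
  refine (Category.assoc _ _ _).symm.trans ?_
  refine (congrArg (· ≫ _) e.symm).trans ?_
  exact ((Colim.postcompose X.diagram h).mapIso (Colim.glue X.diagram u f)).hom_inv_id

/-- The canonical invertible modification at `u : i ⟶ j`. -/
def coconeIso {i j : X.Index} (u : i ⟶ j) :
    X.reprDiagram.map u ≫ X.coconeApp j ≅ X.coconeApp i ≫ 𝟙 X.L :=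
  TwoNatTrans.isoMk
    (fun D => Cat.Hom.isoMk <| NatIso.ofComponents
      (F := (precomp D (X.diagram.map u.op)) ⋙ Colim.incl X.diagram j D)
      (G := Colim.incl X.diagram i D ⋙ 𝟭 _)
      (fun f => (Colim.glue X.diagram u f).symm)
      (fun {f g} α => by
        exact (Iso.comp_inv_eq _).2 (by
          rw [Category.assoc]
          exact (Iso.eq_inv_comp _).2 (Colim.glue_naturality' X.diagram u α).symm)))
    (fun {D E} h => by
      ext f
      rw [Cat.Hom₂.comp_app, Cat.Hom₂.comp_app, Cat.eqToHom_app, Cat.eqToHom_app]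
      refine (X.postcompose_glue_inv h u f).trans ?_
      exact congrArg (_ ≫ ·) (Category.comp_id _).symm)

theorem comp₂_mapId (i : X.Index) (D : C) (f : X.diagram.obj (op i) ⟶ D) :
    comp₂ (X.reprDiagram.mapId i).hom D f =
      ((X.diagram.mapId (op i)).hom ▷ f ≫ (λ_ f).hom : X.diagram.map (𝟙 i).op ≫ f ⟶ f) := by
  refine (comp₂_of_eq (StrictlyUnitaryPseudofunctor.mapId_eq_eqToIso
    X.reprDiagram.toStrictlyUnitaryPseudofunctor i) D f).trans ?_
  have h' : (X.diagram.mapId (op i)).hom ▷ f ≫ (λ_ f).hom =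
      eqToHom ((congrArg (· ≫ f) (X.diagram.map_id (op i))).trans (Strict.id_comp f)) := by
    simp only [X.diagram.mapId_eq_eqToIso, Strict.leftUnitor_eqToIso, eqToIso.hom,
      eqToHom_whiskerRight]
    exact eqToHom_trans _ _
  exact h'.symm

theorem comp₂_mapComp {i j k : X.Index} (u : i ⟶ j) (v : j ⟶ k) (D : C)
    (f : X.diagram.obj (op i) ⟶ D) :
    comp₂ (X.reprDiagram.mapComp u v).hom D f =
      ((X.diagram.mapComp v.op u.op).hom ▷ f ≫ (α_ _ _ f).hom :
        X.diagram.map (u ≫ v).op ≫ f ⟶ X.diagram.map v.op ≫ X.diagram.map u.op ≫ f) := by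
  refine (comp₂_of_eq (StrictPseudofunctor.mapComp_eq_eqToIso X.reprDiagram u v) D f).trans ?_
  have h' : (X.diagram.mapComp v.op u.op).hom ▷ f ≫ (α_ _ _ f).hom =
      eqToHom ((congrArg (· ≫ f) (X.diagram.map_comp v.op u.op)).trans (Strict.assoc _ _ f)) := by
    simp only [X.diagram.mapComp_eq_eqToIso, Strict.associator_eqToIso, eqToIso.hom,
      eqToHom_whiskerRight]
    exact eqToHom_trans _ _
  exact h'.symm

/-- The canonical pseudocone from `i ↦ C(X_i, -)` with vertex `L X`. -/
def cocone : X.reprDiagram.toPseudofunctor ⟶ const X.Index X.L where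
  app := X.coconeApp
  naturality u := X.coconeIso u
  naturality_naturality {i j u v} η := comp₂_ext fun D (f : X.diagram.obj (op i) ⟶ D) => by
    change (Colim.incl X.diagram j D).map (X.diagram.map₂ (Bicategory.Opposite.op2 η) ▷ f) ≫
      (Colim.glue X.diagram v f).inv = (Colim.glue X.diagram u f).inv ≫ 𝟙 _
    rw [Category.comp_id, Iso.comp_inv_eq, Iso.eq_inv_comp]
    exact Colim.glue_two_cell' X.diagram η f
  naturality_id i := comp₂_ext fun D (f : X.diagram.obj (op i) ⟶ D) => by
    change (Colim.glue X.diagram (𝟙 i) f).inv ≫ 𝟙 _ =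
      (Colim.incl X.diagram i D).map (comp₂ (X.reprDiagram.mapId i).hom D f) ≫ 𝟙 _ ≫ 𝟙 _
    refine (Category.comp_id _).trans (Eq.trans ?_ ((congrArg (_ ≫ ·)
      (Category.comp_id _)).trans (Category.comp_id _)).symm)
    refine Iso.inv_ext (Eq.trans ?_ (Colim.glue_id' X.diagram i f))
    exact congrArg (fun t => (Colim.glue X.diagram (𝟙 i) f).hom ≫
      (Colim.incl X.diagram i D).map t) (X.comp₂_mapId i D f)
  naturality_comp {i j k} u v := comp₂_ext fun D (f : X.diagram.obj (op i) ⟶ D) => by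
    change (Colim.glue X.diagram (u ≫ v) f).inv ≫ 𝟙 _ =
      (Colim.incl X.diagram k D).map (comp₂ (X.reprDiagram.mapComp u v).hom D f) ≫ 𝟙 _ ≫
        (Colim.glue X.diagram v (X.diagram.map u.op ≫ f)).inv ≫ 𝟙 _ ≫
        (Colim.glue X.diagram u f).inv ≫ 𝟙 _
    rw [X.comp₂_mapComp u v D f]
    simp only [Category.comp_id]
    refine Iso.inv_ext ?_
    have h := Colim.glue_comp' X.diagram u v f
    refine (Category.assoc _ _ _).symm.trans ?_
    refine (congrArg (· ≫ _) h).trans ?_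
    exact comp_cancel (Colim.glue X.diagram u f)
      (Colim.glue X.diagram v (X.diagram.map u.op ≫ f))

theorem strongTrans_app_comp {J : Type w} [Bicategory.{w, w} J]
    {F : Pseudofunctor J (StrictPseudofunctor C Cat.{w, w})} {Z : StrictPseudofunctor C Cat.{w, w}}
    {s t : F ⟶ const J Z} (h : s = t) {i j : J} (u : i ⟶ j) (D : C) (x : (F.obj i).obj D) :
    comp₂ (s.naturality u).hom D x = eqToHom (by rw [h]) ≫ comp₂ (t.naturality u).hom D x ≫
      eqToHom (by rw [h]) := by
  subst h; simp

/-- Composition with the canonical pseudocone. -/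
abbrev compare (Z : StrictPseudofunctor C Cat.{w, w}) :
    (X.L ⟶ Z) ⥤ (X.reprDiagram.toPseudofunctor ⟶ const X.Index Z) :=
  constFunctor X.Index X.L Z ⋙ precomp (const X.Index Z) X.cocone

variable {X} in
theorem compare_naturality {Z : StrictPseudofunctor C Cat.{w, w}} (θ : X.L ⟶ Z) {i j : X.Index}
    (u : i ⟶ j) (D : C) (f : X.diagram.obj (op i) ⟶ D) :
    comp₂ (((X.compare Z).obj θ).naturality u).hom D f =
      (θ.trans.app D).toFunctor.map (Colim.glue X.diagram u f).inv := by
  change 𝟙 _ ≫ (θ.trans.app D).toFunctor.map (Colim.glue X.diagram u f).inv ≫ 𝟙 _ ≫ (𝟙 _ ≫ 𝟙 _) ≫ 𝟙 _ = _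
  simp

instance (Z : StrictPseudofunctor C Cat.{w, w}) : (X.compare Z).Faithful where
  map_injective {θ η ρ σ} h := comp₂_ext fun D a => by
    have := congrArg (fun m => comp₂ (Pseudofunctor.StrongTrans.Modification.app
      (Pseudofunctor.StrongTrans.Hom.as m) a.idx) D a.hom) h
    exact this

instance (Z : StrictPseudofunctor C Cat.{w, w}) : (X.compare Z).Full where
  map_surjective {θ η} m := by
    let m' := fun i => Pseudofunctor.StrongTrans.Modification.app
      (Pseudofunctor.StrongTrans.Hom.as m) i
    have hm : ∀ {i j : X.Index} (u : i ⟶ j) (D : C) (f : X.diagram.obj (op i) ⟶ D),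
        comp₂ (m' j) D (X.diagram.map u.op ≫ f) ≫
          (η.trans.app D).toFunctor.map (Colim.glue X.diagram u f).inv =
        (θ.trans.app D).toFunctor.map (Colim.glue X.diagram u f).inv ≫ comp₂ (m' i) D f := by
      intro i j u D f
      have h := congrArg (fun ρ => comp₂ ρ D f)
        (Pseudofunctor.StrongTrans.Modification.naturality
          (Pseudofunctor.StrongTrans.Hom.as m) u)
      have h₁ : _ ≫ comp₂ (((X.compare Z).obj η).naturality u).hom D f =
        comp₂ (((X.compare Z).obj θ).naturality u).hom D f ≫ _ := h
      rw [compare_naturality, compare_naturality] at h₁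
      exact h₁
    let n : ∀ D, (θ.trans.app D).toFunctor ⟶ (η.trans.app D).toFunctor := fun D =>
      Colim.natTransMk (X := X.diagram) (fun a => comp₂ (m' a.idx) D a.hom)
        (fun i {f g} α =>
          (Pseudofunctor.StrongTrans.Modification.app
            (Pseudofunctor.StrongTrans.Hom.as (m' i)) D).toNatTrans.naturality α)
        (fun {i j} u f => square_of_inv _ _ _ (hm u D f))
    refine ⟨TwoNatTrans.homMk (fun D => (n D).toCatHom₂) (fun {D E} h => ?_), ?_⟩
    · ext a
      rw [Cat.Hom₂.comp_app, Cat.Hom₂.comp_app, Cat.eqToHom_app, Cat.eqToHom_app]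
      exact comp₂_naturality (m' a.idx) h a.hom
    · refine Pseudofunctor.StrongTrans.homCategory.ext fun i => comp₂_ext fun D f => ?_
      rfl

theorem compare_injective (Z : StrictPseudofunctor C Cat.{w, w}) :
    Function.Injective (X.compare Z).obj := fun θ η h => TwoNatTrans.ext' fun D => Cat.Hom.ext <| by
  have h₀ : ∀ i : X.Index, X.coconeApp i ≫ θ = X.coconeApp i ≫ η := fun i =>
    congrArg (fun s => Pseudofunctor.StrongTrans.app s i) h
  have h₁ : ∀ i : X.Index, Colim.incl X.diagram i D ⋙ (θ.trans.app D).toFunctor =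
      Colim.incl X.diagram i D ⋙ (η.trans.app D).toFunctor := fun i =>
    congrArg (fun t => (t.trans.app D).toFunctor) (h₀ i)
  refine Colim.functor_ext (X := X.diagram)
    (fun a => CategoryTheory.Functor.congr_obj (h₁ a.idx) a.hom) (fun i f g α => ?_)
    (fun {i j} u f => ?_)
  · have := CategoryTheory.Functor.congr_hom (h₁ i) α
    exact square_of_conj this
  · have e := strongTrans_app_comp h u D f
    rw [compare_naturality, compare_naturality] at e
    exact square_of_inv_eq _ _ _ _ _ e

theorem strongTrans_ext {J : Type w} [Bicategory.{w, w} J]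
    {F : Pseudofunctor J (StrictPseudofunctor C Cat.{w, w})} {Z : StrictPseudofunctor C Cat.{w, w}}
    {s t : F ⟶ const J Z} (h : ∀ i, s.app i = t.app i)
    (h' : ∀ {i j : J} (u : i ⟶ j) (D : C) (x : (F.obj i).obj D),
      comp₂ (s.naturality u).hom D x = eqToHom (by rw [h]) ≫ comp₂ (t.naturality u).hom D x ≫
        eqToHom (by rw [h])) : s = t := by
  obtain ⟨sa, sn, _, _, _⟩ := s
  obtain ⟨ta, tn, _, _, _⟩ := t
  obtain rfl : sa = ta := funext h
  congr
  funext i j u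
  exact Iso.ext (comp₂_ext fun D x => (h' u D x).trans (by simp))

section
variable {X} {Z : StrictPseudofunctor C Cat.{w, w}}
  (t : X.reprDiagram.toPseudofunctor ⟶ const X.Index Z)

/-- The images of the `glue` isomorphisms determined by a pseudocone. -/
def liftIso {i j : X.Index} (u : i ⟶ j) (D : C) (f : X.diagram.obj (op i) ⟶ D) :
    ((t.app i).trans.app D).toFunctor.obj f ≅
      ((t.app j).trans.app D).toFunctor.obj (X.diagram.map u.op ≫ f) where
  hom := comp₂ (t.naturality u).inv D f
  inv := comp₂ (t.naturality u).hom D f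
  hom_inv_id := congrArg (fun ρ => comp₂ ρ D f) (t.naturality u).inv_hom_id
  inv_hom_id := congrArg (fun ρ => comp₂ ρ D f) (t.naturality u).hom_inv_id

/-- The functor out of `L X D` determined by a pseudocone. -/
def liftFunctor (D : C) : Colim.Obj X.diagram D ⥤ Z.obj D :=
  Colim.desc (fun i => ((t.app i).trans.app D).toFunctor) (fun u f => liftIso t u D f)
    (fun {i j} u {f g} α => by
      exact (Pseudofunctor.StrongTrans.Modification.app
        (Pseudofunctor.StrongTrans.Hom.as (t.naturality u).inv) D).toNatTrans.naturality α)
    (fun i f => by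
      have e : comp₂ (t.naturality (𝟙 i)).hom D f ≫ 𝟙 _ =
          ((t.app i).trans.app D).toFunctor.map (comp₂ (X.reprDiagram.mapId i).hom D f) ≫
            𝟙 _ ≫ 𝟙 _ := congrArg (fun ρ => comp₂ ρ D f) (t.naturality_id i)
      rw [comp₂_mapId] at e
      refine (congrArg ((liftIso t (𝟙 i) D f).hom ≫ ·) (e.trans ?_).symm).trans ?_
      · exact congr_three _
      · exact (congrArg (_ ≫ ·) (Category.comp_id _)).trans (liftIso t (𝟙 i) D f).hom_inv_id)
    (fun {i j k} u v f => by
      have e : comp₂ (t.naturality (u ≫ v)).hom D f ≫ 𝟙 _ =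
        ((t.app k).trans.app D).toFunctor.map (comp₂ (X.reprDiagram.mapComp u v).hom D f) ≫
          𝟙 _ ≫ comp₂ (t.naturality v).hom D (X.diagram.map u.op ≫ f) ≫ 𝟙 _ ≫
            comp₂ (t.naturality u).hom D f ≫ 𝟙 _ :=
        congrArg (fun ρ => comp₂ ρ D f) (t.naturality_comp u v)
      rw [comp₂_mapComp] at e
      exact comp_aux (liftIso t (u ≫ v) D f) (liftIso t u D f)
        (liftIso t v D (X.diagram.map u.op ≫ f)) e)
    (fun {i j u v} η f => by
      have e : ((t.app j).trans.app D).toFunctor.map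
          (X.diagram.map₂ (Bicategory.Opposite.op2 η) ▷ f) ≫ comp₂ (t.naturality v).hom D f =
          comp₂ (t.naturality u).hom D f ≫ 𝟙 _ :=
        congrArg (fun ρ => comp₂ ρ D f) (t.naturality_naturality η)
      exact two_aux (liftIso t u D f) (liftIso t v D f) e)

/-- The 2-natural transformation out of `L X` determined by a pseudocone. -/
def lift : X.L ⟶ Z :=
  TwoNatTrans.mk' (fun D => (liftFunctor t D).toCatHom)
    (fun {D E} h => Cat.Hom.ext <| Colim.functor_ext (X := X.diagram)
      (fun a => twoNat_obj (t.app a.idx) h a.hom)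
      (fun i {f g} α => square_of_conj (twoNat_map (t.app i) h α))
      (fun {i j} u f => by
        exact lift_aux (comp₂_naturality (t.naturality u).inv h f)
          ((congrArg ((t.app j).trans.app E).toFunctor.map
            (show (α_ (X.diagram.map u.op) f h).inv = eqToHom (Strict.assoc _ f h).symm by
              simp [Strict.associator_eqToIso])).trans (eqToHom_map _ _))))
    (fun {D E h k} β => by
      ext a
      rw [Cat.Hom₂.comp_app, Cat.Hom₂.comp_app, Cat.eqToHom_app, Cat.eqToHom_app]
      exact twoNat_map₂ (t.app a.idx) β a.hom)

end

theorem compare_lift_app {Z : StrictPseudofunctor C Cat.{w, w}}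
    (t : X.reprDiagram.toPseudofunctor ⟶ const X.Index Z) (i : X.Index) :
    ((X.compare Z).obj (lift t)).app i = t.app i :=
  TwoNatTrans.ext' (θ := X.coconeApp i ≫ lift t) (η := t.app i) fun D => by
    rfl

theorem compare_surjective (Z : StrictPseudofunctor C Cat.{w, w}) :
    Function.Surjective (X.compare Z).obj := fun t =>
  ⟨lift t, strongTrans_ext (X.compare_lift_app t) fun u D f =>
    (compare_naturality (lift t) u D f).trans
      ((Category.id_comp _).trans (Category.comp_id _)).symm⟩

/-- The 2-functor `X.L` is the pseudocolimit of the representables `C(X_i, -)`. -/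
theorem isPseudocolimit_cocone : IsPseudocolimit X.cocone := fun Z =>
  isIsoOfCategories_of (X.compare Z) ⟨X.compare_injective Z, X.compare_surjective Z⟩

end TwoProObj
end Universal

end TwoPro

/-! Consider first a diagram `F` over a 2-filtered `J` whose values are literally `L X_j` for
2-pro-objects `X_j`. Its pseudocolimit is `L` of a single 2-pro-object, indexed by `F.Idx`. An
object is a pair `(j, i)` with `i` an index of `X_j`. A 1-cell `(j, i) ⟶ (j', i')` is a 1-cell `a :
j ⟶ j'`, a 1-cell `r : X_{j',i'} ⟶ X_{j,i}` of `C`, and an invertible modification expressing that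
`r` represents the restriction of `F a` to `C(X_{j,i}, -)`. A 2-cell is a compatible pair of 2-cells
of `J` and `C`. By the Yoneda lemma these modifications form a small set. It has to be shown that
`F.Idx` is 2-filtered and that `L` of the diagram `(j, i) ↦ X_{j,i}` is the pseudocolimit of `F`.

For the first point, Yoneda turns questions about 1-cells and 2-cells over fixed data in `J` into
questions about objects and arrows of a category `L X_j (D)`. When the index is 2-filtered, the
arrows of this presented category are understood through fractions, that is 2-cells between
translates `X_u ≫ f` and `X_v ≫ g`: every arrow is a fraction (`exists_frac`), two fractions with
the same legs agree only if their 2-cells agree after a translation (`exists_transl_eq`), and an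
invertible fraction has a 2-cell that becomes invertible after a translation
(`exists_isIso_transl`). The second fact is the substantial one. Since equality is generated by
relations, an invariant is needed: classes of fractions out of a fixed object form a functor
`toType` on the presented category, and an arrow given by a fraction sends the class of the identity
to the class of that fraction.

For the second point, the leg at `j` comes from restricting the canonical cocone to the indices of
`X_j`. The structure 2-cell at `a : j ⟶ k` is computed on `(i, f)` by choosing any 1-cell of `F.Idx`
out of `(j, i)` over `a`. The choice is irrelevant (`edge_cell`), because a 2-cell of `J` between
first components lifts to `F.Idx` after composing with 1-cells inside the fibre (`exists_fibCell`).
Conversely the gluing isomorphisms of the total colimit are recovered from these structure cells and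
the legs (`edges_comp_map`), which gives the universal property by checking generators.

Pseudocolimits defined by isomorphisms of categories are unique up to genuine isomorphism. Hence a
diagram with values in `IsFC` is isomorphic, as a 2-functor, to one with values `L X_j` (`conj`),
and both the pseudocolimit and membership in `IsFC` are transported. The statement on `2-Pro`
follows by duality, since its hom-categories are those of `Hom(C, Cat)ᵒᵖ` between the `L X`. -/

namespace TwoPro
namespace Colim

/-! ### Translation of 1-cells and 2-cells along 1-cells of the index. -/

section Translate
variable {C : Type u} [Bicategory.{w, w} C] {I : Type w} [Bicategory.{w, w} I]
  (X : StrictPseudofunctor Iᵒᵖ C) {D : C}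

/-- The translate `X_u ≫ f` of `f : X_i ⟶ D` along `u : i ⟶ k`. -/
abbrev tr {i k : I} (u : i ⟶ k) (f : X.obj (op i) ⟶ D) : X.obj (op k) ⟶ D := X.map u.op ≫ f

/-- The 2-cell between translates induced by a 2-cell of `I`. -/
def act {i k : I} {u v : i ⟶ k} (γ : u ⟶ v) (f : X.obj (op i) ⟶ D) : tr X u f ⟶ tr X v f :=
  X.map₂ (Bicategory.Opposite.op2 γ) ▷ f

/-- The comparison between translation along a composite and iterated translation. -/
def trComp {i k l : I} (u : i ⟶ k) (w : k ⟶ l) (f : X.obj (op i) ⟶ D) :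
    tr X (u ≫ w) f ≅ tr X w (tr X u f) :=
  whiskerRightIso (X.mapComp w.op u.op) f ≪≫ α_ _ _ f

/-- The comparison between `f` and its translation along an identity. -/
def trId {i : I} (f : X.obj (op i) ⟶ D) : tr X (𝟙 i) f ≅ f :=
  whiskerRightIso (X.mapId (op i)) f ≪≫ λ_ f

variable {X}

/-- Translation along `w` of a 2-cell between translates. -/
def transl {i j k l : I} {u : i ⟶ k} {v : j ⟶ k} {f : X.obj (op i) ⟶ D} {g : X.obj (op j) ⟶ D}
    (w : k ⟶ l) (α : tr X u f ⟶ tr X v g) : tr X (u ≫ w) f ⟶ tr X (v ≫ w) g :=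
  (trComp X u w f).hom ≫ X.map w.op ◁ α ≫ (trComp X v w g).inv

variable {i j k l m : I} {f f' : X.obj (op i) ⟶ D} {g g' : X.obj (op j) ⟶ D}

@[simp]
theorem act_id (u : i ⟶ k) : act X (𝟙 u) f = 𝟙 _ := by
  simp [act]

theorem act_comp {u v w : i ⟶ k} (γ : u ⟶ v) (δ : v ⟶ w) :
    act X (γ ≫ δ) f = act X γ f ≫ act X δ f := by
  simp [act]

theorem act_comp_assoc {u v w : i ⟶ k} (γ : u ⟶ v) (δ : v ⟶ w) {a : X.obj (op k) ⟶ D}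
    (p : tr X w f ⟶ a) : act X (γ ≫ δ) f ≫ p = act X γ f ≫ act X δ f ≫ p := by
  rw [act_comp, Category.assoc]

/-- The action of an invertible 2-cell. -/
@[simps]
def actIso {u v : i ⟶ k} (γ : u ≅ v) (f : X.obj (op i) ⟶ D) : tr X u f ≅ tr X v f where
  hom := act X γ.hom f
  inv := act X γ.inv f
  hom_inv_id := by rw [← act_comp]; simp
  inv_hom_id := by rw [← act_comp]; simp

theorem trComp_naturality (u : i ⟶ k) (w : k ⟶ l) (θ : f ⟶ f') :
    X.map (u ≫ w).op ◁ θ ≫ (trComp X u w f').hom =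
      (trComp X u w f).hom ≫ X.map w.op ◁ X.map u.op ◁ θ := by
  simp [trComp, whisker_exchange_assoc, tr]

theorem trId_naturality (θ : f ⟶ f') :
    X.map (𝟙 i).op ◁ θ ≫ (trId X f').hom = (trId X f).hom ≫ θ := by
  simp only [trId, Iso.trans_hom, whiskerRightIso_hom, Category.assoc]
  rw [← leftUnitor_naturality, ← whisker_exchange_assoc]
  rfl

theorem trComp_act_left {u u' : i ⟶ k} (γ : u ⟶ u') (w : k ⟶ l) :
    act X (γ ▷ w) f ≫ (trComp X u' w f).hom = (trComp X u w f).hom ≫ X.map w.op ◁ act X γ f := by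
  have := X.map₂_whisker_left w.op (Bicategory.Opposite.op2 γ)
  have e : X.map₂ (Bicategory.Opposite.op2 (γ ▷ w)) = _ := this
  simp only [act, trComp, e]
  simp [tr]

theorem trComp_act_right (u : i ⟶ k) {w w' : k ⟶ l} (κ : w ⟶ w') :
    act X (u ◁ κ) f ≫ (trComp X u w' f).hom = (trComp X u w f).hom ≫ act X κ (tr X u f) := by
  have := X.map₂_whisker_right (Bicategory.Opposite.op2 κ) u.op
  have e : X.map₂ (Bicategory.Opposite.op2 (u ◁ κ)) = _ := this
  simp only [act, trComp, e]
  simp [tr]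

/-- Passing to `Iᵒᵖ` reverses the triple, so the associativity axiom of `X` at `w.op`, `v.op`,
`u.op` concerns the inverse associator of `u`, `v`, `w`; it is then moved to the other side. -/
theorem trComp_assoc (u : i ⟶ k) (v : k ⟶ l) (w : l ⟶ m) :
    act X (α_ u v w).hom f ≫ (trComp X u (v ≫ w) f).hom ≫ (trComp X v w (tr X u f)).hom =
      (trComp X (u ≫ v) w f).hom ≫ X.map w.op ◁ (trComp X u v f).hom := by
  have := X.map₂_associator w.op v.op u.op
  have e : X.map₂ (Bicategory.Opposite.op2 (α_ u v w).inv) = _ := this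
  have e' : act X (α_ u v w).inv f = X.map₂ (Bicategory.Opposite.op2 (α_ u v w).inv) ▷ f := rfl
  have h : (trComp X u (v ≫ w) f).hom ≫ (trComp X v w (tr X u f)).hom = act X (α_ u v w).inv f ≫
      (trComp X (u ≫ v) w f).hom ≫ X.map w.op ◁ (trComp X u v f).hom := by
    rw [e', e]
    simp [trComp, tr]
  rw [h, ← Category.assoc, ← act_comp]; simp

/-- The left unitor of `u` is the right unitor of `u.op`, so this is the right unit axiom of `X`. -/
theorem act_leftUnitor (u : i ⟶ k) :
    act X (λ_ u).hom f = (trComp X (𝟙 i) u f).hom ≫ X.map u.op ◁ (trId X f).hom := by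
  have := X.map₂_right_unitor u.op
  have e : X.map₂ (Bicategory.Opposite.op2 (λ_ u).hom) = _ := this
  rw [act, e]
  simp [trComp, trId, tr]

theorem act_rightUnitor (u : i ⟶ k) :
    act X (ρ_ u).hom f = (trComp X u (𝟙 k) f).hom ≫ (trId X (tr X u f)).hom := by
  have := X.map₂_left_unitor u.op
  have e : X.map₂ (Bicategory.Opposite.op2 (ρ_ u).hom) = _ := this
  rw [act, e]
  simp [trComp, trId, tr]

section Transl
variable {u u₁ : i ⟶ k} {v v₁ : j ⟶ k}

theorem transl_id (w : k ⟶ l) : transl w (𝟙 (tr X u f)) = 𝟙 _ := by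
  simp [transl, tr]

theorem transl_comp {j' : I} {g' : X.obj (op j') ⟶ D} {v' : j' ⟶ k} (w : k ⟶ l)
    (α : tr X u f ⟶ tr X v g) (β : tr X v g ⟶ tr X v' g') :
    transl w (α ≫ β) = transl w α ≫ transl w β := by
  simp [transl, tr]

/-- Translation of an invertible 2-cell. -/
def translIso (w : k ⟶ l) (α : tr X u f ≅ tr X v g) : tr X (u ≫ w) f ≅ tr X (v ≫ w) g where
  hom := transl w α.hom
  inv := transl w α.inv
  hom_inv_id := by rw [← transl_comp, Iso.hom_inv_id, transl_id]
  inv_hom_id := by rw [← transl_comp, Iso.inv_hom_id, transl_id]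

theorem transl_whiskerLeft (w : k ⟶ l) (θ : f ⟶ f') :
    transl w (X.map u.op ◁ θ : tr X u f ⟶ tr X u f') = X.map (u ≫ w).op ◁ θ := by
  rw [transl, ← Category.assoc, Iso.comp_inv_eq]
  exact (trComp_naturality u w θ).symm

theorem transl_act (w : k ⟶ l) (γ : u ⟶ u₁) :
    transl w (act X γ f) = act X (γ ▷ w) f := by
  rw [transl, ← Category.assoc, Iso.comp_inv_eq]
  exact (trComp_act_left γ w).symm

/-- The interchange law between `α` and the image of `κ`, conjugated by `trComp`. It allows `w` to
be replaced by `w'` on both sides of a cell at once. -/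
theorem transl_naturality {w w' : k ⟶ l} (κ : w ⟶ w') (α : tr X u f ⟶ tr X v g) :
    transl w α ≫ act X (v ◁ κ) g = act X (u ◁ κ) f ≫ transl w' α := by
  rw [transl, transl, ← cancel_mono (trComp X v w' g).hom]
  simp only [Category.assoc, trComp_act_right, Iso.inv_hom_id_assoc, Iso.inv_hom_id,
    Category.comp_id]
  rw [← Category.assoc (act X (u ◁ κ) f), trComp_act_right]
  simp only [act, Category.assoc, tr, whisker_exchange]

theorem transl_transl (w : k ⟶ l) (w' : l ⟶ m) (α : tr X u f ⟶ tr X v g) :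
    transl w' (transl w α) ≫ act X (α_ v w w').hom g =
      act X (α_ u w w').hom f ≫ transl (w ≫ w') α := by
  have h₁ := trComp_assoc (f := f) u w w'
  have h₂ := trComp_assoc (f := g) v w w'
  rw [← cancel_mono (trComp X v (w ≫ w') g).hom,
    ← cancel_mono (trComp X w w' (tr X v g)).hom]
  simp only [Category.assoc]
  rw [h₂]
  simp only [transl, Category.assoc, Iso.inv_hom_id_assoc, Bicategory.whiskerLeft_comp]
  rw [← whiskerLeft_comp_assoc]
  have h₃ := trComp_naturality w w' α
  have h₃' : X.map (w ≫ w').op ◁ α ≫ (trComp X w w' (tr X v g)).hom =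
    (trComp X w w' (tr X u f)).hom ≫ X.map w'.op ◁ X.map w.op ◁ α := h₃
  rw [h₃', reassoc_of% h₁]
  simp

theorem transl_comp_eq (w : k ⟶ l) (w' : l ⟶ m) (α : tr X u f ⟶ tr X v g) :
    transl (w ≫ w') α = act X (α_ u w w').inv f ≫ transl w' (transl w α) ≫
      act X (α_ v w w').hom g := by
  rw [transl_transl, ← Category.assoc, ← act_comp]
  simp

theorem transl_trComp_inv {i' : I} {h : X.obj (op i') ⟶ D} (s : i' ⟶ i) {u : i ⟶ k}
    (w : k ⟶ l) (α : tr X v g ⟶ tr X u (tr X s h)) :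
    transl w (α ≫ (trComp X s u h).inv) =
      transl w α ≫ (trComp X s (u ≫ w) h).inv ≫ act X (α_ s u w).inv h := by
  have e := trComp_assoc (f := h) s u w
  have e' : (trComp X u w (tr X s h)).inv ≫ (trComp X s (u ≫ w) h).inv ≫
      act X (α_ s u w).inv h = X.map w.op ◁ (trComp X s u h).inv ≫
        (trComp X (s ≫ u) w h).inv := by
    have := congrArg Iso.inv (Iso.ext (α := actIso (α_ s u w) h ≪≫ trComp X s (u ≫ w) h ≪≫
      trComp X u w (tr X s h)) (β := trComp X (s ≫ u) w h ≪≫ whiskerLeftIso _ (trComp X s u h)) e)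
    simpa using this
  simp only [transl, Category.assoc, e', Bicategory.whiskerLeft_comp]

theorem transl_one (α : tr X u f ⟶ tr X v g) :
    transl (𝟙 k) α ≫ act X (ρ_ v).hom g = act X (ρ_ u).hom f ≫ α := by
  have h : X.map (𝟙 k).op ◁ α ≫ (trId X (tr X v g)).hom = (trId X (tr X u f)).hom ≫ α :=
    trId_naturality α
  rw [act_rightUnitor, act_rightUnitor, transl]
  simp only [Category.assoc, Iso.inv_hom_id_assoc]
  rw [h]

end Transl

/-! ### Fractions as arrows of the presented category. -/

section Frac
variable {u u₁ : i ⟶ k} {v v₁ : j ⟶ k}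

/-- The arrow of `Obj X D` represented by a 2-cell between translates. -/
def frac (u : i ⟶ k) (v : j ⟶ k) (α : tr X u f ⟶ tr X v g) :
    (incl X i D).obj f ⟶ (incl X j D).obj g :=
  (glue X u f).hom ≫ (incl X k D).map α ≫ (glue X v g).inv

theorem incl_act_glue_inv (γ : v ⟶ v₁) :
    (incl X k D).map (act X γ g) ≫ (glue X v₁ g).inv = (glue X v g).inv := by
  rw [Iso.comp_inv_eq, Iso.eq_inv_comp]
  exact glue_two_cell' X γ g

theorem frac_act_left (γ : u ⟶ u₁) (α : tr X u₁ f ⟶ tr X v g) :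
    frac u v (act X γ f ≫ α) = frac u₁ v α := by
  have := glue_two_cell' X γ f
  rw [frac, frac, ← this, Functor.map_comp]
  simp only [act, Category.assoc]

theorem frac_act_right (γ : v ⟶ v₁) (α : tr X u f ⟶ tr X v g) :
    frac u v₁ (α ≫ act X γ g) = frac u v α := by
  rw [frac, frac, Functor.map_comp, Category.assoc, incl_act_glue_inv]

theorem frac_comp {j' : I} {g' : X.obj (op j') ⟶ D} (v' : j' ⟶ k)
    (α : tr X u f ⟶ tr X v g) (β : tr X v g ⟶ tr X v' g') :
    frac u v α ≫ frac v v' β = frac u v' (α ≫ β) := by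
  simp [frac]

theorem frac_id : frac u u (𝟙 (tr X u f)) = 𝟙 _ := by
  simp [frac]

theorem frac_whiskerLeft (u : i ⟶ k) (θ : f ⟶ f') :
    frac u u (X.map u.op ◁ θ) = (incl X i D).map θ := by
  rw [frac, ← Category.assoc, Iso.comp_inv_eq]
  exact (glue_naturality' X u θ).symm

theorem glue_trComp (u : i ⟶ k) (w : k ⟶ l) (f : X.obj (op i) ⟶ D) :
    (glue X (u ≫ w) f).hom ≫ (incl X l D).map (trComp X u w f).hom =
      (glue X u f).hom ≫ (glue X w (tr X u f)).hom :=
  glue_comp' X u w f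

theorem trComp_inv_glue_inv (u : i ⟶ k) (w : k ⟶ l) (f : X.obj (op i) ⟶ D) :
    (incl X l D).map (trComp X u w f).inv ≫ (glue X (u ≫ w) f).inv =
      (glue X w (tr X u f)).inv ≫ (glue X u f).inv := by
  have h := glue_trComp u w f
  rw [← Functor.mapIso_hom] at h
  rw [← Functor.mapIso_inv, Iso.inv_comp_eq, ← cancel_epi (glue X (u ≫ w) f).hom,
    Iso.hom_inv_id, ← Category.assoc, h]
  simp

/-- Gluing along `u ≫ w` is gluing along `u` and then along `w`. By naturality of gluing the two
passages along `w` cancel around `α`. -/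
theorem frac_transl (w : k ⟶ l) (α : tr X u f ⟶ tr X v g) :
    frac (u ≫ w) (v ≫ w) (transl w α) = frac u v α := by
  rw [frac, transl, Functor.map_comp, Functor.map_comp]
  simp only [Category.assoc]
  rw [trComp_inv_glue_inv, ← Category.assoc, glue_trComp, Category.assoc,
    ← reassoc_of% (glue_naturality' X w α), frac]
  simp

theorem glue_trId (f : X.obj (op i) ⟶ D) :
    (glue X (𝟙 i) f).hom ≫ (incl X i D).map (trId X f).hom = 𝟙 _ :=
  glue_id' X i f

theorem glue_id_inv (f : X.obj (op i) ⟶ D) :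
    (glue X (𝟙 i) f).inv = (incl X i D).map (trId X f).hom :=
  Iso.inv_ext (glue_trId f)

theorem glue_id_hom (f : X.obj (op i) ⟶ D) :
    (glue X (𝟙 i) f).hom = (incl X i D).map (trId X f).inv := by
  rw [← Functor.mapIso_inv, ← Iso.comp_hom_eq_id]
  exact glue_trId f

theorem glue_hom_eq_frac (u : i ⟶ k) (f : X.obj (op i) ⟶ D) :
    (glue X u f).hom = frac u (𝟙 k) (trId X (tr X u f)).inv := by
  rw [frac, glue_id_inv, ← Functor.map_comp, Iso.inv_hom_id, CategoryTheory.Functor.map_id]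
  exact (Category.comp_id _).symm

theorem glue_inv_eq_frac (u : i ⟶ k) (f : X.obj (op i) ⟶ D) :
    (glue X u f).inv = frac (𝟙 k) u (trId X (tr X u f)).hom := by
  rw [frac, glue_id_hom, ← Functor.map_comp_assoc, Iso.inv_hom_id, CategoryTheory.Functor.map_id]
  exact (Category.id_comp _).symm

end Frac

end Translate
end Colim
end TwoPro

/-! ### Consequences of the 2-filteredness axioms. -/

namespace TwoPro
namespace IsTwoFiltered
variable {I : Type u} [Bicategory.{w, v} I] (hI : IsTwoFiltered I)
include hI

theorem exists_square {i j k : I} (u : i ⟶ j) (v : i ⟶ k) :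
    ∃ (l : I) (w : j ⟶ l) (w' : k ⟶ l), Nonempty (u ≫ w ≅ v ≫ w') := by
  obtain ⟨m, ⟨p⟩, ⟨q⟩⟩ := hI.f0 j k
  obtain ⟨l, h, ⟨e⟩⟩ := hI.f1 (u ≫ p) (v ≫ q)
  exact ⟨l, p ≫ h, q ≫ h, ⟨(α_ _ _ _).symm ≪≫ e ≪≫ α_ _ _ _⟩⟩

/-- The square for `u`, `u'` exists already; F1 then compares the composites of `v` and `v'`, and
whiskering the first isomorphism keeps it valid. -/
theorem exists_square₂ {i j k k' : I} (u : i ⟶ k) (u' : i ⟶ k') (v : j ⟶ k) (v' : j ⟶ k') :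
    ∃ (l : I) (w : k ⟶ l) (w' : k' ⟶ l), Nonempty (u ≫ w ≅ u' ≫ w') ∧
      Nonempty (v ≫ w ≅ v' ≫ w') := by
  obtain ⟨m, p, q, ⟨e⟩⟩ := hI.exists_square u u'
  obtain ⟨l, h, ⟨e'⟩⟩ := hI.f1 (v ≫ p) (v' ≫ q)
  exact ⟨l, p ≫ h, q ≫ h, ⟨(α_ _ _ _).symm ≪≫ whiskerRightIso e h ≪≫ α_ _ _ _⟩,
    ⟨(α_ _ _ _).symm ≪≫ e' ≪≫ α_ _ _ _⟩⟩

/-- Every 2-cell of a 2-filtered 2-category becomes invertible after whiskering. -/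
theorem exists_isIso_whiskerRight {i j : I} {u v : i ⟶ j} (η : u ⟶ v) :
    ∃ (k : I) (h : j ⟶ k), IsIso (η ▷ h) := by
  obtain ⟨m, p, ⟨e⟩⟩ := hI.f1 u v
  -- F1 has supplied some isomorphism `e` between the whiskered 1-cells; F2 forces `η` to coincide
  -- with it after further whiskering.
  obtain ⟨k, q, hq⟩ := hI.f2 (η ▷ p ≫ e.inv) (𝟙 _)
  refine ⟨k, p ≫ q, ?_⟩
  have : (η ▷ p) ▷ q = e.hom ▷ q := by
    have h := congrArg (· ≫ e.hom ▷ q) hq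
    simpa [← comp_whiskerRight] using h
  rw [whiskerRight_comp, this]
  infer_instance

/-- An isomorphism `s ≫ p ≅ s ≫ q` need not come from one between `p` and `q`, but it does after
whiskering: F1 gives an arbitrary isomorphism, and F2 makes its whiskering by `s` agree with `γ`. -/
theorem exists_whiskerLeft_eq {a b c : I} (s : a ⟶ b) {p q : b ⟶ c} (γ : s ≫ p ≅ s ≫ q) :
    ∃ (d : I) (h : c ⟶ d) (κ : p ≫ h ≅ q ≫ h),
      s ◁ κ.hom = (α_ s p h).inv ≫ γ.hom ▷ h ≫ (α_ s q h).hom := by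
  obtain ⟨d, h, ⟨κ⟩⟩ := hI.f1 p q
  obtain ⟨d', h', e⟩ := hI.f2 (s ◁ κ.hom) ((α_ s p h).inv ≫ γ.hom ▷ h ≫ (α_ s q h).hom)
  refine ⟨d', h ≫ h', (α_ _ _ _).symm ≪≫ whiskerRightIso κ h' ≪≫ α_ _ _ _, ?_⟩
  have e' := congrArg (fun t => s ◁ (α_ p h h').inv ≫ (α_ s (p ≫ h) h').inv ≫ t ≫
    (α_ s (q ≫ h) h').hom ≫ s ◁ (α_ q h h').hom) e
  simpa using e'

theorem exists_whiskerLeft_eq₂ {a a' b c : I} (s : a ⟶ b) (s' : a' ⟶ b) {p q : b ⟶ c}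
    (γ : s ≫ p ≅ s ≫ q) (γ' : s' ≫ p ≅ s' ≫ q) :
    ∃ (d : I) (h : c ⟶ d) (κ : p ≫ h ≅ q ≫ h),
      s ◁ κ.hom = (α_ s p h).inv ≫ γ.hom ▷ h ≫ (α_ s q h).hom ∧
      s' ◁ κ.hom = (α_ s' p h).inv ≫ γ'.hom ▷ h ≫ (α_ s' q h).hom := by
  obtain ⟨d, h, κ, hκ⟩ := hI.exists_whiskerLeft_eq s γ
  -- The condition on `s'` is imposed by a second use of F2, and the condition on `s` survives the
  -- extra whiskering by `h'`.
  obtain ⟨d', h', e⟩ := hI.f2 (s' ◁ κ.hom) ((α_ s' p h).inv ≫ γ'.hom ▷ h ≫ (α_ s' q h).hom)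
  refine ⟨d', h ≫ h', (α_ _ _ _).symm ≪≫ whiskerRightIso κ h' ≪≫ α_ _ _ _, ?_, ?_⟩
  · have e' := congrArg (fun t => s ◁ (α_ p h h').inv ≫ (α_ s (p ≫ h) h').inv ≫ t ▷ h' ≫
      (α_ s (q ≫ h) h').hom ≫ s ◁ (α_ q h h').hom) hκ
    simpa using e'
  · have e' := congrArg (fun t => s' ◁ (α_ p h h').inv ≫ (α_ s' (p ≫ h) h').inv ≫ t ≫
      (α_ s' (q ≫ h) h').hom ≫ s' ◁ (α_ q h h').hom) e
    simpa using e'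

end IsTwoFiltered

/-! ### Every arrow is a fraction; equivalence of fractions. -/

namespace Colim
section Surj
variable {C : Type u} [Bicategory.{w, w} C] {I : Type w} [Bicategory.{w, w} I]
  {X : StrictPseudofunctor Iᵒᵖ C} {D : C} (hI : IsTwoFiltered I)
include hI

/-- Induction on formal composites. Each generator is a fraction with some identity legs, and two
fractions compose because the inner legs, which leave the same index, can be completed to a square.
-/
theorem exists_frac {a b : Obj X D} (p : a ⟶ b) :
    ∃ (k : I) (u : a.idx ⟶ k) (v : b.idx ⟶ k) (α : tr X u a.hom ⟶ tr X v b.hom),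
      p = frac u v α := by
  induction p using hom_induction with
  | id a => exact ⟨a.idx, 𝟙 _, 𝟙 _, 𝟙 _, frac_id.symm⟩
  | comp p q hp hq =>
    obtain ⟨k, u, v, α, rfl⟩ := hp
    obtain ⟨k', u', v', β, rfl⟩ := hq
    obtain ⟨l, w, w', ⟨e⟩⟩ := hI.exists_square v u'
    refine ⟨l, u ≫ w, v' ≫ w', transl w α ≫ act X e.hom _ ≫ transl w' β, ?_⟩
    rw [← frac_transl w α, ← frac_transl w' β, ← frac_act_left e.hom]
    exact frac_comp _ _ _
  | incl i α => exact ⟨i, 𝟙 _, 𝟙 _, _, (frac_whiskerLeft (𝟙 i) α).symm⟩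
  | @glue i j u f => exact ⟨j, u, 𝟙 j, _, glue_hom_eq_frac u f⟩
  | @glueInv i j u f => exact ⟨j, 𝟙 j, u, _, glue_inv_eq_frac u f⟩

end Surj

section Span
variable {C : Type u} [Bicategory.{w, w} C] {I : Type w} [Bicategory.{w, w} I]
  {X : StrictPseudofunctor Iᵒᵖ C} {D : C} {b : Obj X D}

variable (b) in
/-- Fractions from `b` to `(i, f)`. -/
structure Span (i : I) (f : X.obj (op i) ⟶ D) : Type w where
  apex : I
  right : i ⟶ apex
  left : b.idx ⟶ apex
  cell : tr X left b.hom ⟶ tr X right f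

namespace Span
variable {i j k l : I} {f f' : X.obj (op i) ⟶ D}

/-- Two fractions are equivalent if they become isomorphic after translation. -/
def Rel (s t : Span b i f) : Prop :=
  ∃ (m : I) (w : s.apex ⟶ m) (w' : t.apex ⟶ m) (γ : s.right ≫ w ≅ t.right ≫ w')
    (δ : s.left ≫ w ≅ t.left ≫ w'),
    transl w s.cell ≫ act X γ.hom f = act X δ.hom b.hom ≫ transl w' t.cell

/-- A comparison between two cells can be pushed further along `h`. This is how two comparisons are
brought to a common stage. -/
theorem rel_extend {k k' m m' : I} {u : i ⟶ k} {v : b.idx ⟶ k} {u' : i ⟶ k'} {v' : b.idx ⟶ k'}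
    {α : tr X v b.hom ⟶ tr X u f} {α' : tr X v' b.hom ⟶ tr X u' f} {w : k ⟶ m} {w' : k' ⟶ m}
    {γ : u ≫ w ⟶ u' ≫ w'} {δ : v ≫ w ⟶ v' ≫ w'}
    (e : transl w α ≫ act X γ f = act X δ b.hom ≫ transl w' α') (h : m ⟶ m') :
    transl (w ≫ h) α ≫ act X ((α_ _ _ _).inv ≫ γ ▷ h ≫ (α_ _ _ _).hom) f =
      act X ((α_ _ _ _).inv ≫ δ ▷ h ≫ (α_ _ _ _).hom) b.hom ≫ transl (w' ≫ h) α' := by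
  have e' := congrArg (transl h) e
  rw [transl_comp, transl_comp, transl_act, transl_act] at e'
  simp only [act_comp, transl_comp_eq, Category.assoc]
  rw [← act_comp_assoc (α_ u w h).hom, Iso.hom_inv_id, act_id, Category.id_comp, reassoc_of% e',
    ← act_comp_assoc (α_ v' w' h).hom, Iso.hom_inv_id, act_id, Category.id_comp]

theorem Rel.refl (s : Span b i f) : Rel s s :=
  ⟨s.apex, 𝟙 _, 𝟙 _, Iso.refl _, Iso.refl _, by simp⟩

theorem Rel.symm {s t : Span b i f} : Rel s t → Rel t s := by
  rintro ⟨m, w, w', γ, δ, e⟩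
  refine ⟨m, w', w, γ.symm, δ.symm, ?_⟩
  have e' := (Iso.eq_comp_inv (actIso γ f)).2 e
  change _ ≫ (actIso γ f).inv = (actIso δ b.hom).inv ≫ _
  rw [Iso.eq_inv_comp, e', ← Category.assoc]
  rfl

/-- The two translations `w'` and `x` of the middle fraction are made isomorphic by a square;
interchange carries its cell from one to the other, and the two extended comparisons are pasted. -/
theorem Rel.trans (hI : IsTwoFiltered I) {s t r : Span b i f} : Rel s t → Rel t r → Rel s r := by
  rintro ⟨m, w, w', γ, δ, e⟩ ⟨n, x, x', γ', δ', e'⟩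
  obtain ⟨l, p, q, ⟨κ⟩⟩ := hI.exists_square w' x
  have h₁ := rel_extend e p
  have h₂ := rel_extend e' q
  have h₃ := transl_naturality κ.hom t.cell
  refine ⟨l, w ≫ p, x' ≫ q, ((α_ _ _ _).symm ≪≫ whiskerRightIso γ p ≪≫ (α_ _ _ _)) ≪≫
    whiskerLeftIso _ κ ≪≫ ((α_ _ _ _).symm ≪≫ whiskerRightIso γ' q ≪≫ (α_ _ _ _)),
    ((α_ _ _ _).symm ≪≫ whiskerRightIso δ p ≪≫ (α_ _ _ _)) ≪≫
    whiskerLeftIso _ κ ≪≫ ((α_ _ _ _).symm ≪≫ whiskerRightIso δ' q ≪≫ (α_ _ _ _)), ?_⟩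
  simp only [Iso.trans_hom, Iso.symm_hom, whiskerRightIso_hom, whiskerLeftIso_hom]
  simp only [act_comp, Category.assoc] at h₁ h₂ h₃ ⊢
  rw [reassoc_of% h₁, reassoc_of% h₃, h₂]

/-- Equivalence demands invertible 2-cells in `I` whereas `γ` is arbitrary; but `γ` becomes
invertible after whiskering. -/
theorem rel_of_act {k : I} {u u' : i ⟶ k} {v : b.idx ⟶ k} (hI : IsTwoFiltered I)
    (γ : u ⟶ u') (α : tr X v b.hom ⟶ tr X u f) :
    Rel (⟨k, u, v, α⟩ : Span b i f) ⟨k, u', v, α ≫ act X γ f⟩ := by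
  obtain ⟨l, h, _⟩ := hI.exists_isIso_whiskerRight γ
  refine ⟨l, h, h, asIso (γ ▷ h), Iso.refl _, ?_⟩
  rw [transl_comp, transl_act]
  simp

end Span
end Span
end Colim
end TwoPro

/-! ### Classes of fractions out of a fixed object, as a functor. -/

namespace TwoPro
namespace Colim
section Span
variable {C : Type u} [Bicategory.{w, w} C] {I : Type w} [Bicategory.{w, w} I]
  {X : StrictPseudofunctor Iᵒᵖ C} {D : C} {b : Obj X D}

namespace Span
variable {i j k l : I} {f f' : X.obj (op i) ⟶ D}

/-- Equivalence of fractions. -/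
def setoid (hI : IsTwoFiltered I) (b : Obj X D) (i : I) (f : X.obj (op i) ⟶ D) :
    Setoid (Span b i f) where
  r := Rel
  iseqv := ⟨Rel.refl, Rel.symm, Rel.trans hI⟩

/-- Composition of a fraction with a 2-cell. -/
def post (s : Span b i f) (θ : f ⟶ f') : Span b i f' :=
  ⟨s.apex, s.right, s.left, s.cell ≫ X.map s.right.op ◁ θ⟩

theorem Rel.post {s t : Span b i f} (θ : f ⟶ f') : Rel s t → Rel (s.post θ) (t.post θ) := by
  rintro ⟨m, w, w', γ, δ, e⟩
  refine ⟨m, w, w', γ, δ, ?_⟩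
  simp only [Span.post]
  rw [transl_comp, transl_comp, transl_whiskerLeft, transl_whiskerLeft, Category.assoc]
  simp only [act, tr] at *
  rw [whisker_exchange, reassoc_of% e]

/-- A fraction to the translate of `f` along `u` as a fraction to `f`. -/
def untr (u : i ⟶ j) (s : Span b j (tr X u f)) : Span b i f :=
  ⟨s.apex, u ≫ s.right, s.left, s.cell ≫ (trComp X u s.right f).inv⟩

/-- Translating commutes with regarding a fraction to a translate as a fraction to `f`. Hence the
two comparison conditions are equivalent as soon as the comparison of right legs is the whiskering
by `u` of a 2-cell `κ`. -/
theorem untr_cell_eq {u : i ⟶ j} {m k k' : I} {x : j ⟶ k} {x' : j ⟶ k'} {y : b.idx ⟶ k}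
    {y' : b.idx ⟶ k'} {w : k ⟶ m} {w' : k' ⟶ m} (α : tr X y b.hom ⟶ tr X x (tr X u f))
    (α' : tr X y' b.hom ⟶ tr X x' (tr X u f)) (κ : x ≫ w ⟶ x' ≫ w') (δ : y ≫ w ⟶ y' ≫ w') :
    transl w (α ≫ (trComp X u x f).inv) ≫
        act X ((α_ _ _ _).hom ≫ u ◁ κ ≫ (α_ _ _ _).inv) f =
      act X δ b.hom ≫ transl w' (α' ≫ (trComp X u x' f).inv) ↔
    transl w α ≫ act X κ (tr X u f) = act X δ b.hom ≫ transl w' α' := by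
  have e : (trComp X u (x ≫ w) f).inv ≫ act X (u ◁ κ) f =
      act X κ (tr X u f) ≫ (trComp X u (x' ≫ w') f).inv := by
    rw [Iso.inv_comp_eq, ← Category.assoc, Iso.eq_comp_inv]
    exact trComp_act_right u κ
  rw [transl_trComp_inv, transl_trComp_inv]
  simp only [act_comp, Category.assoc]
  rw [← act_comp_assoc (α_ u x w).inv, Iso.inv_hom_id, act_id, Category.id_comp, reassoc_of% e]
  rw [← cancel_mono ((trComp X u (x' ≫ w') f).inv ≫ (actIso (α_ u x' w').symm f).hom)]
  simp

theorem Rel.untr {u : i ⟶ j} {s t : Span b j (tr X u f)} :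
    Rel s t → Rel (s.untr u) (t.untr u) := by
  rintro ⟨m, w, w', γ, δ, e⟩
  exact ⟨m, w, w', α_ _ _ _ ≪≫ whiskerLeftIso u γ ≪≫ (α_ _ _ _).symm, δ,
    (untr_cell_eq s.cell t.cell γ.hom δ.hom).2 e⟩

/-- The given comparison of right legs is between composites starting with `u` and need not be a
whiskering by `u`; `exists_whiskerLeft_eq` makes it one at a later stage. -/
theorem Rel.of_untr (hI : IsTwoFiltered I) {u : i ⟶ j} {s t : Span b j (tr X u f)} :
    Rel (s.untr u) (t.untr u) → Rel s t := by
  rintro ⟨m, (w : s.apex ⟶ m), (w' : t.apex ⟶ m),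
    (γ : (u ≫ s.right) ≫ w ≅ (u ≫ t.right) ≫ w'), (δ : s.left ≫ w ≅ t.left ≫ w'), e⟩
  obtain ⟨d, h, κ, hκ⟩ := hI.exists_whiskerLeft_eq u (p := s.right ≫ w) (q := t.right ≫ w')
    ((α_ _ _ _).symm ≪≫ γ ≪≫ α_ _ _ _)
  have e' := rel_extend e h
  refine ⟨d, w ≫ h, w' ≫ h, (α_ _ _ _).symm ≪≫ κ ≪≫ α_ _ _ _,
    (α_ _ _ _).symm ≪≫ whiskerRightIso δ h ≪≫ α_ _ _ _, ?_⟩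
  refine (untr_cell_eq s.cell t.cell _ _).1 (Eq.trans ?_ e')
  congr 2
  simp only [Iso.trans_hom, Iso.symm_hom, Bicategory.whiskerLeft_comp, hκ]
  simp
  rfl

/-- A square on `s.right` and `u` yields a further stage at which the right leg factors through `u`
up to isomorphism. -/
theorem exists_untr_rel (hI : IsTwoFiltered I) (u : i ⟶ j) (s : Span b i f) :
    ∃ t : Span b j (tr X u f), Rel (t.untr u) s := by
  obtain ⟨m, w, w', ⟨γ⟩⟩ := hI.exists_square s.right u
  refine ⟨⟨m, w', s.left ≫ w, transl w s.cell ≫ act X γ.hom f ≫ (trComp X u w' f).hom⟩,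
    Rel.symm ⟨m, w, 𝟙 m, γ ≪≫ (ρ_ _).symm, (ρ_ _).symm, ?_⟩⟩
  have := transl_one (transl w s.cell ≫ act X γ.hom f)
  simp only [untr, Category.assoc, Iso.hom_inv_id, Category.comp_id]
  simp only [Iso.trans_hom, Iso.symm_hom, act_comp]
  change _ = (actIso (ρ_ _) _).inv ≫ _
  rw [Iso.eq_inv_comp]
  change act X (ρ_ _).hom _ ≫ _ ≫ _ ≫ (actIso (ρ_ _) _).inv = _
  rw [← Category.assoc, ← Category.assoc, Iso.comp_inv_eq, Category.assoc]
  exact this.symm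

variable (hI : IsTwoFiltered I)

variable (b) in
/-- Fractions from `b` to `(i, f)` up to equivalence, as a functor in `f`. -/
def functor (i : I) : (X.obj (op i) ⟶ D) ⥤ Type w where
  obj f := Quotient (setoid hI b i f)
  map θ := ↾(Quotient.map' (s₁ := setoid hI b i _) (s₂ := setoid hI b i _) (fun s => s.post θ)
    fun _ _ h => Rel.post θ h)
  map_id f := by
    ext ⟨s⟩
    exact congrArg (fun α => Quotient.mk (setoid hI b i f) ⟨s.apex, s.right, s.left, α⟩) (by simp)
  map_comp θ θ' := by
    ext ⟨s⟩
    exact congrArg (fun α => Quotient.mk (setoid hI b i _) ⟨s.apex, s.right, s.left, α⟩)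
      (by simp only [post, Bicategory.whiskerLeft_comp]; exact (Category.assoc _ _ _).symm)

variable (b) in
/-- Fractions to `(i, f)` and to its translates correspond. -/
noncomputable def untrIso (u : i ⟶ j) (f : X.obj (op i) ⟶ D) :
    (functor b hI j).obj (tr X u f) ≅ (functor b hI i).obj f :=
  Equiv.toIso <| Equiv.ofBijective
    (Quotient.map' (s₁ := setoid hI b j _) (s₂ := setoid hI b i _) (fun s => s.untr u)
      fun _ _ h => Rel.untr h)
    ⟨by
      rintro ⟨s⟩ ⟨t⟩ h
      exact Quotient.sound (s := setoid hI b j _) (Rel.of_untr hI (Quotient.exact h)),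
    by
      rintro ⟨s⟩
      obtain ⟨t, ht⟩ := exists_untr_rel hI u s
      exact ⟨Quotient.mk (setoid hI b j _) t, Quotient.sound (s := setoid hI b i _) ht⟩⟩

theorem untr_post_cell {k : I} {v : b.idx ⟶ k} (u : i ⟶ j) (x : j ⟶ k) (θ : f ⟶ f')
    (α : tr X v b.hom ⟶ tr X x (tr X u f)) :
    (α ≫ X.map x.op ◁ X.map u.op ◁ θ) ≫ (trComp X u x f').inv =
      (α ≫ (trComp X u x f).inv) ≫ X.map (u ≫ x).op ◁ θ := by
  rw [Iso.comp_inv_eq, Category.assoc, Category.assoc, trComp_naturality, Iso.inv_hom_id_assoc]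

theorem rel_of_eq (hI : IsTwoFiltered I) {k : I} {u u' : i ⟶ k} {v : b.idx ⟶ k} (γ : u ⟶ u')
    {α : tr X v b.hom ⟶ tr X u f} {β : tr X v b.hom ⟶ tr X u' f} (h : α ≫ act X γ f = β) :
    Rel (⟨k, u, v, α⟩ : Span b i f) ⟨k, u', v, β⟩ :=
  h ▸ rel_of_act hI γ α

theorem iso_rotate {E : Type u₁} [Category.{v₁} E] {a b c d : E} (e : b ≅ a) (e' : d ≅ c)
    {p : a ⟶ c} {q : b ⟶ d} (h : e.hom ≫ p = q ≫ e'.hom) : p ≫ e'.inv = e.inv ≫ q := by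
  rw [Iso.comp_inv_eq, Category.assoc, ← h, Iso.inv_hom_id_assoc]

variable (b) in
/-- Fractions from `b`, as a functor of the target. -/
noncomputable def toType : Obj X D ⥤ Type w :=
  -- Gluing along `u` acts by the inverse of the bijection `untrIso`. For the identity, composition
  -- and 2-cell relations the two fractions to be compared have different right legs, related by a
  -- unitor, an associator or a whiskered 2-cell of `I`, and `rel_of_eq` identifies them.
  desc (functor b hI) (fun u f => (untrIso b hI u f).symm)
    (fun {i j} u {f g} α => iso_rotate _ _ (by
      ext ⟨s⟩
      refine congrArg (fun α => Quotient.mk (setoid hI b i _)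
        ⟨s.apex, u ≫ s.right, s.left, α⟩) ?_
      exact (untr_post_cell u s.right α s.cell).symm))
    (fun i f => by
      rw [Iso.symm_hom, Iso.inv_comp_eq, Category.comp_id]
      ext ⟨s⟩
      refine Quotient.sound (s := setoid hI b i _) (Rel.symm (rel_of_eq hI (λ_ s.right).hom ?_))
      change (_ ≫ _) ≫ _ = s.cell ≫ X.map s.right.op ◁ (trId X f).hom
      rw [act_leftUnitor, Category.assoc, Iso.inv_hom_id_assoc])
    (fun {i j k} u v f => by
      rw [Iso.symm_hom, Iso.inv_comp_eq, Iso.symm_hom, Iso.symm_hom, ← Category.assoc,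
        Iso.eq_comp_inv, Iso.eq_comp_inv]
      ext ⟨s⟩
      refine Quotient.sound (s := setoid hI b i _) (rel_of_eq hI (α_ u v s.right).inv ?_)
      change ((((s.cell ≫ X.map s.right.op ◁ (trComp X u v f).hom) ≫
        (trComp X v s.right (tr X u f)).inv) ≫ (trComp X u (v ≫ s.right) f).inv)) ≫
          (actIso (α_ u v s.right) f).inv = s.cell ≫ (trComp X (u ≫ v) s.right f).inv
      rw [Iso.comp_inv_eq, Iso.comp_inv_eq, Iso.comp_inv_eq, Category.assoc, Category.assoc]
      simp only [Category.assoc, actIso_hom, trComp_assoc, Iso.inv_hom_id_assoc])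
    (fun {i j u v} η f => by
      rw [Iso.symm_hom, Iso.symm_hom, Iso.inv_comp_eq, Iso.eq_comp_inv]
      ext ⟨s⟩
      refine Quotient.sound (s := setoid hI b i _) (Rel.symm (rel_of_eq hI (η ▷ s.right) ?_))
      change (s.cell ≫ (trComp X u s.right f).inv) ≫ _ =
        (s.cell ≫ X.map s.right.op ◁ act X η f) ≫ (trComp X v s.right f).inv
      rw [Iso.eq_comp_inv, Category.assoc, trComp_act_left, Category.assoc, Iso.inv_hom_id_assoc])

/-- The class of a fraction. -/
def cls (s : Span b i f) : (toType b hI).obj ⟨i, f⟩ := Quotient.mk (setoid hI b i f) s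

theorem toType_map_incl (θ : f ⟶ f') (s : Span b i f) :
    (toType b hI).map ((incl X i D).map θ) (cls hI s) = cls hI (s.post θ) := rfl

theorem toType_map_glue_inv (u : i ⟶ j) (s : Span b j (tr X u f)) :
    (toType b hI).map (glue X u f).inv (cls hI s) = cls hI (s.untr u) := rfl

theorem toType_map_glue_hom (u : i ⟶ j) (s : Span b j (tr X u f)) :
    (toType b hI).map (glue X u f).hom (cls hI (s.untr u)) = cls hI s := by
  rw [← toType_map_glue_inv]
  exact (untrIso b hI u f).hom_inv_id_apply _

theorem cls_eq_of_eq {u u' : i ⟶ k} {v : b.idx ⟶ k} (γ : u ⟶ u') {α : tr X v b.hom ⟶ tr X u f}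
    {β : tr X v b.hom ⟶ tr X u' f} (h : α ≫ act X γ f = β) :
    cls hI (⟨k, u, v, α⟩ : Span b i f) = cls hI ⟨k, u', v, β⟩ :=
  Quotient.sound (s := setoid hI b i f) (rel_of_eq hI γ h)

/-- The functor `toType` recovers a fraction, up to equivalence, from the arrow it represents. Equal
arrows therefore come from equivalent fractions. -/
theorem toType_map_frac {k : I} (u : i ⟶ k) (v : b.idx ⟶ k) (α : tr X v b.hom ⟶ tr X u f) :
    (toType b hI).map (frac v u α) (cls hI ⟨b.idx, 𝟙 _, 𝟙 _, 𝟙 _⟩) = cls hI ⟨k, u, v, α⟩ := by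
  -- Gluing along `v` acts as the inverse of `untr`, so the identity fraction is first rewritten as
  -- an `untr` along `v`, after translating it along `v`.
  have h₁ : cls hI (⟨b.idx, 𝟙 _, 𝟙 _, 𝟙 _⟩ : Span b b.idx b.hom) =
      cls hI ((⟨k, 𝟙 k, v, (trId X (tr X v b.hom)).inv⟩ : Span b k (tr X v b.hom)).untr v) := by
    refine Eq.trans (b := cls hI (⟨k, v, v, 𝟙 _⟩ : Span b b.idx b.hom)) ?_ ?_
    · refine Quotient.sound (s := setoid hI b _ _) ⟨k, v, 𝟙 k, λ_ v ≪≫ (ρ_ v).symm,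
        λ_ v ≪≫ (ρ_ v).symm, ?_⟩
      change transl v (𝟙 _) ≫ _ = _ ≫ transl (𝟙 k) (𝟙 _)
      rw [transl_id, transl_id]
      exact (Category.id_comp _).trans (Category.comp_id _).symm
    · refine (cls_eq_of_eq hI (ρ_ v).hom ?_).symm
      rw [act_rightUnitor, Category.assoc, Iso.inv_hom_id_assoc, Iso.inv_hom_id]
  rw [frac, CategoryTheory.Functor.map_comp, CategoryTheory.Functor.map_comp]
  change (toType b hI).map (glue X u f).inv ((toType b hI).map ((incl X k D).map α)
    ((toType b hI).map (glue X v b.hom).hom _)) = _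
  rw [h₁, toType_map_glue_hom, toType_map_incl, toType_map_glue_inv]
  refine cls_eq_of_eq hI (ρ_ u).hom ?_
  change (((trId X (tr X v b.hom)).inv ≫ X.map (𝟙 k).op ◁ α) ≫ (trComp X u (𝟙 k) f).inv) ≫ _ = _
  rw [act_rightUnitor, Category.assoc, Iso.inv_hom_id_assoc, Category.assoc, trId_naturality,
    Iso.inv_hom_id_assoc]

end Span
end Span

/-! ### Equality and invertibility of fractions at a finite stage. -/

section Exact
variable {C : Type u} [Bicategory.{w, w} C] {I : Type w} [Bicategory.{w, w} I]
  {X : StrictPseudofunctor Iᵒᵖ C} {D : C} (hI : IsTwoFiltered I) {i j k : I}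
  {f : X.obj (op i) ⟶ D} {g : X.obj (op j) ⟶ D}
include hI

theorem exists_frac' (q : (incl X i D).obj f ⟶ (incl X j D).obj g) :
    ∃ (l : I) (u : i ⟶ l) (v : j ⟶ l) (α : tr X u f ⟶ tr X v g), q = frac u v α :=
  exists_frac hI q

/-- Evaluating `toType` at the identity fraction turns the equality of arrows into an equivalence of
fractions, which is then straightened to a comparison along a single translation. -/
theorem exists_transl_eq {u : i ⟶ k} {v : j ⟶ k} {α β : tr X u f ⟶ tr X v g}
    (h : frac u v α = frac u v β) : ∃ (l : I) (w : k ⟶ l), transl w α = transl w β := by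
  have h' := Span.toType_map_frac (b := ⟨i, f⟩) hI v u α
  have e := h'.symm.trans ((congrArg (fun p => (Span.toType ⟨i, f⟩ hI).map p _) h).trans
    (Span.toType_map_frac (b := ⟨i, f⟩) hI v u β))
  obtain ⟨m, w, w', γ, δ, e⟩ := Quotient.exact (s := Span.setoid hI ⟨i, f⟩ j g) e
  change k ⟶ m at w w'
  change v ≫ w ≅ v ≫ w' at γ
  change u ≫ w ≅ u ≫ w' at δ
  -- The equivalence translates `α` along `w` and `β` along a possibly different `w'`. One
  -- isomorphism `κ` between their extensions induces both comparisons `γ` and `δ`, so interchange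
  -- replaces `w'` by `w`.
  obtain ⟨l, h, κ, h₁, h₂⟩ := hI.exists_whiskerLeft_eq₂ v u γ δ
  refine ⟨l, w ≫ h, ?_⟩
  have e₁ := Span.rel_extend e h
  have e₂ := transl_naturality κ.hom β
  rw [← cancel_mono (actIso (whiskerLeftIso v κ) g).hom]
  simp only [actIso_hom, whiskerLeftIso_hom]
  rw [e₂, h₁, h₂]
  exact e₁

/-- An arrow in the other direction is a fraction with unrelated legs; comparing both pairs of legs
simultaneously moves it onto extensions of `u` and `v`. -/
theorem exists_frac_eq (u : i ⟶ k) (v : j ⟶ k) (q : (incl X j D).obj g ⟶ (incl X i D).obj f) :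
    ∃ (l : I) (w : k ⟶ l) (β : tr X (v ≫ w) g ⟶ tr X (u ≫ w) f),
      q = frac (v ≫ w) (u ≫ w) β := by
  obtain ⟨k', v', u', β, rfl⟩ := exists_frac' hI q
  obtain ⟨l, w, w', ⟨γ⟩, ⟨δ⟩⟩ := hI.exists_square₂ v v' u u'
  refine ⟨l, w, act X γ.hom g ≫ transl w' β ≫ act X δ.inv f, ?_⟩
  rw [frac_act_left, frac_act_right, frac_transl]

/-- The inverse arrow is represented by a cell `β` over the same legs after a translation. Each of
the two composites represents an identity, hence is one after a further translation. -/
theorem exists_isIso_transl {u : i ⟶ k} {v : j ⟶ k} {α : tr X u f ⟶ tr X v g}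
    (h : IsIso (frac u v α)) : ∃ (l : I) (w : k ⟶ l), IsIso (transl w α) := by
  obtain ⟨l, w, β, hβ⟩ := exists_frac_eq hI u v (inv (frac u v α))
  have h₁ : frac (u ≫ w) (u ≫ w) (transl w α ≫ β) = frac (u ≫ w) (u ≫ w) (𝟙 _) := by
    rw [← frac_comp, ← hβ, frac_transl, frac_id, IsIso.hom_inv_id]
  have h₂ : frac (v ≫ w) (v ≫ w) (β ≫ transl w α) = frac (v ≫ w) (v ≫ w) (𝟙 _) := by
    rw [← frac_comp, ← hβ, frac_transl, frac_id, IsIso.inv_hom_id]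
  obtain ⟨l₁, w₁, e₁⟩ := exists_transl_eq hI h₁
  have h₃ : frac ((v ≫ w) ≫ w₁) _ (transl w₁ (β ≫ transl w α)) =
      frac _ _ (transl w₁ (𝟙 (tr X (v ≫ w) g))) := by
    rw [frac_transl, frac_transl, h₂]
  obtain ⟨l₂, w₂, e₂⟩ := exists_transl_eq hI h₃
  have h₄ : IsIso (transl w₂ (transl w₁ (transl w α))) := by
    refine ⟨transl w₂ (transl w₁ β), ?_, ?_⟩
    · rw [← transl_comp, ← transl_comp, e₁, transl_id, transl_id]
    · rw [← transl_comp, ← transl_comp, e₂, transl_id, transl_id]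
  refine ⟨l₂, (w ≫ w₁) ≫ w₂, ?_⟩
  rw [transl_comp_eq, transl_comp_eq, transl_comp, transl_comp, transl_act, transl_act]
  simp only [← actIso_hom, ← actIso_inv, ← whiskerRightIso_hom, ← whiskerRightIso_inv]
  infer_instance

end Exact
end Colim
end TwoPro

/-! ### Yoneda for representables, and diagrams with values `L X_j`. -/

namespace TwoPro

section ReprExt
variable {C : Type u} [Bicategory.{w, w} C] [Strict C]

omit [Strict C] in
theorem comp₂_eq_of_eq {F G : StrictPseudofunctor C Cat.{w, w}} {θ η : F ⟶ G} {ρ σ : θ ⟶ η}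
    {D : C} {x y : F.obj D} (h : x = y) (e : comp₂ ρ D x = comp₂ σ D x) :
    comp₂ ρ D y = comp₂ σ D y := by
  subst h; exact e

/-- A modification out of a representable is determined by its value at the identity. -/
theorem repr_hom_ext {A : C} {G : StrictPseudofunctor C Cat.{w, w}} {θ η : repr A ⟶ G}
    {ρ σ : θ ⟶ η} (h : comp₂ ρ A (𝟙 A : A ⟶ A) = comp₂ σ A (𝟙 A : A ⟶ A)) : ρ = σ :=
  comp₂_ext fun D (f : A ⟶ D) => comp₂_eq_of_eq (Strict.id_comp f) <| by
    have h₁ := comp₂_naturality ρ f (𝟙 A : A ⟶ A)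
    have h₂ := comp₂_naturality σ f (𝟙 A : A ⟶ A)
    rw [h] at h₁
    exact h₁.trans h₂.symm

/-- By Yoneda, these modifications inject into a hom-set of the small category `G.obj A`. This is
what makes the 1-cells of `F.Idx` a small set although modifications range over all objects of `C`.
-/
instance {A : C} {G : StrictPseudofunctor C Cat.{w, w}} (θ η : repr A ⟶ G) :
    Small.{w} (θ ≅ η) :=
  small_of_injective (f := fun e : θ ≅ η => comp₂ e.hom A (𝟙 A : A ⟶ A)) fun _ _ h =>
    Iso.ext (repr_hom_ext h)

theorem reprMap_comp {A B D : C} (r : A ⟶ B) (s : B ⟶ D) :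
    reprMap s ≫ reprMap r = reprMap (r ≫ s) :=
  ((yoneda₂ C).map_comp s.op r.op).symm

theorem reprMap_id (A : C) : reprMap (𝟙 A) = 𝟙 (repr A) :=
  (yoneda₂ C).map_id (op A)

theorem comp₂_eqToHom_reprMap_comp {A B D E : C} (r : A ⟶ B) (s : B ⟶ D) (f : D ⟶ E) :
    comp₂ (eqToHom (reprMap_comp r s)) E f = (α_ r s f).inv := by
  refine (comp₂_eqToHom (reprMap_comp r s) E f).trans ?_
  rw [Strict.associator_eqToIso]
  rfl

theorem comp₂_eqToHom_reprMap_id {A E : C} (f : A ⟶ E) :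
    comp₂ (eqToHom (reprMap_id A)) E f = (λ_ f).hom := by
  refine (comp₂_eqToHom (reprMap_id A) E f).trans ?_
  rw [Strict.leftUnitor_eqToIso]
  rfl

/-- The component of an invertible modification. -/
def comp₂Iso {F G : StrictPseudofunctor C Cat.{w, w}} {θ η : F ⟶ G} (e : θ ≅ η) (D : C)
    (x : F.obj D) : (θ.trans.app D).toFunctor.obj x ≅ (η.trans.app D).toFunctor.obj x where
  hom := comp₂ e.hom D x
  inv := comp₂ e.inv D x
  hom_inv_id := congrArg (fun ρ => comp₂ ρ D x) e.hom_inv_id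
  inv_hom_id := congrArg (fun ρ => comp₂ ρ D x) e.inv_hom_id

end ReprExt

/-- A pseudofunctor from `J` to `Hom(C, Cat)` with values `L X_j` for 2-pro-objects `X_j`. -/
structure ProDiagram (J : Type w) [Bicategory.{w, w} J] (C : Type u) [Bicategory.{w, w} C]
    [Strict C] where
  obj : J → TwoProObj C
  map {i j : J} : (i ⟶ j) → ((obj i).L ⟶ (obj j).L)
  map₂ {i j : J} {a b : i ⟶ j} : (a ⟶ b) → (map a ⟶ map b)
  mapId (i : J) : map (𝟙 i) ≅ 𝟙 (obj i).L
  mapComp {i j k : J} (a : i ⟶ j) (b : j ⟶ k) : map (a ≫ b) ≅ map a ≫ map b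
  map₂_id {i j : J} (a : i ⟶ j) : map₂ (𝟙 a) = 𝟙 (map a)
  map₂_comp {i j : J} {a b c : i ⟶ j} (α : a ⟶ b) (β : b ⟶ c) :
    map₂ (α ≫ β) = map₂ α ≫ map₂ β
  map₂_whisker_left {i j k : J} (a : i ⟶ j) {b c : j ⟶ k} (β : b ⟶ c) :
    map₂ (a ◁ β) = (mapComp a b).hom ≫ map a ◁ map₂ β ≫ (mapComp a c).inv
  map₂_whisker_right {i j k : J} {a b : i ⟶ j} (α : a ⟶ b) (c : j ⟶ k) :
    map₂ (α ▷ c) = (mapComp a c).hom ≫ map₂ α ▷ map c ≫ (mapComp b c).inv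
  map₂_associator {i j k l : J} (a : i ⟶ j) (b : j ⟶ k) (c : k ⟶ l) :
    map₂ (α_ a b c).hom = (mapComp (a ≫ b) c).hom ≫ (mapComp a b).hom ▷ map c ≫
      (α_ (map a) (map b) (map c)).hom ≫ map a ◁ (mapComp b c).inv ≫ (mapComp a (b ≫ c)).inv
  map₂_left_unitor {i j : J} (a : i ⟶ j) :
    map₂ (λ_ a).hom = (mapComp (𝟙 i) a).hom ≫ (mapId i).hom ▷ map a ≫ (λ_ (map a)).hom
  map₂_right_unitor {i j : J} (a : i ⟶ j) :
    map₂ (ρ_ a).hom = (mapComp a (𝟙 j)).hom ≫ map a ◁ (mapId j).hom ≫ (ρ_ (map a)).hom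

namespace ProDiagram
variable {J : Type w} [Bicategory.{w, w} J] {C : Type u} [Bicategory.{w, w} C] [Strict C]
  (F : ProDiagram J C)

/-- The underlying pseudofunctor. -/
def toPseudofunctor : Pseudofunctor J (StrictPseudofunctor C Cat.{w, w}) where
  obj j := (F.obj j).L
  map := F.map
  map₂ := F.map₂
  mapId := F.mapId
  mapComp := F.mapComp
  map₂_id := F.map₂_id
  map₂_comp := F.map₂_comp
  map₂_whisker_left := F.map₂_whisker_left
  map₂_whisker_right := F.map₂_whisker_right
  map₂_associator := F.map₂_associator
  map₂_left_unitor := F.map₂_left_unitor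
  map₂_right_unitor := F.map₂_right_unitor

section Components
variable {D : C}

/-- The value of `F a` at `D`. -/
abbrev ev {i j : J} (a : i ⟶ j) (D : C) :
    Colim.Obj (F.obj i).diagram D ⥤ Colim.Obj (F.obj j).diagram D :=
  ((F.map a).trans.app D).toFunctor

/-- The component of `F α`. -/
abbrev ev₂ {i j : J} {a b : i ⟶ j} (α : a ⟶ b) : F.ev a D ⟶ F.ev b D :=
  (Pseudofunctor.StrongTrans.Modification.app
    (Pseudofunctor.StrongTrans.Hom.as (F.map₂ α)) D).toNatTrans

variable {i j k l : J} (a : i ⟶ j) (b : j ⟶ k) (c : k ⟶ l) (x : Colim.Obj (F.obj i).diagram D)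

/-- The component of `F.mapComp`. -/
def evComp : (F.ev (a ≫ b) D).obj x ≅ (F.ev b D).obj ((F.ev a D).obj x) :=
  comp₂Iso (F.mapComp a b) D x

/-- The component of `F.mapId`. -/
def evId : (F.ev (𝟙 i) D).obj x ≅ x :=
  comp₂Iso (F.mapId i) D x

theorem evComp_naturality {x y : Colim.Obj (F.obj i).diagram D} (p : x ⟶ y) :
    (F.ev (a ≫ b) D).map p ≫ (F.evComp a b y).hom =
      (F.evComp a b x).hom ≫ (F.ev b D).map ((F.ev a D).map p) :=
  (Pseudofunctor.StrongTrans.Modification.app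
    (Pseudofunctor.StrongTrans.Hom.as (F.mapComp a b).hom) D).toNatTrans.naturality p

theorem evId_naturality {x y : Colim.Obj (F.obj i).diagram D} (p : x ⟶ y) :
    (F.ev (𝟙 i) D).map p ≫ (F.evId y).hom = (F.evId x).hom ≫ p :=
  (Pseudofunctor.StrongTrans.Modification.app
    (Pseudofunctor.StrongTrans.Hom.as (F.mapId i).hom) D).toNatTrans.naturality p

theorem ev₂_id : (F.ev₂ (𝟙 a)).app x = 𝟙 _ :=
  congrArg (fun ρ => comp₂ ρ D x) (F.map₂_id a)

variable {a b} {a' a'' : i ⟶ j} {b' : j ⟶ k}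

theorem ev₂_comp (α : a ⟶ a') (β : a' ⟶ a'') :
    (F.ev₂ (α ≫ β)).app x = (F.ev₂ α).app x ≫ (F.ev₂ β).app x :=
  congrArg (fun ρ => comp₂ ρ D x) (F.map₂_comp α β)

theorem ev₂_comp_assoc (α : a ⟶ a') (β : a' ⟶ a'') {y : Colim.Obj (F.obj j).diagram D}
    (p : (F.ev a'' D).obj x ⟶ y) :
    (F.ev₂ (α ≫ β)).app x ≫ p = (F.ev₂ α).app x ≫ (F.ev₂ β).app x ≫ p := by
  rw [ev₂_comp, Category.assoc]

/-- The component of `F` at an invertible 2-cell. -/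
@[simps]
def ev₂Iso (e : a ≅ a') : (F.ev a D).obj x ≅ (F.ev a' D).obj x where
  hom := (F.ev₂ e.hom).app x
  inv := (F.ev₂ e.inv).app x
  hom_inv_id := by rw [← ev₂_comp, e.hom_inv_id, ev₂_id]
  inv_hom_id := by rw [← ev₂_comp, e.inv_hom_id, ev₂_id]

variable (a) in
theorem ev₂_whiskerLeft (β : b ⟶ b') : (F.ev₂ (a ◁ β)).app x ≫ (F.evComp a b' x).hom =
    (F.evComp a b x).hom ≫ (F.ev₂ β).app ((F.ev a D).obj x) := by
  rw [← Iso.eq_comp_inv, Category.assoc]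
  exact congrArg (fun ρ => comp₂ ρ D x) (F.map₂_whisker_left a β)

variable (b) in
theorem ev₂_whiskerRight (α : a ⟶ a') : (F.ev₂ (α ▷ b)).app x ≫ (F.evComp a' b x).hom =
    (F.evComp a b x).hom ≫ (F.ev b D).map ((F.ev₂ α).app x) := by
  rw [← Iso.eq_comp_inv, Category.assoc]
  exact congrArg (fun ρ => comp₂ ρ D x) (F.map₂_whisker_right α b)

theorem ev₂_associator : (F.ev₂ (α_ a b c).hom).app x ≫ (F.evComp a (b ≫ c) x).hom ≫
    (F.evComp b c _).hom = (F.evComp (a ≫ b) c x).hom ≫ (F.ev c D).map (F.evComp a b x).hom := by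
  rw [← Category.assoc, ← Iso.eq_comp_inv, ← Iso.eq_comp_inv, Category.assoc, Category.assoc]
  refine (congrArg (fun ρ => comp₂ ρ D x) (F.map₂_associator a b c)).trans ?_
  exact congrArg (_ ≫ _ ≫ ·) (Category.id_comp _)

theorem ev₂_leftUnitor : (F.ev₂ (λ_ a).hom).app x =
    (F.evComp (𝟙 i) a x).hom ≫ (F.ev a D).map (F.evId x).hom := by
  refine (congrArg (fun ρ => comp₂ ρ D x) (F.map₂_left_unitor a)).trans ?_
  exact congrArg (_ ≫ ·) (Category.comp_id _)

theorem ev₂_rightUnitor : (F.ev₂ (ρ_ a).hom).app x =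
    (F.evComp a (𝟙 j) x).hom ≫ (F.evId _).hom := by
  refine (congrArg (fun ρ => comp₂ ρ D x) (F.map₂_right_unitor a)).trans ?_
  exact congrArg (_ ≫ ·) (Category.comp_id _)

end Components
end ProDiagram
end TwoPro

/-! ### The index 2-category of a diagram of 2-pro-objects. -/

namespace TwoPro
namespace ProDiagram
variable {J : Type w} [Bicategory.{w, w} J] {C : Type u} [Bicategory.{w, w} C] [Strict C]
  (F : ProDiagram J C)

/-- The objects of the index 2-category of the limit of a diagram of 2-pro-objects. -/
structure Idx : Type w where
  fst : J
  snd : (F.obj fst).Index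

variable {F}

namespace Idx

/-- The object of `C` at an index. -/
abbrev val (κ : F.Idx) : C := (F.obj κ.fst).diagram.obj (op κ.snd)

/-- The canonical functor from `C(X_κ, D)`. -/
abbrev inc (κ : F.Idx) (D : C) : (κ.val ⟶ D) ⥤ Colim.Obj (F.obj κ.fst).diagram D :=
  Colim.incl (F.obj κ.fst).diagram κ.snd D

/-- The canonical transformation from `C(X_κ, -)`. -/
abbrev proj (κ : F.Idx) : repr κ.val ⟶ (F.obj κ.fst).L := (F.obj κ.fst).coconeApp κ.snd

/-- The 1-cells `κ ⟶ μ`: pairs of a 1-cell `a` of `J` and a 1-cell `r : X_μ ⟶ X_κ` representing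
the restriction of `F a`. -/
structure Hom (κ μ : F.Idx) : Type w where
  fst : κ.fst ⟶ μ.fst
  snd : μ.val ⟶ κ.val
  shrunkIso : Shrink.{w} (κ.proj ≫ F.map fst ≅ reprMap snd ≫ μ.proj)

namespace Hom
variable {κ μ ν ξ : F.Idx}

/-- The isomorphism witnessing that `snd` represents `F.map fst`. -/
noncomputable def iso (k : Hom κ μ) : κ.proj ≫ F.map k.fst ≅ reprMap k.snd ≫ μ.proj :=
  (equivShrink _).symm k.shrunkIso

/-- The components of `iso`. -/
noncomputable def comp (k : Hom κ μ) {D : C} (f : κ.val ⟶ D) :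
    (F.ev k.fst D).obj ((κ.inc D).obj f) ≅ (μ.inc D).obj (k.snd ≫ f) :=
  comp₂Iso k.iso D f

theorem comp_naturality (k : Hom κ μ) {D : C} {f g : κ.val ⟶ D} (θ : f ⟶ g) :
    (F.ev k.fst D).map ((κ.inc D).map θ) ≫ (k.comp g).hom =
      (k.comp f).hom ≫ (μ.inc D).map (k.snd ◁ θ) :=
  (Pseudofunctor.StrongTrans.Modification.app
    (Pseudofunctor.StrongTrans.Hom.as k.iso.hom) D).toNatTrans.naturality θ

/-- A 1-cell from an isomorphism of transformations. -/
noncomputable abbrev mkOfIso (a : κ.fst ⟶ μ.fst) (r : μ.val ⟶ κ.val)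
    (e : κ.proj ≫ F.map a ≅ reprMap r ≫ μ.proj) : Hom κ μ :=
  ⟨a, r, equivShrink _ e⟩

theorem comp_mkOfIso (a : κ.fst ⟶ μ.fst) (r : μ.val ⟶ κ.val)
    (e : κ.proj ≫ F.map a ≅ reprMap r ≫ μ.proj) {D : C} (f : κ.val ⟶ D) :
    (mkOfIso a r e).comp f = comp₂Iso e D f := by
  have : (mkOfIso a r e).iso = e := Equiv.symm_apply_apply _ _
  exact congrArg (fun e => comp₂Iso e D f) this

theorem inc_map_id_whiskerRight (r : μ.val ⟶ κ.val) {D : C} (f : κ.val ⟶ D)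
    {x : Colim.Obj (F.obj μ.fst).diagram D} (p : x ⟶ (μ.inc D).obj (r ≫ f)) :
    p ≫ (μ.inc D).map (𝟙 r ▷ f) = p := by
  rw [id_whiskerRight, CategoryTheory.Functor.map_id]
  exact Category.comp_id _

/-- The last hypothesis has the shape of the compatibility condition of a 2-cell whose components
are `eqToHom`s, so that equality of 1-cells can be read off from such a 2-cell. -/
theorem ext' {k l : Hom κ μ} (h₁ : k.fst = l.fst) (h₂ : k.snd = l.snd)
    (h : ∀ (D : C) (f : κ.val ⟶ D), (k.comp f).hom ≫ (μ.inc D).map (eqToHom h₂ ▷ f) =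
      (F.ev₂ (eqToHom h₁)).app ((κ.inc D).obj f) ≫ (l.comp f).hom) : k = l := by
  obtain ⟨a, r, φ⟩ := k
  obtain ⟨b, s, ψ⟩ := l
  obtain rfl : a = b := h₁
  obtain rfl : r = s := h₂
  congr 1
  refine (equivShrink _).symm.injective (Iso.ext (comp₂_ext fun D f => ?_))
  have e := h D f
  rw [eqToHom_refl, eqToHom_refl, ev₂_id] at e
  exact ((inc_map_id_whiskerRight r f _).symm.trans e).trans (Category.id_comp _)

/-- The identity. -/
noncomputable abbrev id (κ : F.Idx) : Hom κ κ :=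
  mkOfIso (𝟙 _) (𝟙 _) (whiskerLeftIso κ.proj (F.mapId _) ≪≫ ρ_ _ ≪≫ (λ_ _).symm ≪≫
    whiskerRightIso (eqToIso (reprMap_id _)).symm _)

/-- Composition. -/
noncomputable abbrev vcomp (k : Hom κ μ) (l : Hom μ ν) : Hom κ ν :=
  mkOfIso (k.fst ≫ l.fst) (l.snd ≫ k.snd)
    (whiskerLeftIso κ.proj (F.mapComp _ _) ≪≫ (α_ _ _ _).symm ≪≫
      whiskerRightIso k.iso (F.map l.fst) ≪≫ α_ _ _ _ ≪≫ whiskerLeftIso _ l.iso ≪≫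
      (α_ _ _ _).symm ≪≫ whiskerRightIso (eqToIso (reprMap_comp _ _)) _)

theorem id_comp_hom {D : C} (f : κ.val ⟶ D) : ((id κ).comp f).hom =
    (F.evId _).hom ≫ (κ.inc D).map (λ_ f).inv := by
  refine (congrArg Iso.hom (comp_mkOfIso _ _ _ f)).trans ?_
  have h : comp₂ (eqToIso (reprMap_id κ.val)).inv D f = (λ_ f).inv := by
    refine (IsIso.inv_eq_of_hom_inv_id (f := (λ_ f).hom) ?_).symm.trans (IsIso.Iso.inv_hom _)
    rw [← comp₂_eqToHom_reprMap_id]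
    exact (comp₂Iso (eqToIso (reprMap_id κ.val)) D f).hom_inv_id
  change (F.evId _).hom ≫ 𝟙 _ ≫ 𝟙 _ ≫ (κ.inc D).map (comp₂ (eqToIso (reprMap_id κ.val)).inv D f) = _
  rw [h, Category.id_comp, Category.id_comp]
  rfl

theorem vcomp_comp_hom (k : Hom κ μ) (l : Hom μ ν) {D : C} (f : κ.val ⟶ D) :
    ((k.vcomp l).comp f).hom = (F.evComp k.fst l.fst _).hom ≫ (F.ev l.fst D).map (k.comp f).hom ≫
      (l.comp (k.snd ≫ f)).hom ≫ (ν.inc D).map (α_ l.snd k.snd f).inv := by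
  refine (congrArg Iso.hom (comp_mkOfIso _ _ _ f)).trans ?_
  have h := comp₂_eqToHom_reprMap_comp l.snd k.snd f
  change (F.evComp k.fst l.fst _).hom ≫ 𝟙 _ ≫ (F.ev l.fst D).map (k.comp f).hom ≫ 𝟙 _ ≫
      (l.comp (k.snd ≫ f)).hom ≫ 𝟙 _ ≫ (ν.inc D).map (comp₂ (eqToHom (reprMap_comp l.snd k.snd)) D f) = _
  rw [h]
  simp only [Category.id_comp]
  rfl

/-- The 2-cells. -/
@[ext]
structure Hom₂ (k l : Hom κ μ) : Type w where
  fst : k.fst ⟶ l.fst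
  snd : k.snd ⟶ l.snd
  comm : ∀ {D : C} (f : κ.val ⟶ D), (k.comp f).hom ≫ (μ.inc D).map (snd ▷ f) =
    (F.ev₂ fst).app ((κ.inc D).obj f) ≫ (l.comp f).hom

/-- The compatibility condition in a form usable inside longer composites, needed to paste 2-cells.
-/
theorem Hom₂.comm_assoc {k l : Hom κ μ} (s : Hom₂ k l) {D : C} (f : κ.val ⟶ D)
    {x : Colim.Obj (F.obj μ.fst).diagram D} (p : (μ.inc D).obj (l.snd ≫ f) ⟶ x) :
    (k.comp f).hom ≫ (μ.inc D).map (s.snd ▷ f) ≫ p =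
      (F.ev₂ s.fst).app ((κ.inc D).obj f) ≫ (l.comp f).hom ≫ p := by
  rw [← Category.assoc, s.comm, Category.assoc]

instance : Category (Hom κ μ) where
  Hom k l := Hom₂ k l
  id k := ⟨𝟙 _, 𝟙 _, fun f => by
    rw [ev₂_id, id_whiskerRight, CategoryTheory.Functor.map_id, Category.id_comp]
    exact Category.comp_id _⟩
  comp s t := ⟨s.fst ≫ t.fst, s.snd ≫ t.snd, fun f => by
    rw [comp_whiskerRight, CategoryTheory.Functor.map_comp, s.comm_assoc, t.comm, ev₂_comp_assoc]⟩
  id_comp s := Hom₂.ext (Category.id_comp _) (Category.id_comp _)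
  comp_id s := Hom₂.ext (Category.comp_id _) (Category.comp_id _)
  assoc s t u := Hom₂.ext (Category.assoc _ _ _) (Category.assoc _ _ _)

/-- An invertible 2-cell from invertible components. -/
def isoMk {k l : Hom κ μ} (e : k.fst ≅ l.fst) (e' : k.snd ≅ l.snd)
    (h : ∀ {D : C} (f : κ.val ⟶ D), (k.comp f).hom ≫ (μ.inc D).map (e'.hom ▷ f) =
      (F.ev₂ e.hom).app ((κ.inc D).obj f) ≫ (l.comp f).hom) : k ≅ l where
  hom := ⟨e.hom, e'.hom, h⟩
  inv := ⟨e.inv, e'.inv, fun f => by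
    rw [← cancel_epi (F.ev₂Iso ((κ.inc _).obj f) e).hom, ev₂Iso_hom, ← ev₂_comp_assoc, e.hom_inv_id,
      ev₂_id, Category.id_comp, ← Category.assoc, ← h, Category.assoc,
      ← CategoryTheory.Functor.map_comp, ← comp_whiskerRight, e'.hom_inv_id, id_whiskerRight,
      CategoryTheory.Functor.map_id]
    exact Category.comp_id _⟩
  hom_inv_id := Hom₂.ext e.hom_inv_id e'.hom_inv_id
  inv_hom_id := Hom₂.ext e.inv_hom_id e'.inv_hom_id

end Hom

theorem comp_eq_left {A : Type*} [Category* A] {x y : A} (p : x ⟶ y) {q : y ⟶ y} (h : q = 𝟙 y) :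
    p ≫ q = p := by
  rw [h, Category.comp_id]

section Whisker
variable {κ μ ν ξ : F.Idx}
open Hom

/-- Left whiskering. -/
noncomputable def wl (k : Hom κ μ) {l l' : Hom μ ν} (s : l ⟶ l') : k.vcomp l ⟶ k.vcomp l' :=
  Hom₂.mk (k.fst ◁ s.fst) (s.snd ▷ k.snd) fun {D} f => by
    rw [vcomp_comp_hom, vcomp_comp_hom]
    have h₁ := F.ev₂_whiskerLeft k.fst ((κ.inc D).obj f) s.fst
    have h₂ := s.comm (k.snd ≫ f)
    have h₃ := (F.ev₂ s.fst).naturality (k.comp f).hom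
    simp only [Category.assoc]
    rw [reassoc_of% h₁, ← reassoc_of% h₃, ← reassoc_of% h₂, ← CategoryTheory.Functor.map_comp,
      ← CategoryTheory.Functor.map_comp, associator_inv_naturality_left]

/-- Right whiskering. -/
noncomputable def wr {k k' : Hom κ μ} (s : k ⟶ k') (l : Hom μ ν) : k.vcomp l ⟶ k'.vcomp l :=
  Hom₂.mk (s.fst ▷ l.fst) (l.snd ◁ s.snd) fun {D} f => by
    rw [vcomp_comp_hom, vcomp_comp_hom]
    have h₁ := F.ev₂_whiskerRight l.fst ((κ.inc D).obj f) s.fst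
    have h₂ := congrArg (F.ev l.fst D).map (s.comm f)
    have h₃ := l.comp_naturality (s.snd ▷ f)
    rw [CategoryTheory.Functor.map_comp, CategoryTheory.Functor.map_comp] at h₂
    simp only [Category.assoc]
    rw [reassoc_of% h₁, ← reassoc_of% h₂, reassoc_of% h₃, ← CategoryTheory.Functor.map_comp,
      ← CategoryTheory.Functor.map_comp, associator_inv_naturality_middle]

/-- The associator. -/
noncomputable def assoc (k : Hom κ μ) (l : Hom μ ν) (m : Hom ν ξ) :
    (k.vcomp l).vcomp m ≅ k.vcomp (l.vcomp m) :=
  Hom.isoMk (α_ _ _ _) (α_ _ _ _).symm fun {D} f => by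
    rw [vcomp_comp_hom, vcomp_comp_hom, vcomp_comp_hom, vcomp_comp_hom]
    have h₁ := F.ev₂_associator (a := k.fst) (b := l.fst) m.fst ((κ.inc D).obj f)
    have h₂ := F.evComp_naturality l.fst m.fst (k.comp f).hom
    have h₃ := m.comp_naturality (α_ l.snd k.snd f).inv
    change ((F.evComp (k.fst ≫ l.fst) m.fst ((κ.inc D).obj f)).hom ≫ _ ≫
      (m.comp ((l.snd ≫ k.snd) ≫ f)).hom ≫ (ξ.inc D).map (α_ m.snd (l.snd ≫ k.snd) f).inv) ≫
        (ξ.inc D).map ((α_ m.snd l.snd k.snd).inv ▷ f) =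
      (F.ev₂ (α_ k.fst l.fst m.fst).hom).app ((κ.inc D).obj f) ≫
      (F.evComp k.fst (l.fst ≫ m.fst) ((κ.inc D).obj f)).hom ≫
      (F.ev (l.fst ≫ m.fst) D).map (k.comp f).hom ≫
          ((F.evComp l.fst m.fst ((μ.inc D).obj (k.snd ≫ f))).hom ≫ _) ≫
            (ξ.inc D).map (α_ (m.snd ≫ l.snd) k.snd f).inv
    simp only [Category.assoc, CategoryTheory.Functor.map_comp]
    rw [reassoc_of% h₂, reassoc_of% h₁, reassoc_of% h₃, ← CategoryTheory.Functor.map_comp,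
      ← CategoryTheory.Functor.map_comp, ← CategoryTheory.Functor.map_comp, pentagon_inv]

/-- The left unitor. -/
noncomputable def lu (k : Hom κ μ) : (Hom.id κ).vcomp k ≅ k :=
  Hom.isoMk (λ_ _) (ρ_ _) fun {D} f => by
    rw [vcomp_comp_hom, id_comp_hom]
    have h₁ := F.ev₂_leftUnitor (a := k.fst) ((κ.inc D).obj f)
    have h₃ := k.comp_naturality (λ_ f).inv
    change ((F.evComp (𝟙 κ.fst) k.fst ((κ.inc D).obj f)).hom ≫ _ ≫
      (k.comp (𝟙 _ ≫ f)).hom ≫ (μ.inc D).map (α_ k.snd (𝟙 _) f).inv) ≫ _ = _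
    simp only [Category.assoc, CategoryTheory.Functor.map_comp]
    have h : k.snd ◁ (λ_ f).inv ≫ (α_ k.snd (𝟙 _) f).inv ≫ (ρ_ k.snd).hom ▷ f = 𝟙 _ := by simp
    rw [reassoc_of% h₃, h₁]
    refine Eq.trans ?_ (Category.assoc _ _ _).symm
    refine congrArg (_ ≫ _ ≫ ·) (comp_eq_left _ ?_)
    rw [← CategoryTheory.Functor.map_comp, ← CategoryTheory.Functor.map_comp, h,
      CategoryTheory.Functor.map_id]

/-- The right unitor. -/
noncomputable def ru (k : Hom κ μ) : k.vcomp (Hom.id μ) ≅ k :=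
  Hom.isoMk (ρ_ _) (λ_ _) fun {D} f => by
    rw [vcomp_comp_hom, id_comp_hom]
    have h₁ := F.ev₂_rightUnitor (a := k.fst) ((κ.inc D).obj f)
    have h₂ := F.evId_naturality (k.comp f).hom
    change ((F.evComp k.fst (𝟙 μ.fst) ((κ.inc D).obj f)).hom ≫
        (F.ev (𝟙 μ.fst) D).map (k.comp f).hom ≫
          ((F.evId ((μ.inc D).obj (k.snd ≫ f))).hom ≫ (μ.inc D).map (λ_ (k.snd ≫ f)).inv) ≫
            (μ.inc D).map (α_ (𝟙 _) k.snd f).inv) ≫ _ = _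
    simp only [Category.assoc]
    have h : (λ_ (k.snd ≫ f)).inv ≫ (α_ (𝟙 _) k.snd f).inv ≫ (λ_ k.snd).hom ▷ f = 𝟙 _ := by simp
    rw [reassoc_of% h₂, h₁]
    refine Eq.trans ?_ (Category.assoc _ _ _).symm
    refine congrArg (_ ≫ _ ≫ ·) (comp_eq_left _ ?_)
    rw [← CategoryTheory.Functor.map_comp, ← CategoryTheory.Functor.map_comp, h,
      CategoryTheory.Functor.map_id]

end Whisker

/-- The axioms hold on each of the two components separately, the compatibility being a property.
The second component lives in `C` with 1-cells reversed, so there each law is the mirror image of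
the one in `J`: left and right whiskering are exchanged, and associators are inverted. -/
noncomputable instance : Bicategory.{w, w} F.Idx where
  Hom κ μ := Hom κ μ
  id κ := Hom.id κ
  comp k l := k.vcomp l
  whiskerLeft k _ _ s := wl k s
  whiskerRight s l := wr s l
  associator k l m := assoc k l m
  leftUnitor k := lu k
  rightUnitor k := ru k
  whiskerLeft_id k l := Hom.Hom₂.ext (whiskerLeft_id _ _) (id_whiskerRight _ _)
  whiskerLeft_comp k _ _ _ s t := Hom.Hom₂.ext (whiskerLeft_comp _ _ _) (comp_whiskerRight _ _ _)
  id_whiskerLeft s := Hom.Hom₂.ext (id_whiskerLeft _) (whiskerRight_id _)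
  comp_whiskerLeft k l _ _ s := Hom.Hom₂.ext (comp_whiskerLeft _ _ _)
    (whiskerRight_comp (Hom.Hom₂.snd s) l.snd k.snd)
  id_whiskerRight _ _ := Hom.Hom₂.ext (id_whiskerRight _ _) (whiskerLeft_id _ _)
  comp_whiskerRight _ _ _ := Hom.Hom₂.ext (comp_whiskerRight _ _ _) (whiskerLeft_comp _ _ _)
  whiskerRight_id _ := Hom.Hom₂.ext (whiskerRight_id _) (id_whiskerLeft _)
  whiskerRight_comp s k l := Hom.Hom₂.ext (whiskerRight_comp _ _ _)
    (comp_whiskerLeft l.snd k.snd (Hom.Hom₂.snd s))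
  whisker_assoc k _ _ s l := Hom.Hom₂.ext (whisker_assoc _ _ _)
    (whisker_assoc_symm l.snd (Hom.Hom₂.snd s) k.snd)
  whisker_exchange _ _ := Hom.Hom₂.ext (whisker_exchange _ _) (whisker_exchange _ _).symm
  pentagon _ _ _ _ := Hom.Hom₂.ext (pentagon _ _ _ _) (pentagon_inv _ _ _ _)
  triangle _ _ := Hom.Hom₂.ext (triangle _ _) (triangle_assoc_comp_right _ _)

end Idx
end ProDiagram
end TwoPro

/-! ### Strictness of the index; 1-cells over a given `a` and inside a fibre. -/

namespace TwoPro

section Aux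
variable {A : Type u₁} [Category.{v₁} A] {B : Type u₂} [Category.{v₂} B]

theorem map_eqToHom_conj (Φ : A ⥤ B) {x x' y y' : A} (p : x = x') (t : x' ⟶ y') (q : y' = y) :
    Φ.map (eqToHom p ≫ t ≫ eqToHom q) =
      eqToHom (congrArg Φ.obj p) ≫ Φ.map t ≫ eqToHom (congrArg Φ.obj q) := by
  subst p q
  simp

theorem eqToHom_conj_trans {x x' x'' y y' y'' : A} {p : x = x'} {t : x' ⟶ y'} {q : y' = y}
    {p' : x' = x''} {q' : y'' = y'} {t' : x'' ⟶ y''} (h : t = eqToHom p' ≫ t' ≫ eqToHom q') :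
    eqToHom p ≫ t ≫ eqToHom q = eqToHom (p.trans p') ≫ t' ≫ eqToHom (q'.trans q) := by
  subst p q p' q' h
  simp

theorem NatTrans.app_eq {Φ Ψ : A ⥤ B} (τ : Φ ⟶ Ψ) {x y : A} (h : x = y) :
    τ.app x = eqToHom (congrArg Φ.obj h) ≫ τ.app y ≫ eqToHom (congrArg Ψ.obj h).symm := by
  subst h
  simp

theorem eqToHom_conj_congr {x x' y y' m m' n n' : A} {s : x ⟶ y} {t : x' ⟶ y'} {a : m ⟶ n}
    {b : m' ⟶ n'} {h₁ : m = m'} {h₂ : n' = n} (h : a = eqToHom h₁ ≫ b ≫ eqToHom h₂)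
    {p : x = m} {q : n = y} {p' : x' = m'} {q' : n' = y'}
    (e₁ : s = eqToHom p ≫ a ≫ eqToHom q) (e₂ : t = eqToHom p' ≫ b ≫ eqToHom q')
    (r₁ : x = x') (r₂ : y' = y) : s = eqToHom r₁ ≫ t ≫ eqToHom r₂ := by
  subst h₁ h₂ p q p' q'
  simp_all

theorem comp_square_five {x₀ x₁ x₂ x₃ x₄ x₅ y : A} {a : x₀ ⟶ x₁} {m : x₁ ⟶ x₂} {e : x₂ ⟶ x₃}
    {g : x₃ ⟶ x₄} {q : x₄ ⟶ x₅} {e' : x₁ ⟶ y} {k : y ⟶ x₃} (h : m ≫ e = e' ≫ k) :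
    a ≫ m ≫ (e ≫ g) ≫ q = (a ≫ e') ≫ k ≫ g ≫ q := by
  simp [reassoc_of% h]

/-- Passage from an identity between fractions to the compatibility condition for a 2-cell between
composites with `fib u` and `fib v`; `frac_eq_of_square` goes back. The isomorphisms `g`, `g'` stand
for gluings and `a`, `a'` for associators. -/
theorem comp_frac_square {Φ : A ⥤ B} {x₀ x₁ x₂ x₃ x₁' x₂' : B} {y₁ y₂ y₃ y₄ : A}
    {ρ : x₀ ⟶ x₁} {k : x₁ ⟶ x₂} {g : x₂ ≅ Φ.obj y₁} {a : y₂ ≅ y₁} {θ : y₂ ⟶ y₃} {a' : y₃ ≅ y₄}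
    {w : x₀ ⟶ x₁'} {ρ' : x₁' ⟶ x₃} {l : x₃ ⟶ x₂'} {g' : x₂' ≅ Φ.obj y₄} {b : x₁ ⟶ x₃}
    (hw : w ≫ ρ' = ρ ≫ b)
    (h : k ≫ g.hom ≫ Φ.map (a.inv ≫ θ ≫ a'.hom) ≫ g'.inv = b ≫ l) :
    (ρ ≫ k ≫ g.hom ≫ Φ.map a.inv) ≫ Φ.map θ = w ≫ ρ' ≫ l ≫ g'.hom ≫ Φ.map a'.inv := by
  rw [reassoc_of% hw, ← reassoc_of% h]
  simp [← Functor.map_comp]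

theorem frac_eq_of_square {Φ : A ⥤ B} {x₀ x₁ x₂ x₃ x₁' x₂' : B} {y₁ y₂ y₃ y₄ : A}
    {ρ : x₀ ≅ x₁} {k : x₁ ⟶ x₂} {g : x₂ ≅ Φ.obj y₁} {a : y₂ ≅ y₁} {θ : y₂ ⟶ y₃} {a' : y₃ ≅ y₄}
    {w : x₀ ⟶ x₁'} {ρ' : x₁' ⟶ x₃} {l : x₃ ⟶ x₂'} {g' : x₂' ≅ Φ.obj y₄} {b : x₁ ⟶ x₃}
    (hw : w ≫ ρ' = ρ.hom ≫ b)
    (h : (ρ.hom ≫ k ≫ g.hom ≫ Φ.map a.inv) ≫ Φ.map θ =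
      w ≫ ρ' ≫ l ≫ g'.hom ≫ Φ.map a'.inv) :
    k ≫ g.hom ≫ Φ.map (a.inv ≫ θ ≫ a'.hom) ≫ g'.inv = b ≫ l := by
  rw [reassoc_of% hw] at h
  simp only [Category.assoc, cancel_epi] at h
  simp only [Functor.map_comp, Category.assoc]
  rw [reassoc_of% h]
  simp [← Functor.map_comp_assoc]

end Aux

section ReprExt
variable {C : Type u} [Bicategory.{w, w} C] [Strict C]

theorem whiskerRight_id_conj {A B D E : C} {p : A ⟶ B} {q : B ⟶ D} {p' : A ⟶ E} {q' : E ⟶ D}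
    (θ : p ≫ q ≫ 𝟙 D ⟶ p' ≫ q' ≫ 𝟙 D) : (α_ p q (𝟙 D)).inv ≫
      (p ◁ (ρ_ q).inv ≫ θ ≫ p' ◁ (ρ_ q').hom) ▷ 𝟙 D ≫ (α_ p' q' (𝟙 D)).hom = θ := by
  simp

theorem eq_id_whiskerLeft_conj {A D : C} {f g : A ⟶ D} (β : f ⟶ g) :
    β = eqToHom (Strict.id_comp f).symm ≫ 𝟙 A ◁ β ≫ eqToHom (Strict.id_comp g) := by
  rw [id_whiskerLeft_eq]
  simp

/-- A 2-natural transformation out of a representable is determined by its value at the identity. -/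
theorem repr_trans_ext {A : C} {G : StrictPseudofunctor C Cat.{w, w}} {θ η : repr A ⟶ G}
    (h : (θ.trans.app A).toFunctor.obj (𝟙 A : A ⟶ A) =
      (η.trans.app A).toFunctor.obj (𝟙 A : A ⟶ A)) : θ = η := by
  have h₁ : ∀ {D : C} (f : A ⟶ D), (θ.trans.app D).toFunctor.obj f =
      (η.trans.app D).toFunctor.obj f := fun {D} f => by
    have e : (repr A).map f = (repr A).map f := rfl
    have e₁ := twoNat_obj θ f (𝟙 A : A ⟶ A)
    have e₂ := twoNat_obj η f (𝟙 A : A ⟶ A)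
    rw [h, ← e₂] at e₁
    have e₃ : ((repr A).map f).toFunctor.obj (𝟙 A : A ⟶ A) = f := Strict.id_comp f
    rwa [e₃] at e₁
  refine TwoNatTrans.ext' fun D => Cat.Hom.ext (CategoryTheory.Functor.ext (fun f => h₁ f) ?_)
  intro (f : A ⟶ D) (g : A ⟶ D) (β : f ⟶ g)
  have e : ∀ ζ : repr A ⟶ G, ∃ p q, (ζ.trans.app D).toFunctor.map β =
      eqToHom p ≫ (G.map₂ β).toNatTrans.app ((ζ.trans.app A).toFunctor.obj (𝟙 A : A ⟶ A)) ≫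
        eqToHom q := fun ζ => by
    have p : (ζ.trans.app D).toFunctor.obj f = (G.map f).toFunctor.obj
        ((ζ.trans.app A).toFunctor.obj (𝟙 A : A ⟶ A)) :=
      (congrArg (ζ.trans.app D).toFunctor.obj (Strict.id_comp f).symm).trans
        (twoNat_obj ζ f (𝟙 A : A ⟶ A))
    have q : (G.map g).toFunctor.obj ((ζ.trans.app A).toFunctor.obj (𝟙 A : A ⟶ A)) =
        (ζ.trans.app D).toFunctor.obj g :=
      (twoNat_obj ζ g (𝟙 A : A ⟶ A)).symm.trans
        (congrArg (ζ.trans.app D).toFunctor.obj (Strict.id_comp g))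
    exact ⟨p, q, (congrArg (ζ.trans.app D).toFunctor.map (eq_id_whiskerLeft_conj β)).trans
      ((map_eqToHom_conj _ _ _ _).trans (eqToHom_conj_trans (twoNat_map₂ ζ β (𝟙 A : A ⟶ A))))⟩
  obtain ⟨p, q, e₁⟩ := e θ
  obtain ⟨p', q', e₂⟩ := e η
  exact eqToHom_conj_congr (NatTrans.app_eq (G.map₂ β).toNatTrans h) e₁ e₂ _ _

end ReprExt

namespace ProDiagram
variable {J : Type w} [Bicategory.{w, w} J] {C : Type u} [Bicategory.{w, w} C] [Strict C]
  {F : ProDiagram J C}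

theorem ev₂_rightUnitor_naturality {i j : J} {a b : i ⟶ j} (α : a ⟶ b) {D : C}
    (x : Colim.Obj (F.obj i).diagram D) : (F.ev₂ (α ▷ 𝟙 j)).app x ≫ (F.ev₂ (ρ_ b).hom).app x =
      (F.ev₂ (ρ_ a).hom).app x ≫ (F.ev₂ α).app x := by
  rw [← F.ev₂_comp, ← F.ev₂_comp, rightUnitor_naturality]

namespace Idx
section Basic
variable {κ μ ν : F.Idx}

theorem comp_hom_comp (k : κ ⟶ μ) (l : μ ⟶ ν) {D : C} (f : κ.val ⟶ D) :
    (Hom.comp (k ≫ l) f).hom = (F.evComp k.fst l.fst _).hom ≫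
      (F.ev l.fst D).map (k.comp f).hom ≫ (l.comp (k.snd ≫ f)).hom ≫
        (ν.inc D).map (α_ l.snd k.snd f).inv :=
  Hom.vcomp_comp_hom k l f

/-- A 2-cell of the index 2-category, compatibility being tested on the identity. -/
def cellMk {k l : κ ⟶ μ} (α : k.fst ⟶ l.fst) (θ : k.snd ⟶ l.snd)
    (h : (k.comp (𝟙 κ.val)).hom ≫ (μ.inc _).map (θ ▷ 𝟙 κ.val) =
      (F.ev₂ α).app ((κ.inc _).obj (𝟙 κ.val)) ≫ (l.comp (𝟙 κ.val)).hom) : k ⟶ l :=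
  Hom.Hom₂.mk α θ fun {D} f => by
    have e : k.iso.hom ≫ reprMap₂ θ ▷ μ.proj = κ.proj ◁ F.map₂ α ≫ l.iso.hom := repr_hom_ext h
    exact congrArg (fun ρ => comp₂ ρ D f) e

theorem cell_ext {k l : κ ⟶ μ} {s t : k ⟶ l} (h₁ : Hom.Hom₂.fst s = Hom.Hom₂.fst t)
    (h₂ : Hom.Hom₂.snd s = Hom.Hom₂.snd t) : s = t :=
  Hom.Hom₂.ext h₁ h₂

theorem eqToHom_fst {k l : κ ⟶ μ} (h : k = l) :
    Hom.Hom₂.fst (eqToHom h) = eqToHom (congrArg Hom.fst h) := by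
  subst h; rfl

theorem eqToHom_snd {k l : κ ⟶ μ} (h : k = l) :
    Hom.Hom₂.snd (eqToHom h) = eqToHom (congrArg Hom.snd h) := by
  subst h; rfl

/-- Compatibility of `s`, whose components are `eqToHom`s, is exactly what `Hom.ext'` requires.
Applied to unitors and associators, this gives the strictness laws. -/
theorem eq_of_hom {k l : κ ⟶ μ} (h₁ : k.fst = l.fst) (h₂ : k.snd = l.snd) (s : k ⟶ l)
    (e₁ : Hom.Hom₂.fst s = eqToHom h₁) (e₂ : Hom.Hom₂.snd s = eqToHom h₂) : k = l :=
  Hom.ext' h₁ h₂ fun D f => by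
    rw [← e₁, ← e₂]
    exact Hom.Hom₂.comm s f

theorem iso_eq_eqToIso {k l : κ ⟶ μ} (e : k ≅ l) (h : k = l)
    (e₁ : Hom.Hom₂.fst e.hom = eqToHom (congrArg Hom.fst h))
    (e₂ : Hom.Hom₂.snd e.hom = eqToHom (congrArg Hom.snd h)) : e = eqToIso h :=
  Iso.ext (cell_ext (e₁.trans (eqToHom_fst h).symm) (e₂.trans (eqToHom_snd h).symm))

end Basic

section
variable [Strict J] {κ μ : F.Idx}

noncomputable instance : Strict F.Idx where
  id_comp k := eq_of_hom (Strict.id_comp k.fst) (Strict.comp_id k.snd) (λ_ k).hom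
    (congrArg Iso.hom (Strict.leftUnitor_eqToIso k.fst))
    (congrArg Iso.hom (Strict.rightUnitor_eqToIso k.snd))
  comp_id k := eq_of_hom (Strict.comp_id k.fst) (Strict.id_comp k.snd) (ρ_ k).hom
    (congrArg Iso.hom (Strict.rightUnitor_eqToIso k.fst))
    (congrArg Iso.hom (Strict.leftUnitor_eqToIso k.snd))
  assoc k l m := eq_of_hom (Strict.assoc k.fst l.fst m.fst) (Strict.assoc m.snd l.snd k.snd).symm
    (α_ k l m).hom (congrArg Iso.hom (Strict.associator_eqToIso k.fst l.fst m.fst))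
    (congrArg Iso.inv (Strict.associator_eqToIso m.snd l.snd k.snd))
  leftUnitor_eqToIso k := iso_eq_eqToIso _ _
    (congrArg Iso.hom (Strict.leftUnitor_eqToIso k.fst))
    (congrArg Iso.hom (Strict.rightUnitor_eqToIso k.snd))
  rightUnitor_eqToIso k := iso_eq_eqToIso _ _
    (congrArg Iso.hom (Strict.rightUnitor_eqToIso k.fst))
    (congrArg Iso.hom (Strict.leftUnitor_eqToIso k.snd))
  associator_eqToIso k l m := iso_eq_eqToIso _ _
    (congrArg Iso.hom (Strict.associator_eqToIso k.fst l.fst m.fst))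
    (congrArg Iso.inv (Strict.associator_eqToIso m.snd l.snd k.snd))

end

section Special
variable {κ μ ν : F.Idx}

/-- A codomain for 1-cells out of `κ` over `a`. -/
noncomputable abbrev push (κ : F.Idx) {j : J} (a : κ.fst ⟶ j) : F.Idx :=
  ⟨j, ((F.ev a κ.val).obj ((κ.inc κ.val).obj (𝟙 κ.val))).idx⟩

/-- A 1-cell over `a`. -/
noncomputable abbrev pushHom (κ : F.Idx) {j : J} (a : κ.fst ⟶ j) : κ ⟶ κ.push a :=
  Hom.mkOfIso (κ := κ) (μ := κ.push a) a
    -- The image of the identity of `X_κ` under `F a` is an object of the presented category, hence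
    -- a pair of an index and a 1-cell. By Yoneda this pair represents the restriction of `F a`,
    -- even up to equality.
    ((F.ev a κ.val).obj ((κ.inc κ.val).obj (𝟙 κ.val))).hom (eqToIso (repr_trans_ext (by
      exact congrArg (Colim.Obj.mk _) (Strict.comp_id _).symm)))

/-- The 1-cell `(𝟙 j, X_u)` of a 1-cell `u` of the index 2-category of `F.obj j`. -/
noncomputable abbrev fib {j : J} {i i' : (F.obj j).Index} (u : i ⟶ i') :
    (⟨j, i⟩ : F.Idx) ⟶ ⟨j, i'⟩ :=
  Hom.mkOfIso (κ := ⟨j, i⟩) (μ := ⟨j, i'⟩) (𝟙 j) ((F.obj j).diagram.map u.op)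
    (whiskerLeftIso _ (F.mapId j) ≪≫ ((F.obj j).coconeIso u).symm)

theorem fib_comp_hom {j : J} {i i' : (F.obj j).Index} (u : i ⟶ i') {D : C}
    (f : (⟨j, i⟩ : F.Idx).val ⟶ D) : (Hom.comp (fib u) f).hom =
      (F.evId _).hom ≫ (Colim.glue (F.obj j).diagram u f).hom :=
  congrArg Iso.hom (Hom.comp_mkOfIso (κ := ⟨j, i⟩) (μ := ⟨j, i'⟩) _ _ _ f)

theorem comp_fib_comp_hom (k : κ ⟶ μ) {i : (F.obj μ.fst).Index} (u : μ.snd ⟶ i) {D : C}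
    (f : κ.val ⟶ D) : (Hom.comp (k ≫ fib u) f).hom =
      (F.ev₂ (ρ_ k.fst).hom).app _ ≫ (k.comp f).hom ≫
        (Colim.glue (F.obj μ.fst).diagram u (k.snd ≫ f)).hom ≫
          (Colim.incl (F.obj μ.fst).diagram i D).map
            (α_ ((F.obj μ.fst).diagram.map u.op) k.snd f).inv := by
  refine (comp_hom_comp k (fib u) f).trans ?_
  rw [fib_comp_hom, F.ev₂_rightUnitor]
  have h := F.evId_naturality (k.comp f).hom
  exact comp_square_five h

section
open Colim
variable {j : J} {i i' n : (F.obj j).Index} {k : κ ⟶ ⟨j, i⟩} {l : κ ⟶ ⟨j, i'⟩} {u : i ⟶ n}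
  {v : i' ⟶ n}

/-- The 2-cell given by a fraction. -/
noncomputable def fibCell (α : k.fst ⟶ l.fst)
    (θ : (F.obj j).diagram.map u.op ≫ k.snd ⟶ (F.obj j).diagram.map v.op ≫ l.snd)
    (h : (k.comp (𝟙 κ.val)).hom ≫ frac u v
        ((α_ _ _ _).inv ≫ θ ▷ 𝟙 κ.val ≫ (α_ _ _ _).hom) =
      (F.ev₂ α).app ((κ.inc _).obj (𝟙 κ.val)) ≫ (l.comp (𝟙 κ.val)).hom) :
    k ≫ fib u ⟶ l ≫ fib v :=
  cellMk (α ▷ 𝟙 j) θ (by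
    rw [comp_fib_comp_hom, comp_fib_comp_hom]
    refine comp_frac_square (a' := α_ _ _ _) ?_ h
    exact F.ev₂_rightUnitor_naturality α _)

/-- The invertible 2-cell given by an invertible fraction. -/
noncomputable def fibIso (α : k.fst ≅ l.fst)
    (θ : (F.obj j).diagram.map u.op ≫ k.snd ≅ (F.obj j).diagram.map v.op ≫ l.snd)
    (h : (k.comp (𝟙 κ.val)).hom ≫ frac u v
        ((α_ _ _ _).inv ≫ θ.hom ▷ 𝟙 κ.val ≫ (α_ _ _ _).hom) =
      (F.ev₂ α.hom).app ((κ.inc _).obj (𝟙 κ.val)) ≫ (l.comp (𝟙 κ.val)).hom) :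
    k ≫ fib u ≅ l ≫ fib v :=
  Hom.isoMk (whiskerRightIso α (𝟙 j)) θ
    (fun f => Hom.Hom₂.comm (fibCell α.hom θ.hom h) f)

/-- The condition is imposed on the identity only; by Yoneda the 2-cell it defines is compatible at
every `f`, and the fraction identity at `f` is extracted from that. -/
theorem fibCell_comm (α : k.fst ⟶ l.fst)
    (θ : (F.obj j).diagram.map u.op ≫ k.snd ⟶ (F.obj j).diagram.map v.op ≫ l.snd)
    (h : (k.comp (𝟙 κ.val)).hom ≫ frac u v
        ((α_ _ _ _).inv ≫ θ ▷ 𝟙 κ.val ≫ (α_ _ _ _).hom) =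
      (F.ev₂ α).app ((κ.inc _).obj (𝟙 κ.val)) ≫ (l.comp (𝟙 κ.val)).hom) {D : C} (f : κ.val ⟶ D) :
    (k.comp f).hom ≫ frac u v ((α_ _ _ _).inv ≫ θ ▷ f ≫ (α_ _ _ _).hom) =
      (F.ev₂ α).app ((κ.inc _).obj f) ≫ (l.comp f).hom := by
  have e := Hom.Hom₂.comm (fibCell α θ h) f
  rw [comp_fib_comp_hom, comp_fib_comp_hom] at e
  exact frac_eq_of_square (ρ := F.ev₂Iso _ (ρ_ k.fst)) (F.ev₂_rightUnitor_naturality α _) e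

/-- The conjugate of `F α` by the representing isomorphisms of `k` and `l` is an arrow of `L X_j` at
`X_κ`, hence a fraction. Its legs and cell are the data sought, so `α` lifts to a 2-cell after
moving within the fibre over `j`. -/
theorem exists_fibCell (k : κ ⟶ ⟨j, i⟩) (l : κ ⟶ ⟨j, i'⟩) (α : k.fst ⟶ l.fst) :
    ∃ (n : (F.obj j).Index) (u : i ⟶ n) (v : i' ⟶ n)
      (θ : (F.obj j).diagram.map u.op ≫ k.snd ⟶ (F.obj j).diagram.map v.op ≫ l.snd),
      (k.comp (𝟙 κ.val)).hom ≫ frac u v ((α_ _ _ _).inv ≫ θ ▷ 𝟙 κ.val ≫ (α_ _ _ _).hom) =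
        (F.ev₂ α).app ((κ.inc _).obj (𝟙 κ.val)) ≫ (l.comp (𝟙 κ.val)).hom := by
  obtain ⟨n, u, v, β, hβ⟩ := exists_frac' (F.obj j).isTwoFiltered ((k.comp (𝟙 κ.val)).inv ≫
    (F.ev₂ α).app _ ≫ (l.comp (𝟙 κ.val)).hom)
  -- The fraction joins `k.snd ≫ 𝟙` and `l.snd ≫ 𝟙`; the right unitors remove the identities.
  refine ⟨n, u, v, _ ◁ (ρ_ k.snd).inv ≫ β ≫ _ ◁ (ρ_ l.snd).hom, ?_⟩
  refine (congrArg (fun t => (k.comp (𝟙 κ.val)).hom ≫ frac u v t)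
    (whiskerRight_id_conj β)).trans ?_
  rw [← hβ]
  exact Iso.hom_inv_id_assoc _ _

end

end Special
end Idx

/-! ### The index 2-category is 2-filtered. -/

section Filtered
open Idx Colim

/-- The isomorphism `α` gives an invertible arrow of a fibre category, hence an invertible cell
between translates at a late stage. This cell is the second component of the required isomorphism.
-/
theorem exists_iso_of_fst_iso {κ μ : F.Idx} (k l : κ ⟶ μ) (α : k.fst ≅ l.fst) :
    ∃ (ν : F.Idx) (m : μ ⟶ ν), Nonempty (k ≫ m ≅ l ≫ m) := by
  have hI := (F.obj μ.fst).isTwoFiltered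
  obtain ⟨n, u, v, β, hβ⟩ := exists_frac' hI ((k.comp (𝟙 κ.val)).inv ≫
    (F.ev₂Iso _ α).hom ≫ (l.comp (𝟙 κ.val)).hom)
  have h₁ : IsIso (frac u v β) := by
    rw [← hβ]; infer_instance
  obtain ⟨n', w, hw⟩ := exists_isIso_transl hI h₁
  -- The two legs may still differ, while `k` and `l` must be followed by the same 1-cell; F1
  -- identifies the legs up to isomorphism, and `γ` is absorbed into `θ` without changing the
  -- fraction.
  obtain ⟨n'', p, ⟨γ⟩⟩ := hI.f1 (u ≫ w) (v ≫ w)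
  let u' := (u ≫ w) ≫ p
  let θ := translIso p (asIso (transl w β)) ≪≫ (actIso γ _).symm
  have hθ : frac u' u' θ.hom = frac u v β := by
    refine (frac_act_right (g := l.snd ≫ 𝟙 κ.val) γ.inv _).trans ?_
    exact (frac_transl p (transl w β)).trans (frac_transl w β)
  refine ⟨⟨μ.fst, n''⟩, fib u', ⟨fibIso (j := μ.fst) α
    (whiskerLeftIso _ (ρ_ k.snd).symm ≪≫ θ ≪≫ whiskerLeftIso _ (ρ_ l.snd)) ?_⟩⟩
  refine (congrArg (fun t => (k.comp (𝟙 κ.val)).hom ≫ frac u' u' t)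
    (whiskerRight_id_conj θ.hom)).trans ?_
  rw [hθ, ← hβ]
  exact Iso.hom_inv_id_assoc _ _

/-- As the representing isomorphism of `k` is invertible, compatibility forces the second components
to have the same image in the fibre category. They then agree after a translation, which is
composition with a 1-cell of the fibre. -/
theorem exists_whiskerRight_eq_of_fst_eq {κ μ : F.Idx} {k l : κ ⟶ μ} (s t : k ⟶ l)
    (h : Hom.Hom₂.fst s = Hom.Hom₂.fst t) : ∃ (ν : F.Idx) (m : μ ⟶ ν), s ▷ m = t ▷ m := by
  have hI := (F.obj μ.fst).isTwoFiltered
  have h₁ : (μ.inc κ.val).map (Hom.Hom₂.snd s ▷ 𝟙 κ.val) =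
      (μ.inc κ.val).map (Hom.Hom₂.snd t ▷ 𝟙 κ.val) := by
    rw [← cancel_epi (k.comp (𝟙 κ.val)).hom, Hom.Hom₂.comm, Hom.Hom₂.comm, h]
  rw [← frac_whiskerLeft (𝟙 μ.snd), ← frac_whiskerLeft (𝟙 μ.snd)] at h₁
  obtain ⟨n, w, hw⟩ := exists_transl_eq hI h₁
  rw [transl_whiskerLeft, transl_whiskerLeft] at hw
  have h₂ : (F.obj μ.fst).diagram.map (𝟙 μ.snd ≫ w).op ◁ Hom.Hom₂.snd s =
      (F.obj μ.fst).diagram.map (𝟙 μ.snd ≫ w).op ◁ Hom.Hom₂.snd t := by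
    simpa using hw
  exact ⟨⟨μ.fst, n⟩, fib (𝟙 μ.snd ≫ w), cell_ext (congrArg (· ▷ 𝟙 μ.fst) h) h₂⟩

/-- The index 2-category of a 2-filtered diagram of 2-pro-objects is 2-filtered. -/
theorem isTwoFiltered_idx (hJ : IsTwoFiltered J) : IsTwoFiltered F.Idx where
  f0 κ μ := by
    obtain ⟨j, ⟨a⟩, ⟨b⟩⟩ := hJ.f0 κ.fst μ.fst
    -- Both objects are first pushed into the fibre over a common `j`, where F0 for the index of
    -- `X_j` applies.
    obtain ⟨i, ⟨u⟩, ⟨v⟩⟩ := (F.obj j).isTwoFiltered.f0 (κ.push a).snd (μ.push b).snd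
    exact ⟨⟨j, i⟩, ⟨κ.pushHom a ≫ fib (F := F) (j := j) u⟩,
      ⟨μ.pushHom b ≫ fib (F := F) (j := j) v⟩⟩
  f1 {κ μ} k l := by
    obtain ⟨j, a, ⟨α⟩⟩ := hJ.f1 k.fst l.fst
    -- Composing with a 1-cell over `a` reduces to first components isomorphic by `α`.
    obtain ⟨ν, m, ⟨e⟩⟩ := exists_iso_of_fst_iso (k ≫ μ.pushHom a) (l ≫ μ.pushHom a) α
    exact ⟨ν, μ.pushHom a ≫ m, ⟨(α_ _ _ _).symm ≪≫ e ≪≫ α_ _ _ _⟩⟩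
  f2 {κ μ k l} s t := by
    obtain ⟨j, a, h⟩ := hJ.f2 (Hom.Hom₂.fst s) (Hom.Hom₂.fst t)
    obtain ⟨ν, m, e⟩ := exists_whiskerRight_eq_of_fst_eq (s ▷ μ.pushHom a) (t ▷ μ.pushHom a) h
    refine ⟨ν, μ.pushHom a ≫ m, ?_⟩
    rw [whiskerRight_comp, whiskerRight_comp, e]

end Filtered

/-! ### The total 2-pro-object. -/

section Total
variable [Strict J]

variable (F) in
/-- The 2-functor `κ ↦ X_κ`. -/
noncomputable def totalDiagram : StrictPseudofunctor F.Idxᵒᵖ C := StrictPseudofunctor.mk''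
  { obj := fun κ => κ.unop.val
    map := fun k => k.unop.snd
    map₂ := fun s => Idx.Hom.Hom₂.snd s.unop2
    map₂_id := fun _ => rfl
    map₂_comp := fun _ _ => rfl
    map_id := fun _ => rfl
    map_comp := fun _ _ => rfl
    map₂_whisker_left := fun f g h η => by
      rw [eqToHom_refl, eqToHom_refl, Category.id_comp, Category.comp_id]
      rfl
    map₂_whisker_right := fun η h => by
      rw [eqToHom_refl, eqToHom_refl, Category.id_comp, Category.comp_id]
      rfl }

variable (F) in
/-- The 2-pro-object of all `X_κ`. -/
noncomputable def total (hJ : IsTwoFiltered J) : TwoProObj C where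
  Index := F.Idx
  isTwoFiltered := F.isTwoFiltered_idx hJ
  diagram := F.totalDiagram

end Total
end ProDiagram
end TwoPro

/-! ### Legs and structure isomorphisms of the cocone to the total colimit. -/

namespace TwoPro

section Aux
variable {A : Type u₁} [Category.{v₁} A] {B : Type u₂} [Category.{v₂} B]

theorem comp_map_eq_map_inv (Φ : A ⥤ B) {x y z : A} {g : Φ.obj x ⟶ Φ.obj y} {m : y ⟶ z}
    (l : z ≅ x) (h : g ≫ Φ.map (m ≫ l.hom) = 𝟙 _) : g ≫ Φ.map m = Φ.map l.inv := by
  rw [← cancel_mono (Φ.map l.hom), Category.assoc, ← Φ.map_comp, h, ← Φ.map_comp, Iso.inv_hom_id,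
    Φ.map_id]

theorem glue_comp_aux (Φ : A ⥤ B) {x y z : A} (a : y ≅ z) {m : x ⟶ y} {b₀ b₁ b₂ b₃ : B}
    {e₁ : b₁ ⟶ b₀} {e₂ : b₀ ⟶ b₁} (e : e₁ ≫ e₂ = 𝟙 _) {ε' : b₁ ⟶ b₂} {g : b₂ ⟶ Φ.obj x}
    {g₁ : b₂ ⟶ b₃} {g₂ : b₃ ⟶ Φ.obj z} (h : g ≫ Φ.map (m ≫ a.hom) = g₁ ≫ g₂) :
    (ε' ≫ g) ≫ Φ.map m = e₁ ≫ e₂ ≫ (ε' ≫ g₁) ≫ g₂ ≫ Φ.map a.inv := by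
  rw [reassoc_of% e, Category.assoc, Category.assoc, ← reassoc_of% h, ← Φ.map_comp]
  simp

theorem comp_inv_eq_of_comp_eq {x y z : A} {e : x ≅ y} {e' : x ≅ z} {p : y ⟶ z}
    (h : e.hom ≫ p = e'.hom) : p ≫ e'.inv = e.inv ≫ 𝟙 x := by
  rw [Category.comp_id, Iso.comp_inv_eq, Iso.eq_inv_comp, h]

theorem inv_eq_map_of_comp_eq (Φ : A ⥤ B) {x y z : A} {e : Φ.obj x ≅ Φ.obj y} {m : y ⟶ z}
    (l : z ≅ x) (h : e.hom ≫ Φ.map m = Φ.map l.inv) :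
    e.inv ≫ 𝟙 _ = Φ.map (m ≫ l.hom) ≫ 𝟙 _ ≫ 𝟙 _ := by
  rw [← cancel_epi e.hom, Φ.map_comp, Category.assoc, reassoc_of% h]
  simp [← Φ.map_comp]

theorem inv_eq_map_comp_of_comp_eq (Φ : A ⥤ B) {x y z : A} (a : y ≅ z) {m : x ⟶ y} {b₀ b₁ : B}
    {e : b₀ ≅ Φ.obj x} {e₁ : b₀ ≅ b₁} {e₂ : b₁ ≅ Φ.obj z}
    (h : e.hom ≫ Φ.map m = e₁.hom ≫ e₂.hom ≫ Φ.map a.inv) :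
    e.inv ≫ 𝟙 _ = Φ.map (m ≫ a.hom) ≫ 𝟙 _ ≫ e₂.inv ≫ 𝟙 _ ≫ e₁.inv ≫ 𝟙 _ := by
  rw [← cancel_epi e.hom, Φ.map_comp, Category.assoc, reassoc_of% h]
  simp [← Φ.map_comp_assoc]

theorem edge_cell_aux {A' : Type*} [Category* A'] (Φ : A ⥤ B)
    (Ψ : A' ⥤ B) {x₁ x₂ y₁ y₂ : A} {c : x₁ ≅ y₁} {d : x₂ ≅ y₂} {e : x₁ ⟶ x₂} {p : y₁ ⟶ y₂}
    {b : B} {z z₁ z₂ z' : A'} {g : b ⟶ Φ.obj y₁} {g' : b ⟶ Φ.obj y₂} {h₁ : Φ.obj y₁ ≅ Ψ.obj z}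
    {h₂ : Φ.obj y₂ ≅ Ψ.obj z'} {a : z₁ ≅ z} {a' : z₂ ≅ z'} {θ : z₁ ⟶ z₂}
    (e₁ : c.hom ≫ p = e ≫ d.hom)
    (e₂ : (g ≫ h₁.hom ≫ Ψ.map a.inv) ≫ Ψ.map θ = g' ≫ h₂.hom ≫ Ψ.map a'.inv)
    (e₃ : Φ.map p = h₁.hom ≫ Ψ.map (a.inv ≫ θ ≫ a'.hom) ≫ h₂.inv) :
    (g ≫ Φ.map c.inv) ≫ Φ.map e = g' ≫ Φ.map d.inv := by
  have e₄ : e = c.hom ≫ p ≫ d.inv := by rw [reassoc_of% e₁, Iso.hom_inv_id, Category.comp_id]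
  simp only [Category.assoc] at e₂
  simp only [e₄, Φ.map_comp, e₃, Ψ.map_comp, Category.assoc]
  rw [← Φ.map_comp_assoc, Iso.inv_hom_id, Φ.map_id, Category.id_comp, reassoc_of% e₂,
    ← Ψ.map_comp_assoc, Iso.inv_hom_id, Ψ.map_id, Category.id_comp, Iso.hom_inv_id_assoc]

theorem comp_eqToHom_comp {x y z : A} (p : x ⟶ y) (q : y ⟶ z) (h : y = y) :
    p ≫ eqToHom h ≫ q = p ≫ q := by
  rw [eqToHom_refl, Category.id_comp]

theorem edge_comp_aux (Φ : A ⥤ B) {x₀ x₁ x₂ x₃ x₄ : A} {c : x₀ ≅ x₄} {e : x₀ ⟶ x₁} {m : x₁ ⟶ x₂}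
    {l : x₂ ≅ x₃} {n : x₄ ≅ x₃} (hc : c.hom = e ≫ m ≫ l.hom ≫ n.inv) {b b' : B}
    {g : b ⟶ b'} {g' : b' ⟶ Φ.obj x₃} :
    ((g ≫ g' ≫ Φ.map n.inv) ≫ Φ.map c.inv) ≫ Φ.map e ≫ Φ.map m = g ≫ g' ≫ Φ.map l.inv := by
  have h : n.inv ≫ c.inv ≫ e ≫ m = l.inv := by simp [show e ≫ m = c.hom ≫ n.hom ≫ l.inv by simp [hc]]
  simp only [Category.assoc, ← Φ.map_comp, h]

theorem edges_glue_aux {A' : Type*} [Category* A'] (Ψ : A' ⥤ A) (Φ : A ⥤ B) {x₁ x₂ x₃ : A'}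
    {y : A} {c : x₁ ⟶ x₃} {d : x₁ ⟶ x₂} {g' : x₂ ⟶ x₃} {e : y ⟶ Ψ.obj x₁} {r : y ⟶ Ψ.obj x₂}
    {b b' : B} {E : b ⟶ Φ.obj y} {g : b ⟶ b'} {E' : b' ⟶ Φ.obj (Ψ.obj x₃)}
    {E'' : b ⟶ Φ.obj (Ψ.obj x₂)} (h₁ : E ≫ Φ.map e ≫ Φ.map (Ψ.map c) = g ≫ E')
    (hc : c = d ≫ g') (h₂ : r = e ≫ Ψ.map d) (h₃ : E ≫ Φ.map r = E'') :
    g ≫ E' = E'' ≫ Φ.map (Ψ.map g') := by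
  rw [← h₁, ← h₃, hc, h₂]
  simp

theorem edges_comp_aux {A' : Type*} [Category* A'] (Ψ : A' ⥤ A) (Φ' : A' ⥤ B) (Φ : A ⥤ B)
    {x x' : A'} {c : x ≅ x'} {y : A} {e : y ⟶ Ψ.obj x} {b : B} {E₀ E : b ⟶ Φ.obj y}
    {g : b ⟶ Φ'.obj x'} {E₁ : Φ'.obj x ⟶ Φ.obj (Ψ.obj x)} {E₂ : Φ'.obj x' ⟶ Φ.obj (Ψ.obj x')}
    (h₁ : E ≫ Φ.map e ≫ Φ.map (Ψ.map c.hom) = g ≫ E₂) (h₂ : E₀ = E)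
    (h₃ : Φ'.map c.hom ≫ E₂ = E₁ ≫ Φ.map (Ψ.map c.hom)) :
    E₀ ≫ Φ.map e = (g ≫ Φ'.map c.inv) ≫ E₁ := by
  rw [← cancel_mono ((Φ.mapIso (Ψ.mapIso c)).hom)]
  simp only [Functor.mapIso_hom, Category.assoc, h₂, h₁, ← h₃]
  rw [← Functor.map_comp_assoc, Iso.inv_hom_id, CategoryTheory.Functor.map_id, Category.id_comp]

theorem edge_id_aux (Φ : A ⥤ B) {x₀ x₁ x₂ : A} {c : x₀ ≅ x₂} {e : x₀ ⟶ x₁} {n : x₂ ≅ x₁}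
    (hc : c.hom = e ≫ n.inv) : (Φ.map n.inv ≫ Φ.map c.inv) ≫ Φ.map e = 𝟙 _ := by
  have h : (n.inv ≫ c.inv) ≫ e = 𝟙 _ := by simp [show e = c.hom ≫ n.hom by simp [hc]]
  rw [← Φ.map_comp, ← Φ.map_comp, h, Φ.map_id]

end Aux
theorem comp₂_trans_eqToIso_trans {C : Type u} [Bicategory.{w, w} C]
    {F G : StrictPseudofunctor C Cat.{w, w}} {θ₁ θ₂ θ₃ θ₄ : F ⟶ G} (e₁ : θ₁ ≅ θ₂) (p : θ₂ = θ₃)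
    (e₃ : θ₃ ≅ θ₄) {e : θ₁ ≅ θ₄} (h : e = e₁ ≪≫ eqToIso p ≪≫ e₃) (D : C) (x : F.obj D) :
    comp₂ e.hom D x = comp₂ e₁.hom D x ≫ eqToHom (by rw [p]) ≫ comp₂ e₃.hom D x := by
  subst h p
  exact congrArg (_ ≫ ·) (by rfl)

namespace ProDiagram
variable {J : Type w} [Bicategory.{w, w} J] [Strict J] {C : Type u} [Bicategory.{w, w} C]
  [Strict C] {F : ProDiagram J C}
open Idx

namespace Idx
variable {κ μ ν : F.Idx} {D : C}

/-- The canonical functor from `C(X_κ, D)` to the colimit over all `κ`. -/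
noncomputable abbrev tinc (κ : F.Idx) (D : C) :
    (κ.val ⟶ D) ⥤ Colim.Obj F.totalDiagram D :=
  Colim.incl F.totalDiagram κ D

/-- The canonical isomorphisms of the colimit over all `κ`. -/
noncomputable def tglue (k : κ ⟶ μ) (f : κ.val ⟶ D) :
    (κ.tinc D).obj f ≅ (μ.tinc D).obj (k.snd ≫ f) :=
  Colim.glue F.totalDiagram k f

/-- Each 2-cell of the index is a relation between gluings. Coherence of the cocone is obtained by
exhibiting suitable 2-cells: for the legs these are `fibMap`, `fibId` and `fibComp`, and no strict
functoriality of `fib` is needed. -/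
theorem tglue_cell {k l : κ ⟶ μ} (s : k ⟶ l) (f : κ.val ⟶ D) :
    (tglue k f).hom ≫ (μ.tinc D).map (Hom.Hom₂.snd s ▷ f) = (tglue l f).hom :=
  Colim.glue_two_cell' F.totalDiagram s f

theorem tglue_comp (k : κ ⟶ μ) (l : μ ⟶ ν) (f : κ.val ⟶ D) : (tglue (k ≫ l) f).hom =
    (tglue k f).hom ≫ (tglue l (k.snd ≫ f)).hom ≫ (ν.tinc D).map (α_ l.snd k.snd f).inv := by
  have h := Colim.glue_comp' F.totalDiagram k l f
  have e : ((F.totalDiagram.mapComp l.op k.op).hom ▷ f ≫ (α_ _ _ f).hom) =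
      (α_ l.snd k.snd f).hom := by
    rw [F.totalDiagram.mapComp_eq_eqToIso]
    exact (congrArg (· ≫ (α_ l.snd k.snd f).hom) (id_whiskerRight _ f)).trans (Category.id_comp _)
  have h := (congrArg (fun t => (Colim.glue F.totalDiagram (k ≫ l) f).hom ≫
    (Colim.incl F.totalDiagram ν D).map t) e.symm).trans h
  exact (Iso.eq_comp_inv ((ν.tinc D).mapIso (α_ l.snd k.snd f))).2 h |>.trans
    (Category.assoc _ _ _)

theorem tglue_id (f : κ.val ⟶ D) : (tglue (𝟙 κ) f).hom = (κ.tinc D).map (λ_ f).inv := by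
  have h := Colim.glue_id' F.totalDiagram κ f
  have e : ((F.totalDiagram.mapId (op κ)).hom ▷ f ≫ (λ_ f).hom) = (λ_ f).hom := by
    rw [F.totalDiagram.mapId_eq_eqToIso]
    exact (congrArg (· ≫ (λ_ f).hom) (id_whiskerRight _ f)).trans (Category.id_comp _)
  have h := (congrArg (fun t => (Colim.glue F.totalDiagram (𝟙 κ) f).hom ≫
    (Colim.incl F.totalDiagram κ D).map t) e.symm).trans h
  exact ((Iso.eq_comp_inv ((κ.tinc D).mapIso (λ_ f))).2 h).trans (Category.id_comp _)

end Idx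

variable (F) (hJ : IsTwoFiltered J)

section Leg
variable {j : J} {i i' i'' : (F.obj j).Index}

variable {F}

/-- A 2-cell of `(F.obj j).Index` as a 2-cell of the total index 2-category. -/
noncomputable def fibMap {u v : i ⟶ i'} (η : u ⟶ v) : fib (F := F) u ⟶ fib v :=
  cellMk (𝟙 _) ((F.obj j).diagram.map₂ (Bicategory.Opposite.op2 η)) (by
    rw [fib_comp_hom, fib_comp_hom, ev₂_id, Category.id_comp]
    refine (Category.assoc _ _ _).trans (congrArg (_ ≫ ·) ?_)
    exact Colim.glue_two_cell' _ η _)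

/-- Compatibility of the inclusion of `(F.obj j).Index` with identities. -/
noncomputable def fibId (i : (F.obj j).Index) :
    fib (F := F) (𝟙 i) ⟶ 𝟙 (⟨j, i⟩ : F.Idx) :=
  cellMk (𝟙 (𝟙 j)) ((F.obj j).diagram.mapId (op i)).hom (by
    rw [fib_comp_hom]
    refine Eq.trans ?_ ((congrArg (_ ≫ ·) (Hom.id_comp_hom _)).trans
      ((congrArg (· ≫ _) (F.ev₂_id _ _)).trans (Category.id_comp _))).symm
    refine (Category.assoc _ _ _).trans (congrArg (_ ≫ ·) ?_)
    exact comp_map_eq_map_inv (Colim.incl (F.obj j).diagram i _) (λ_ _) (Colim.glue_id' _ i _))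

/-- Compatibility of the inclusion of `(F.obj j).Index` with composition. -/
noncomputable def fibComp (u : i ⟶ i') (v : i' ⟶ i'') :
    fib (F := F) (u ≫ v) ⟶ fib u ≫ fib v :=
  cellMk (λ_ (𝟙 j)).inv ((F.obj j).diagram.mapComp v.op u.op).hom (by
    rw [comp_fib_comp_hom, fib_comp_hom]
    refine Eq.trans ?_ (congrArg (_ ≫ _ ≫ · ≫ _) (fib_comp_hom u _)).symm
    have e : ∀ {D : C} (x : Colim.Obj (F.obj j).diagram D), (F.ev₂ (λ_ (𝟙 j)).inv).app x ≫
        (F.ev₂ (ρ_ (𝟙 j)).hom).app x = 𝟙 _ := fun x => by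
      rw [← F.ev₂_comp, ← unitors_equal, Iso.inv_hom_id, F.ev₂_id]
    exact glue_comp_aux (Colim.incl (F.obj j).diagram i'' _) (α_ _ _ _) (e _)
      (Colim.glue_comp' _ u v _))

variable (F)
/-- The pseudocone over `(F.obj j).Index` obtained by restriction. -/
noncomputable def legCocone (j : J) :
    (F.obj j).reprDiagram.toPseudofunctor ⟶ const (F.obj j).Index (F.total hJ).L where
  app i := (F.total hJ).coconeApp (⟨j, i⟩ : F.Idx)
  naturality u := (F.total hJ).coconeIso (fib u)
  naturality_naturality {i _ u v} η := comp₂_ext fun D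
      (f : (F.obj j).diagram.obj (op i) ⟶ D) =>
    comp_inv_eq_of_comp_eq (e := tglue (fib u) f) (e' := tglue (fib v) f) (tglue_cell (fibMap η) f)
  naturality_id i := comp₂_ext fun D (f : (F.obj j).diagram.obj (op i) ⟶ D) =>
    (inv_eq_map_of_comp_eq (e := tglue (fib (𝟙 i)) f) (tinc ⟨j, i⟩ D) (λ_ f)
      ((tglue_cell (fibId i) f).trans (tglue_id (κ := ⟨j, i⟩) f))).trans
        (congrArg (fun t => (tinc ⟨j, i⟩ D).map t ≫ _ ≫ _) ((F.obj j).comp₂_mapId i D f).symm)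
  naturality_comp {i _ i''} u v := comp₂_ext fun D (f : (F.obj j).diagram.obj (op i) ⟶ D) =>
    (inv_eq_map_comp_of_comp_eq (e := tglue (fib (u ≫ v)) f) (tinc ⟨j, i''⟩ D) (α_ _ _ f)
      (e₁ := tglue (fib u) f) (e₂ := tglue (fib v) _)
      ((tglue_cell (fibComp u v) f).trans (tglue_comp (fib u) (fib v) f))).trans
        (congrArg (fun t => (tinc ⟨j, i''⟩ D).map t ≫ _ ≫ _ ≫ _ ≫ _ ≫ _)
          ((F.obj j).comp₂_mapComp u v D f).symm)

/-- The leg of the pseudocolimit cocone at `j`. -/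
noncomputable def leg (j : J) : (F.obj j).L ⟶ (F.total hJ).L :=
  TwoProObj.lift (F.legCocone hJ j)

/-- The component of `leg`. -/
noncomputable abbrev legF (j : J) (D : C) :
    Colim.Obj (F.obj j).diagram D ⥤ Colim.Obj F.totalDiagram D :=
  ((F.leg hJ j).trans.app D).toFunctor

theorem legF_frac (D : C) {n : (F.obj j).Index} {f : (F.obj j).diagram.obj (op i) ⟶ D}
    {g : (F.obj j).diagram.obj (op i') ⟶ D} (u : i ⟶ n) (v : i' ⟶ n)
    (β : (F.obj j).diagram.map u.op ≫ f ⟶ (F.obj j).diagram.map v.op ≫ g) :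
    (F.legF hJ j D).map (Colim.frac u v β) = (tglue (fib u) f).hom ≫ (tinc ⟨j, n⟩ D).map β ≫
      (tglue (fib v) g).inv := rfl

end Leg

section Edge
variable {κ μ ν : F.Idx} {D : C}

/-- The canonical transformation out of `C(X_κ, -)`. -/
noncomputable def tproj (κ : F.Idx) : repr κ.val ⟶ (F.total hJ).L := (F.total hJ).coconeApp κ

/-- The canonical invertible modification at `k`. -/
noncomputable def tprojIso (k : κ ⟶ μ) :
    F.tproj hJ κ ≫ 𝟙 (F.total hJ).L ≅ reprMap k.snd ≫ F.tproj hJ μ :=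
  ((F.total hJ).coconeIso k).symm

theorem reprMap_tproj {A : C} (r : μ.val ⟶ A) :
    reprMap r ≫ F.tproj hJ μ = (reprMap r ≫ μ.proj) ≫ F.leg hJ μ.fst :=
  TwoNatTrans.ext' fun _ => rfl

/-- The isomorphism from the leg at `κ` to the composite of `F k` with the leg at `μ`. -/
noncomputable def edgeIso (k : κ ⟶ μ) :
    F.tproj hJ κ ≫ 𝟙 _ ≅ (κ.proj ≫ F.map k.fst) ≫ F.leg hJ μ.fst :=
  F.tprojIso hJ k ≪≫ eqToIso (F.reprMap_tproj hJ k.snd) ≪≫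
    whiskerRightIso k.iso.symm (F.leg hJ μ.fst)

variable {F}

/-- The component of `edgeIso`. -/
noncomputable def edge (k : κ ⟶ μ) (f : κ.val ⟶ D) :
    (κ.tinc D).obj f ≅ (F.legF hJ μ.fst D).obj ((F.ev k.fst D).obj ((κ.inc D).obj f)) :=
  tglue k f ≪≫ (F.legF hJ μ.fst D).mapIso (k.comp f).symm

theorem edge_hom (k : κ ⟶ μ) (f : κ.val ⟶ D) : (edge hJ k f).hom =
    (tglue k f).hom ≫ (F.legF hJ μ.fst D).map (k.comp f).inv := rfl

theorem edgeIso_eq (k : κ ⟶ μ) : F.edgeIso hJ k = F.tprojIso hJ k ≪≫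
    eqToIso (F.reprMap_tproj hJ k.snd) ≪≫ whiskerRightIso k.iso.symm (F.leg hJ μ.fst) := rfl

theorem comp₂_edgeIso (k : κ ⟶ μ) (f : κ.val ⟶ D) :
    comp₂ (F.edgeIso hJ k).hom D f = (edge hJ k f).hom := by
  exact (comp₂_trans_eqToIso_trans _ _ _ (edgeIso_eq hJ k) D f).trans
    (comp_eqToHom_comp (tglue k f).hom ((F.legF hJ μ.fst D).map (k.comp f).inv) rfl)

theorem edge_naturality (k : κ ⟶ μ) {f g : κ.val ⟶ D} (θ : f ⟶ g) :
    (κ.tinc D).map θ ≫ (edge hJ k g).hom = (edge hJ k f).hom ≫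
      (F.legF hJ μ.fst D).map ((F.ev k.fst D).map ((κ.inc D).map θ)) := by
  rw [← comp₂_edgeIso, ← comp₂_edgeIso]
  exact (Pseudofunctor.StrongTrans.Modification.app
    (Pseudofunctor.StrongTrans.Hom.as (F.edgeIso hJ k).hom) D).toNatTrans.naturality θ

/-- This makes `edge` independent of the 1-cell chosen over a given 1-cell of `J`. The 2-cell `α`
lifts to one between `k ≫ fib u` and `l ≫ fib v`; its relation between gluings, once the gluings
inside the fibre are cancelled through the leg, is the claim. -/
theorem edge_cell {j : J} {i i' : (F.obj j).Index} (k : κ ⟶ ⟨j, i⟩) (l : κ ⟶ ⟨j, i'⟩)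
    (α : k.fst ⟶ l.fst) (f : κ.val ⟶ D) :
    (edge hJ k f).hom ≫ (F.legF hJ j D).map ((F.ev₂ α).app ((κ.inc D).obj f)) =
      (edge hJ l f).hom := by
  obtain ⟨n, u, v, θ, h⟩ := exists_fibCell k l α
  have h₁ := fibCell_comm α θ h f
  have h₂ := tglue_cell (fibCell α θ h) f
  rw [tglue_comp, tglue_comp] at h₂
  rw [edge_hom, edge_hom]
  exact edge_cell_aux (F.legF hJ j D) (tinc ⟨j, n⟩ D) h₁ (a := α_ _ _ _) (a' := α_ _ _ _) h₂
    (F.legF_frac hJ D u v _)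

theorem edge_comp (k : κ ⟶ μ) (l : μ ⟶ ν) (f : κ.val ⟶ D) :
    (edge hJ (k ≫ l) f).hom ≫ (F.legF hJ ν.fst D).map (F.evComp k.fst l.fst _).hom ≫
        (F.legF hJ ν.fst D).map ((F.ev l.fst D).map (k.comp f).hom) =
      (tglue k f).hom ≫ (edge hJ l (k.snd ≫ f)).hom := by
  rw [edge_hom, edge_hom, tglue_comp]
  exact edge_comp_aux (F.legF hJ ν.fst D) (n := (ν.inc D).mapIso (α_ l.snd k.snd f))
    (comp_hom_comp k l f)

theorem edge_id (f : κ.val ⟶ D) :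
    (edge hJ (𝟙 κ) f).hom ≫ (F.legF hJ κ.fst D).map (F.evId _).hom = 𝟙 _ := by
  rw [edge_hom, tglue_id]
  exact edge_id_aux (F.legF hJ κ.fst D) (n := (κ.inc D).mapIso (λ_ f)) (Hom.id_comp_hom f)

end Edge

section Edges
variable {j k : J} {D : C}

variable {F} in
/-- The components of the pseudocone structure. -/
noncomputable def edges (a : j ⟶ k) (x : Colim.Obj (F.obj j).diagram D) :
    (F.legF hJ j D).obj x ≅ (F.legF hJ k D).obj ((F.ev a D).obj x) :=
  edge hJ (pushHom ⟨j, x.idx⟩ a) x.hom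

theorem edge_cell_edges {κ : F.Idx} {i : (F.obj k).Index} (l : κ ⟶ ⟨k, i⟩) {a : κ.fst ⟶ k}
    (α : l.fst ⟶ a) (f : κ.val ⟶ D) :
    (edge hJ l f).hom ≫ (F.legF hJ k D).map ((F.ev₂ α).app ((κ.inc D).obj f)) =
      (edges hJ a ((κ.inc D).obj f)).hom :=
  edge_cell hJ l (pushHom κ a) α f

/-- The definition of `edges` uses the particular 1-cell `pushHom`; any other 1-cell over the same
`a` gives the same isomorphism, by `edge_cell` at an identity. -/
theorem edges_eq_edge {κ : F.Idx} {i : (F.obj k).Index} (l : κ ⟶ ⟨k, i⟩) (f : κ.val ⟶ D) :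
    (edges hJ l.fst ((κ.inc D).obj f)).hom = (edge hJ l f).hom := by
  rw [← edge_cell_edges F hJ l (𝟙 _) f, F.ev₂_id, CategoryTheory.Functor.map_id]
  exact Category.comp_id _

theorem edges_cell {a b : j ⟶ k} (α : a ⟶ b) (x : Colim.Obj (F.obj j).diagram D) :
    (edges hJ a x).hom ≫ (F.legF hJ k D).map ((F.ev₂ α).app x) = (edges hJ b x).hom :=
  edge_cell hJ (pushHom ⟨j, x.idx⟩ a) (pushHom ⟨j, x.idx⟩ b) α x.hom

/-- `edges` as a natural transformation. -/
noncomputable def edgesNat (a : j ⟶ k) : F.legF hJ j D ⟶ F.ev a D ⋙ F.legF hJ k D :=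
  Colim.natTransMk (fun x => (edges hJ a x).hom)
    (fun i {f g} θ => by
      exact edge_naturality hJ (pushHom (⟨j, i⟩ : F.Idx) a) θ)
    (fun {i i'} u f => by
      -- Naturality on a gluing compares two 1-cells from `(j, i)`: the chosen one over `a`, and
      -- `fib u` followed by the one chosen for `i'`, which lies over `𝟙 j ≫ a`. The left unitor of
      -- `a` relates them.
      exact edges_glue_aux (F.ev a D) (F.legF hJ k D)
        (edge_comp hJ (fib u) (pushHom (⟨j, i'⟩ : F.Idx) a) f) (fib_comp_hom u f)
        (F.ev₂_leftUnitor _)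
        (edge_cell hJ (fib u ≫ pushHom (⟨j, i'⟩ : F.Idx) a) (pushHom (⟨j, i⟩ : F.Idx) a)
          (λ_ a).hom f))

theorem edges_naturality (a : j ⟶ k) {x y : Colim.Obj (F.obj j).diagram D} (p : x ⟶ y) :
    (F.legF hJ j D).map p ≫ (edges hJ a y).hom =
      (edges hJ a x).hom ≫ (F.legF hJ k D).map ((F.ev a D).map p) :=
  (F.edgesNat hJ a).naturality p

/-- The 1-cell chosen over `a ≫ b` may be replaced by the composite of those chosen over `a` and
then over `b`, for which gluing is multiplicative. -/
theorem edges_comp {l : J} (a : j ⟶ k) (b : k ⟶ l) (x : Colim.Obj (F.obj j).diagram D) :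
    (edges hJ (a ≫ b) x).hom ≫ (F.legF hJ l D).map (F.evComp a b x).hom =
      (edges hJ a x).hom ≫ (edges hJ b ((F.ev a D).obj x)).hom := by
  have h₁ := edge_comp hJ (pushHom ⟨j, x.idx⟩ a) (pushHom (push ⟨j, x.idx⟩ a) b) x.hom
  have h₂ := edges_eq_edge F hJ (pushHom ⟨j, x.idx⟩ a ≫ pushHom (push ⟨j, x.idx⟩ a) b) x.hom
  have h₃ := F.edges_naturality hJ b (Hom.comp (pushHom ⟨j, x.idx⟩ a) x.hom).hom
  exact edges_comp_aux (F.ev b D) (F.legF hJ k D) (F.legF hJ l D) h₁ h₂ h₃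

theorem edges_id (x : Colim.Obj (F.obj j).diagram D) :
    (edges hJ (𝟙 j) x).hom ≫ (F.legF hJ j D).map (F.evId x).hom = 𝟙 _ := by
  have h₁ := edge_id (F := F) hJ (κ := ⟨j, x.idx⟩) x.hom
  have h₂ := edges_eq_edge F hJ (𝟙 (⟨j, x.idx⟩ : F.Idx)) x.hom
  exact (congrArg (· ≫ _) h₂).trans h₁

end Edges

end ProDiagram
end TwoPro

/-! ### The pseudocone with vertex the total colimit. -/

namespace TwoPro

section Aux
variable {A : Type u₁} [Category.{v₁} A] {B : Type u₂} [Category.{v₂} B]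

theorem inv_comp_id_of_comp_eq {x y : A} {e : x ≅ y} {p : y ⟶ x} (h : e.hom ≫ p = 𝟙 x) :
    e.inv ≫ 𝟙 x = p ≫ 𝟙 x ≫ 𝟙 x := by
  rw [← cancel_epi e.hom, reassoc_of% h]
  simp

theorem inv_comp_id_of_comp_eq_comp {x y z t : A} {e : x ≅ t} {p : t ⟶ z} {e₁ : x ≅ y} {e₂ : y ≅ z}
    (h : e.hom ≫ p = e₁.hom ≫ e₂.hom) :
    e.inv ≫ 𝟙 x = p ≫ 𝟙 z ≫ e₂.inv ≫ 𝟙 y ≫ e₁.inv ≫ 𝟙 x := by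
  rw [← cancel_epi e.hom, reassoc_of% h]
  simp

end Aux

theorem eq_conj_of_comp₂_eq {C : Type u} [Bicategory.{w, w} C] [Strict C] {A : C}
    {G : StrictPseudofunctor C Cat.{w, w}} {θ η : repr A ⟶ G} (ρ : θ ⟶ η) {D E : C} (f : A ⟶ D)
    (h : D ⟶ E) {p : (θ.trans.app D).toFunctor.obj f ⟶ (η.trans.app D).toFunctor.obj f}
    {q : (θ.trans.app E).toFunctor.obj (f ≫ h) ⟶ (η.trans.app E).toFunctor.obj (f ≫ h)}
    (hp : comp₂ ρ D f = p) (hq : comp₂ ρ E (f ≫ h) = q) :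
    q = eqToHom (twoNat_obj θ h f) ≫ (G.map h).toFunctor.map p ≫
      eqToHom (twoNat_obj η h f).symm := by
  subst hp hq
  exact comp₂_naturality ρ h f

namespace ProDiagram
variable {J : Type w} [Bicategory.{w, w} J] [Strict J] {C : Type u} [Bicategory.{w, w} C]
  [Strict C] (F : ProDiagram J C) (hJ : IsTwoFiltered J)
open Idx

theorem comp₂_edgeIso_inv {κ μ : F.Idx} {D : C} (k : κ ⟶ μ) (f : κ.val ⟶ D) :
    comp₂ (F.edgeIso hJ k).inv D f = (edge hJ k f).inv := by
  have h : comp₂Iso (F.edgeIso hJ k) D f = edge hJ k f := Iso.ext (comp₂_edgeIso hJ k f)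
  exact congrArg Iso.inv h

/-- The isomorphisms `edge` at varying `D` are the components of one modification `edgeIso`, so this
is its modification axiom. -/
theorem edge_inv_postcompose {κ μ : F.Idx} {D E : C} (k : κ ⟶ μ) (f : κ.val ⟶ D) (h : D ⟶ E) :
    (edge hJ k (f ≫ h)).inv = eqToHom (twoNat_obj ((κ.proj ≫ F.map k.fst) ≫ F.leg hJ μ.fst) h f) ≫
      ((F.total hJ).L.map h).toFunctor.map (edge hJ k f).inv ≫
        eqToHom (twoNat_obj (F.tproj hJ κ ≫ 𝟙 _) h f).symm :=
  eq_conj_of_comp₂_eq (F.edgeIso hJ k).inv f h (F.comp₂_edgeIso_inv hJ k f)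
    (F.comp₂_edgeIso_inv hJ k (f ≫ h))

/-- The component of the pseudocone at `a`. -/
noncomputable def coconeIsoApp {j k : J} (a : j ⟶ k) (D : C) :
    (F.map a ≫ F.leg hJ k).trans.app D ≅ (F.leg hJ j ≫ 𝟙 (F.total hJ).L).trans.app D :=
  Cat.Hom.isoMk <| NatIso.ofComponents (F := F.ev a D ⋙ F.legF hJ k D)
      (G := F.legF hJ j D ⋙ 𝟭 _) (fun x => (edges hJ a x).symm)
      (fun {x y} p => by
        exact (Iso.comp_inv_eq _).2 (by
          rw [Category.assoc]
          exact (Iso.eq_inv_comp _).2 (F.edges_naturality hJ a p).symm))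

/-- The structure 2-cell of the pseudocone at `a`. -/
noncomputable def coconeIso {j k : J} (a : j ⟶ k) :
    F.map a ≫ F.leg hJ k ≅ F.leg hJ j ≫ 𝟙 (F.total hJ).L :=
  TwoNatTrans.isoMk (F.coconeIsoApp hJ a)
    (fun {D E} h => by
      ext x
      rw [Cat.Hom₂.comp_app, Cat.Hom₂.comp_app, Cat.eqToHom_app, Cat.eqToHom_app]
      exact F.edge_inv_postcompose hJ (pushHom ⟨j, x.idx⟩ a) x.hom h)

/-- The pseudocone from `F` with vertex `L X` for the total 2-pro-object `X`. -/
noncomputable def cocone : F.toPseudofunctor ⟶ const J (F.total hJ).L where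
  app := F.leg hJ
  naturality a := F.coconeIso hJ a
  naturality_naturality {j k a b} α := comp₂_ext fun D x => by
    change (F.legF hJ k D).map ((F.ev₂ α).app x) ≫ (edges hJ b x).inv =
      (edges hJ a x).inv ≫ 𝟙 _
    rw [Category.comp_id, Iso.comp_inv_eq, Iso.eq_inv_comp]
    exact F.edges_cell hJ α x
  naturality_id j := comp₂_ext fun D x => by
    change (edges hJ (𝟙 j) x).inv ≫ 𝟙 _ = (F.legF hJ j D).map (F.evId x).hom ≫ 𝟙 _ ≫ 𝟙 _
    exact inv_comp_id_of_comp_eq (F.edges_id hJ x)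
  naturality_comp {j k l} a b := comp₂_ext fun D x => by
    change (edges hJ (a ≫ b) x).inv ≫ 𝟙 _ =
      (F.legF hJ l D).map (F.evComp a b x).hom ≫ 𝟙 _ ≫
        (edges hJ b ((F.ev a D).obj x)).inv ≫ 𝟙 _ ≫ (edges hJ a x).inv ≫ 𝟙 _
    exact inv_comp_id_of_comp_eq_comp (F.edges_comp hJ a b x)

end ProDiagram
end TwoPro

/-! ### Comparison functor: full, faithful, injective on objects. -/

namespace TwoPro

section Aux
variable {A : Type u₁} [Category.{v₁} A] {B : Type u₂} [Category.{v₂} B]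

/-- If an arrow `g` is an edge followed by the image of an arrow under a leg, naturality at `g`
follows from naturality at these two factors. -/
theorem square_of_comp_map {A' : Type*} [Category* A'] (Φ Ψ : A ⥤ B) (Λ : A' ⥤ A) {x : A} {y z : A'}
    {e : x ≅ Λ.obj y} {p : y ⟶ z} {g : x ⟶ Λ.obj z} (hg : e.hom ≫ Λ.map p = g)
    {mx : Φ.obj x ⟶ Ψ.obj x} {my : Φ.obj (Λ.obj y) ⟶ Ψ.obj (Λ.obj y)}
    {mz : Φ.obj (Λ.obj z) ⟶ Ψ.obj (Λ.obj z)} (h₁ : my ≫ Ψ.map e.inv = Φ.map e.inv ≫ mx)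
    (h₂ : Φ.map (Λ.map p) ≫ mz = my ≫ Ψ.map (Λ.map p)) : Φ.map g ≫ mz = mx ≫ Ψ.map g := by
  have h₃ := square_of_inv Φ Ψ e h₁
  rw [← hg, Φ.map_comp, Category.assoc, h₂, Ψ.map_comp, reassoc_of% h₃]

end Aux

namespace ProDiagram
variable {J : Type w} [Bicategory.{w, w} J] [Strict J] {C : Type u} [Bicategory.{w, w} C]
  [Strict C] (F : ProDiagram J C) (hJ : IsTwoFiltered J)
open Idx

/-- Every gluing of the total colimit factors into a structure isomorphism of the cocone and the
image of an arrow under a leg. Hence whatever is compatible with legs and structure isomorphisms is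
compatible with all generators. -/
theorem edges_comp_map {κ μ : F.Idx} {D : C} (k : κ ⟶ μ) (f : κ.val ⟶ D) :
    (edges hJ k.fst ((κ.inc D).obj f)).hom ≫ (F.legF hJ μ.fst D).map (k.comp f).hom =
      (tglue k f).hom := by
  have h := edges_eq_edge F hJ k f
  rw [edge_hom] at h
  exact ((Iso.eq_comp_inv ((F.legF hJ μ.fst D).mapIso (k.comp f))).1 h)

/-- Composition with the pseudocone. -/
noncomputable abbrev compare (Z : StrictPseudofunctor C Cat.{w, w}) :
    ((F.total hJ).L ⟶ Z) ⥤ (F.toPseudofunctor ⟶ const J Z) :=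
  constFunctor J (F.total hJ).L Z ⋙ precomp (const J Z) (F.cocone hJ)

variable {F} in
theorem compare_naturality {Z : StrictPseudofunctor C Cat.{w, w}} (θ : (F.total hJ).L ⟶ Z)
    {j k : J} (a : j ⟶ k) (D : C) (x : Colim.Obj (F.obj j).diagram D) :
    comp₂ (((F.compare hJ Z).obj θ).naturality a).hom D x =
      (θ.trans.app D).toFunctor.map (edges hJ a x).inv := by
  change 𝟙 _ ≫ (θ.trans.app D).toFunctor.map (edges hJ a x).inv ≫ 𝟙 _ ≫ (𝟙 _ ≫ 𝟙 _) ≫ 𝟙 _ = _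
  simp

/-- Each object of the total colimit is, by definition, the image of an object under a leg, so a
modification has no component that the legs do not see. -/
instance (Z : StrictPseudofunctor C Cat.{w, w}) : (F.compare hJ Z).Faithful where
  map_injective {θ η ρ σ} h := comp₂_ext fun D (a : Colim.Obj F.totalDiagram D) => by
    have := congrArg (fun m => comp₂ (Pseudofunctor.StrongTrans.Modification.app
      (Pseudofunctor.StrongTrans.Hom.as m) a.idx.fst) D ((a.idx.inc D).obj a.hom)) h
    exact this

instance (Z : StrictPseudofunctor C Cat.{w, w}) : (F.compare hJ Z).Full where
  map_surjective {θ η} m := by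
    let m' := fun j => Pseudofunctor.StrongTrans.Modification.app
      (Pseudofunctor.StrongTrans.Hom.as m) j
    have hm : ∀ {j k : J} (a : j ⟶ k) (D : C) (x : Colim.Obj (F.obj j).diagram D),
        comp₂ (m' k) D ((F.ev a D).obj x) ≫
          (η.trans.app D).toFunctor.map (edges hJ a x).inv =
        (θ.trans.app D).toFunctor.map (edges hJ a x).inv ≫ comp₂ (m' j) D x := by
      intro j k a D x
      have h := congrArg (fun ρ => comp₂ ρ D x)
        (Pseudofunctor.StrongTrans.Modification.naturality
          (Pseudofunctor.StrongTrans.Hom.as m) a)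
      have h₁ : _ ≫ comp₂ (((F.compare hJ Z).obj η).naturality a).hom D x =
        comp₂ (((F.compare hJ Z).obj θ).naturality a).hom D x ≫ _ := h
      rw [compare_naturality, compare_naturality] at h₁
      exact h₁
    have hn : ∀ (j : J) (D : C) {x y : Colim.Obj (F.obj j).diagram D} (p : x ⟶ y),
        (θ.trans.app D).toFunctor.map ((F.legF hJ j D).map p) ≫ comp₂ (m' j) D y =
          comp₂ (m' j) D x ≫ (η.trans.app D).toFunctor.map ((F.legF hJ j D).map p) :=
      fun j D {x y} p => (Pseudofunctor.StrongTrans.Modification.app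
            (Pseudofunctor.StrongTrans.Hom.as (m' j)) D).toNatTrans.naturality p
    let n : ∀ D, (θ.trans.app D).toFunctor ⟶ (η.trans.app D).toFunctor := fun D =>
      -- The component at `(κ, f)` is forced to be that of `m` at the leg of `κ`. On 2-cells
      -- naturality comes from a single `m' j`; on gluings it combines `hm` and `hn` through the
      -- factorization above.
      Colim.natTransMk (X := F.totalDiagram)
        (fun a => comp₂ (m' a.idx.fst) D ((a.idx.inc D).obj a.hom))
        (fun κ {f g} α => hn κ.fst D ((κ.inc D).map α))
        (fun {κ μ} k f => square_of_comp_map _ _ (F.legF hJ μ.fst D) (F.edges_comp_map hJ k f)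
          (hm k.fst D ((κ.inc D).obj f)) (hn μ.fst D _))
    refine ⟨TwoNatTrans.homMk (fun D => (n D).toCatHom₂) (fun {D E} h => ?_), ?_⟩
    · ext a
      rw [Cat.Hom₂.comp_app, Cat.Hom₂.comp_app, Cat.eqToHom_app, Cat.eqToHom_app]
      let a' : Colim.Obj F.totalDiagram D := a
      exact comp₂_naturality (m' a'.idx.fst) h ((a'.idx.inc D).obj a'.hom)
    · refine Pseudofunctor.StrongTrans.homCategory.ext fun i => comp₂_ext fun D f => ?_
      rfl

theorem compare_injective (Z : StrictPseudofunctor C Cat.{w, w}) :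
    Function.Injective (F.compare hJ Z).obj := fun θ η h =>
  TwoNatTrans.ext' fun D => Cat.Hom.ext <| by
    have h₀ : ∀ j : J, F.leg hJ j ≫ θ = F.leg hJ j ≫ η := fun j =>
      congrArg (fun s => Pseudofunctor.StrongTrans.app s j) h
    have h₁ : ∀ j : J, F.legF hJ j D ⋙ (θ.trans.app D).toFunctor =
        F.legF hJ j D ⋙ (η.trans.app D).toFunctor := fun j =>
      congrArg (fun t => (t.trans.app D).toFunctor) (h₀ j)
    have h₂ : ∀ (j : J) (x : Colim.Obj (F.obj j).diagram D),
        (θ.trans.app D).toFunctor.obj ((F.legF hJ j D).obj x) =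
          (η.trans.app D).toFunctor.obj ((F.legF hJ j D).obj x) :=
      fun j x => CategoryTheory.Functor.congr_obj (h₁ j) x
    have h₃ : ∀ (j : J) {x y : Colim.Obj (F.obj j).diagram D} (p : x ⟶ y),
        (θ.trans.app D).toFunctor.map ((F.legF hJ j D).map p) ≫ eqToHom (h₂ j y) =
          eqToHom (h₂ j x) ≫ (η.trans.app D).toFunctor.map ((F.legF hJ j D).map p) :=
      fun j {x y} p => square_of_conj (CategoryTheory.Functor.congr_hom (h₁ j) p)
    refine Colim.functor_ext (X := F.totalDiagram)
      (fun a => h₂ a.idx.fst ((a.idx.inc D).obj a.hom))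
      (fun κ f g α => h₃ κ.fst ((κ.inc D).map α))
      (fun {κ μ} k f => square_of_comp_map _ _ (F.legF hJ μ.fst D) (F.edges_comp_map hJ k f)
          (my := eqToHom (h₂ _ _)) ?_ (h₃ μ.fst _))
    have e := TwoProObj.strongTrans_app_comp h k.fst D ((κ.inc D).obj f)
    rw [compare_naturality, compare_naturality] at e
    exact (square_of_conj e).symm

end ProDiagram
end TwoPro

/-! ### Extending a pseudocone on `F` to the total colimit. -/

namespace TwoPro

section Aux
variable {A : Type u₁} [Category.{v₁} A] {B : Type u₂} [Category.{v₂} B]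

theorem desc_cell_aux (Φ : A ⥤ B) {x y : A} {x' y' : A} {c : x ≅ x'} {d : y ≅ y'} {p : x' ⟶ y'}
    {q : x ⟶ y} (h : c.hom ≫ p = q ≫ d.hom) {b : B} {τ : Φ.obj x ⟶ b} {σ : Φ.obj y ⟶ b}
    (h' : Φ.map q ≫ σ = τ) {n : Φ.obj x' ⟶ b} {n' : Φ.obj y' ⟶ b} (hn : n = Φ.map c.inv ≫ τ)
    (hn' : n' = Φ.map d.inv ≫ σ) : Φ.map p ≫ n' = n ≫ 𝟙 b := by
  have e : p = c.inv ≫ q ≫ d.hom := by rw [← h, Iso.inv_hom_id_assoc]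
  subst hn hn' h'
  rw [e, ← Φ.map_comp_assoc]
  simp

theorem desc_id_aux (Φ : A ⥤ B) {x y x' : A} {c : x ≅ x'} {m : x ⟶ y} {l : x' ≅ y}
    (h : c.hom = m ≫ l.inv) {τ : Φ.obj x ⟶ Φ.obj y} (h' : τ = Φ.map m)
    {n : Φ.obj x' ⟶ Φ.obj y} (hn : n = Φ.map c.inv ≫ τ) {l' : x' ⟶ y} (hl : l' = l.hom) :
    n ≫ 𝟙 _ = Φ.map l' ≫ 𝟙 _ ≫ 𝟙 _ := by
  have e : c.inv ≫ m = l.hom := by simp [show m = c.hom ≫ l.hom by simp [h]]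
  rw [hn, hl, h', ← Φ.map_comp, e, Category.comp_id, Category.comp_id, Category.comp_id]

theorem desc_comp_aux {A' : Type*} [Category* A'] (Φ : A ⥤ B) (Ψ : A' ⥤ B) (E : A' ⥤ A)
    {x y x' : A} {u v : A'} {c : x ≅ x'} {m : x ⟶ E.obj u} {k : u ≅ v} {l : E.obj v ≅ y}
    {a : x' ≅ y} (h : c.hom = m ≫ E.map k.hom ≫ l.hom ≫ a.inv) {b : B}
    {τ : Φ.obj x ⟶ b} {σ : Φ.obj (E.obj u) ⟶ Ψ.obj u} {σ' : Φ.obj (E.obj v) ⟶ Ψ.obj v}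
    {ρ : Ψ.obj u ⟶ b} (hτ : τ = Φ.map m ≫ σ ≫ ρ)
    (hσ : Φ.map (E.map k.hom) ≫ σ' = σ ≫ Ψ.map k.hom) {n : Φ.obj x' ⟶ b} {n₁ : Φ.obj y ⟶ Ψ.obj v}
    {n₂ : Ψ.obj v ⟶ b} {a' : x' ⟶ y} (hn : n = Φ.map c.inv ≫ τ) (hn₁ : n₁ = Φ.map l.inv ≫ σ')
    (hn₂ : n₂ = Ψ.map k.inv ≫ ρ) (ha : a' = a.hom) :
    n ≫ 𝟙 b = Φ.map a' ≫ 𝟙 _ ≫ n₁ ≫ 𝟙 _ ≫ n₂ ≫ 𝟙 b := by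
  have e : c.inv ≫ m = a.hom ≫ l.inv ≫ E.map k.inv := by
    have : m = c.hom ≫ a.hom ≫ l.inv ≫ E.map k.inv := by simp [h, ← E.map_comp]
    simp [this]
  have e' : Φ.map (E.map k.inv) ≫ σ = σ' ≫ Ψ.map k.inv := by
    have : σ = Φ.map (E.map k.hom) ≫ σ' ≫ Ψ.map k.inv := by
      rw [reassoc_of% hσ, ← Ψ.map_comp]; simp
    rw [this, ← Φ.map_comp_assoc, ← E.map_comp]
    simp
  rw [hn, hn₁, hn₂, ha, hτ, ← Φ.map_comp_assoc, e]
  simp [reassoc_of% e']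

end Aux

namespace ProDiagram
variable {J : Type w} [Bicategory.{w, w} J] [Strict J] {C : Type u} [Bicategory.{w, w} C]
  [Strict C] {F : ProDiagram J C} (hJ : IsTwoFiltered J)
open Idx

variable (F) in
theorem comp₂_total_mapId (κ : F.Idx) {D : C} (f : κ.val ⟶ D) :
    comp₂ ((F.total hJ).reprDiagram.mapId κ).hom D f = (λ_ f).hom := by
  refine ((F.total hJ).comp₂_mapId κ D f).trans ?_
  change (F.totalDiagram.mapId (op κ)).hom ▷ f ≫ (λ_ f).hom = _
  rw [F.totalDiagram.mapId_eq_eqToIso]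
  exact (congrArg (· ≫ (λ_ f).hom) (id_whiskerRight _ f)).trans (Category.id_comp _)

variable (F) in
theorem comp₂_total_mapComp {κ μ ν : F.Idx} (k : κ ⟶ μ) (l : μ ⟶ ν) {D : C} (f : κ.val ⟶ D) :
    comp₂ ((F.total hJ).reprDiagram.mapComp k l).hom D f = (α_ l.snd k.snd f).hom := by
  refine ((F.total hJ).comp₂_mapComp k l D f).trans ?_
  change (F.totalDiagram.mapComp l.op k.op).hom ▷ f ≫ (α_ l.snd k.snd f).hom = _
  rw [F.totalDiagram.mapComp_eq_eqToIso]
  exact (congrArg (· ≫ (α_ l.snd k.snd f).hom) (id_whiskerRight _ f)).trans (Category.id_comp _)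

section Desc
variable {Z : StrictPseudofunctor C Cat.{w, w}} (t : F.toPseudofunctor ⟶ const J Z)

/-- The component of a pseudocone at `D`. -/
abbrev coneF (j : J) (D : C) : Colim.Obj (F.obj j).diagram D ⥤ Z.obj D :=
  ((t.app j).trans.app D).toFunctor

variable {i j k : J} {D : C}

/-- The structure isomorphisms of a pseudocone. -/
def coneIso (a : j ⟶ k) (x : Colim.Obj (F.obj j).diagram D) :
    (coneF t k D).obj ((F.ev a D).obj x) ≅ (coneF t j D).obj x :=
  comp₂Iso (t.naturality a) D x

theorem coneIso_naturality (a : j ⟶ k) {x y : Colim.Obj (F.obj j).diagram D} (p : x ⟶ y) :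
    (coneF t k D).map ((F.ev a D).map p) ≫ (coneIso t a y).hom =
      (coneIso t a x).hom ≫ (coneF t j D).map p :=
  (Pseudofunctor.StrongTrans.Modification.app
    (Pseudofunctor.StrongTrans.Hom.as (t.naturality a).hom) D).toNatTrans.naturality p

theorem coneIso_cell {a b : j ⟶ k} (α : a ⟶ b) (x : Colim.Obj (F.obj j).diagram D) :
    (coneF t k D).map ((F.ev₂ α).app x) ≫ (coneIso t b x).hom = (coneIso t a x).hom := by
  have h : (coneF t k D).map ((F.ev₂ α).app x) ≫ (coneIso t b x).hom =
      (coneIso t a x).hom ≫ 𝟙 _ := congrArg (fun ρ => comp₂ ρ D x) (t.naturality_naturality α)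
  exact h.trans (Category.comp_id _)

theorem coneIso_id (x : Colim.Obj (F.obj j).diagram D) :
    (coneIso t (𝟙 j) x).hom = (coneF t j D).map (F.evId x).hom := by
  have h : (coneIso t (𝟙 j) x).hom ≫ 𝟙 _ = (coneF t j D).map (F.evId x).hom ≫ 𝟙 _ ≫ 𝟙 _ :=
    congrArg (fun ρ => comp₂ ρ D x) (t.naturality_id j)
  simpa using h

theorem coneIso_comp (a : i ⟶ j) (b : j ⟶ k) (x : Colim.Obj (F.obj i).diagram D) :
    (coneIso t (a ≫ b) x).hom = (coneF t k D).map (F.evComp a b x).hom ≫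
      (coneIso t b ((F.ev a D).obj x)).hom ≫ (coneIso t a x).hom := by
  have h : (coneIso t (a ≫ b) x).hom ≫ 𝟙 _ = (coneF t k D).map (F.evComp a b x).hom ≫ 𝟙 _ ≫
      (coneIso t b ((F.ev a D).obj x)).hom ≫ 𝟙 _ ≫ (coneIso t a x).hom ≫ 𝟙 _ :=
    congrArg (fun ρ => comp₂ ρ D x) (t.naturality_comp a b)
  simpa using h

variable {κ μ : F.Idx}

/-- The structure 2-cell at `k` of the pseudocone on all representables. -/
noncomputable def descIso (k : κ ⟶ μ) :
    reprMap k.snd ≫ μ.proj ≫ t.app μ.fst ≅ (κ.proj ≫ t.app κ.fst) ≫ 𝟙 Z :=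
  (α_ _ _ _).symm ≪≫ whiskerRightIso k.iso.symm (t.app μ.fst) ≪≫ α_ _ _ _ ≪≫
    whiskerLeftIso κ.proj (t.naturality k.fst) ≪≫ (α_ _ _ _).symm

theorem comp₂_descIso (k : κ ⟶ μ) (f : κ.val ⟶ D) : comp₂ (descIso t k).hom D f =
    (coneF t μ.fst D).map (k.comp f).inv ≫ (coneIso t k.fst ((κ.inc D).obj f)).hom := by
  change 𝟙 _ ≫ (coneF t μ.fst D).map (k.comp f).inv ≫ 𝟙 _ ≫
    (coneIso t k.fst ((κ.inc D).obj f)).hom ≫ 𝟙 _ = _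
  rw [Category.id_comp, Category.id_comp, Category.comp_id]

/-- The pseudocone on all representables determined by a pseudocone on `F`. -/
noncomputable def descCone : (F.total hJ).reprDiagram.toPseudofunctor ⟶ const F.Idx Z where
  app κ := κ.proj ≫ t.app κ.fst
  naturality k := descIso t k
  naturality_naturality {κ μ k l} s := comp₂_ext fun D (f : κ.val ⟶ D) =>
    desc_cell_aux (coneF t μ.fst D) (Hom.Hom₂.comm s f)
      (coneIso_cell t (Hom.Hom₂.fst s) ((κ.inc D).obj f)) (comp₂_descIso t k f)
      (comp₂_descIso t l f)
  naturality_id κ := comp₂_ext fun D (f : κ.val ⟶ D) =>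
    desc_id_aux (coneF t κ.fst D) (l := (κ.inc D).mapIso (λ_ f)) (Hom.id_comp_hom f)
      (coneIso_id t ((κ.inc D).obj f)) (comp₂_descIso t (𝟙 κ) f)
      (congrArg (κ.inc D).map (F.comp₂_total_mapId hJ κ f))
  naturality_comp {κ μ ν} k l := comp₂_ext fun D (f : κ.val ⟶ D) =>
    desc_comp_aux (coneF t ν.fst D) (coneF t μ.fst D) (F.ev l.fst D) (k := Hom.comp k f)
      (l := Hom.comp l (k.snd ≫ f))
      (a := (ν.inc D).mapIso (α_ l.snd k.snd f)) (comp_hom_comp k l f)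
      (coneIso_comp t k.fst l.fst _) (coneIso_naturality t l.fst (Hom.comp k f).hom)
      (comp₂_descIso t (k ≫ l) f) (comp₂_descIso t l (k.snd ≫ f)) (comp₂_descIso t k f)
      (congrArg (ν.inc D).map (F.comp₂_total_mapComp hJ k l f))

end Desc

end ProDiagram
end TwoPro

namespace TwoPro

section Aux
variable {A : Type u₁} [Category.{v₁} A] {B : Type u₂} [Category.{v₂} B]

theorem desc_glue_aux (Φ : A ⥤ B) {x x' y : A} {c : x ≅ x'} {m : x ⟶ y} {g : y ≅ x'}
    (h : c.hom = m ≫ g.hom) {τ : Φ.obj x ⟶ Φ.obj y} (hτ : τ = Φ.map m) :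
    Φ.map c.inv ≫ τ = Φ.map g.inv := by
  have e : c.inv ≫ m = g.inv := by simp [show m = c.hom ≫ g.inv by simp [h]]
  rw [hτ, ← Φ.map_comp, e]

theorem eq_id_comp_comp_id {x y : A} {p q : x ⟶ y} (h : p = q) : p = 𝟙 x ≫ q ≫ 𝟙 y := by
  simp [h]

end Aux

namespace ProDiagram
variable {J : Type w} [Bicategory.{w, w} J] [Strict J] {C : Type u} [Bicategory.{w, w} C]
  [Strict C] {F : ProDiagram J C} (hJ : IsTwoFiltered J)
open Idx

section Desc
variable {Z : StrictPseudofunctor C Cat.{w, w}} (t : F.toPseudofunctor ⟶ const J Z)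
  {i j k : J} {D : C}

/-- The transformation determined by a pseudocone. -/
noncomputable def desc : (F.total hJ).L ⟶ Z := TwoProObj.lift (descCone hJ t)

/-- The component of `desc`. -/
noncomputable abbrev descF (D : C) : Colim.Obj F.totalDiagram D ⥤ Z.obj D :=
  ((desc hJ t).trans.app D).toFunctor

theorem descF_tglue_inv {κ μ : F.Idx} (k : κ ⟶ μ) (f : κ.val ⟶ D) :
    (descF hJ t D).map (tglue k f).inv = (coneF t μ.fst D).map (k.comp f).inv ≫
      (coneIso t k.fst ((κ.inc D).obj f)).hom :=
  comp₂_descIso t k f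

/-- The functors agree by definition on objects and on images of 2-cells. For the gluing along `fib
u`, the factor of its representing isomorphism coming from `F.mapId` cancels against the identity
axiom of the pseudocone. -/
theorem leg_comp_descF (j : J) (D : C) : F.legF hJ j D ⋙ descF hJ t D = coneF t j D :=
  Colim.functor_ext (fun _ => rfl)
    (fun i {f g} α => by
      exact (Category.comp_id _).trans (Category.id_comp _).symm)
    (fun {i i'} u f => by
      refine square_of_inv_eq (F.legF hJ j D ⋙ descF hJ t D) (coneF t j D) _ rfl rfl ?_
      exact eq_id_comp_comp_id ((descF_tglue_inv hJ t (fib u) f).trans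
        (desc_glue_aux _ (fib_comp_hom u f) (coneIso_id t _))))

theorem descF_map_legF (j : J) {x y : Colim.Obj (F.obj j).diagram D} (p : x ⟶ y) :
    (descF hJ t D).map ((F.legF hJ j D).map p) = (coneF t j D).map p := by
  have h := CategoryTheory.Functor.congr_hom (leg_comp_descF hJ t j D) p
  exact h.trans ((Category.id_comp _).trans (Category.comp_id _))

/-- The inverse of an edge is the image under a leg of a representing isomorphism, followed by an
inverse gluing. Under `desc` the first factor cancels the representing isomorphism contained in the
value of the second. -/
theorem descF_edges_inv (a : j ⟶ k) (x : Colim.Obj (F.obj j).diagram D) :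
    (descF hJ t D).map (edges hJ a x).inv = (coneIso t a x).hom := by
  let κ : F.Idx := ⟨j, x.idx⟩
  have h₁ := descF_map_legF hJ t k (Hom.comp (pushHom κ a) x.hom).hom
  have h₂ := descF_tglue_inv hJ t (pushHom κ a) x.hom
  have h₃ := (descF hJ t D).map_comp ((F.legF hJ k D).map (Hom.comp (pushHom κ a) x.hom).hom)
    (tglue (pushHom κ a) x.hom).inv
  refine h₃.trans ((congrArg₂ (· ≫ ·) h₁ h₂).trans ?_)
  exact ((coneF t k D).mapIso (Hom.comp (pushHom κ a) x.hom)).hom_inv_id_assoc _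

end Desc

variable (F)

theorem compare_surjective (Z : StrictPseudofunctor C Cat.{w, w}) :
    Function.Surjective (F.compare hJ Z).obj := fun t =>
  ⟨desc hJ t, TwoProObj.strongTrans_ext
    (fun j => TwoNatTrans.ext' (θ := F.leg hJ j ≫ desc hJ t) (η := t.app j) fun D =>
      Cat.Hom.ext (leg_comp_descF hJ t j D))
    fun a D x => (compare_naturality hJ (desc hJ t) a D x).trans
      (eq_id_comp_comp_id (descF_edges_inv hJ t a x))⟩

/-- The 2-functor `L X` for the total 2-pro-object `X` is the pseudocolimit. -/
theorem isPseudocolimit_cocone : IsPseudocolimit (F.cocone hJ) := fun Z =>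
  isIsoOfCategories_of (F.compare hJ Z) ⟨F.compare_injective hJ Z, F.compare_surjective hJ Z⟩

end ProDiagram
end TwoPro

/-! ### Uniqueness of pseudocolimits and transport along isomorphisms. -/

namespace TwoPro

section IsoOfCategories
variable {X : Type u₁} [Category.{v₁} X] {Y : Type u₂} [Category.{v₂} Y] {F : X ⥤ Y}

theorem IsIsoOfCategories.isEquivalence (h : IsIsoOfCategories F) : F.IsEquivalence := by
  obtain ⟨G, h₁, h₂⟩ := h
  exact (CategoryTheory.Equivalence.mk F G (eqToIso h₁.symm) (eqToIso h₂)).isEquivalence_functor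

theorem IsIsoOfCategories.bijective (h : IsIsoOfCategories F) : Function.Bijective F.obj := by
  obtain ⟨G, h₁, h₂⟩ := h
  exact Function.bijective_iff_has_inverse.2
    ⟨G.obj, CategoryTheory.Functor.congr_obj h₁, CategoryTheory.Functor.congr_obj h₂⟩

/-- Full faithfulness is invariant under isomorphism of functors, so only bijectivity on objects has
to be checked strictly. -/
theorem IsIsoOfCategories.of_iso {G : X ⥤ Y} (e : F ≅ G) [F.IsEquivalence]
    (h : Function.Bijective G.obj) : IsIsoOfCategories G := by
  have := CategoryTheory.Functor.isEquivalence_of_iso e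
  exact isIsoOfCategories_of G h

end IsoOfCategories

section Strict
variable {I : Type u₁} [Bicategory.{w₁, v₁} I] {A : Type u₂} [Bicategory.{w₂, v₂} A]

/-- Once components are identified, the modification has identity components, and its naturality
says that the structure 2-cells coincide. -/
theorem strongTrans_eq_of_modification {F G : Pseudofunctor I A} {s t : F ⟶ G} (m : s ⟶ t)
    (h : ∀ i, s.app i = t.app i) (hm : ∀ i, m.as.app i = eqToHom (h i)) : s = t := by
  obtain ⟨sa, sn, _, _, _⟩ := s
  obtain ⟨ta, tn, _, _, _⟩ := t
  obtain rfl : sa = ta := funext h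
  congr
  funext i j f
  have e := m.as.naturality f
  rw [hm, hm] at e
  refine Iso.ext ?_
  change F.map f ◁ 𝟙 _ ≫ (tn f).hom = (sn f).hom ≫ 𝟙 _ ▷ G.map f at e
  simpa using e.symm

variable [Strict A]

theorem strongTrans_id_comp {F G : Pseudofunctor I A} (s : F ⟶ G) : 𝟙 F ≫ s = s :=
  strongTrans_eq_of_modification (λ_ s).hom (fun _ => Strict.id_comp _) fun _ =>
    congrArg Iso.hom (Strict.leftUnitor_eqToIso _)

theorem strongTrans_comp_id {F G : Pseudofunctor I A} (s : F ⟶ G) : s ≫ 𝟙 G = s :=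
  strongTrans_eq_of_modification (ρ_ s).hom (fun _ => Strict.comp_id _) fun _ =>
    congrArg Iso.hom (Strict.rightUnitor_eqToIso _)

theorem strongTrans_assoc {F G H K : Pseudofunctor I A} (s : F ⟶ G) (t : G ⟶ H) (r : H ⟶ K) :
    (s ≫ t) ≫ r = s ≫ t ≫ r :=
  strongTrans_eq_of_modification (α_ s t r).hom (fun _ => Strict.assoc _ _ _) fun _ =>
    congrArg Iso.hom (Strict.associator_eqToIso _ _ _)

end Strict

section Const
variable (I : Type u₁) [Bicategory.{w₁, v₁} I] {A : Type u₂} [Bicategory.{w₂, v₂} A] {X Y Z : A}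

/-- Constant transformations are compatible with composition. -/
def constComp (f : X ⟶ Y) (g : Y ⟶ Z) : (constFunctor I X Y).obj f ≫ (constFunctor I Y Z).obj g ≅
    (constFunctor I X Z).obj (f ≫ g) :=
  Pseudofunctor.StrongTrans.isoMk (fun _ => Iso.refl _) (fun {a b} u => by
    change 𝟙 X ◁ 𝟙 (f ≫ g) ≫ (λ_ (f ≫ g)).hom ≫ (ρ_ (f ≫ g)).inv =
      ((α_ _ _ _).inv ≫ ((λ_ f).hom ≫ (ρ_ f).inv) ▷ g ≫ (α_ _ _ _).hom ≫
        f ◁ ((λ_ g).hom ≫ (ρ_ g).inv) ≫ (α_ _ _ _).inv) ≫ 𝟙 (f ≫ g) ▷ 𝟙 Z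
    simp)

theorem constComp_eq (f : X ⟶ Y) (g : Y ⟶ Z) :
    (constFunctor I X Y).obj f ≫ (constFunctor I Y Z).obj g =
      (constFunctor I X Z).obj (f ≫ g) :=
  strongTrans_eq_of_modification (constComp I f g).hom (fun _ => rfl) fun _ => rfl

/-- The constant transformation at an identity. -/
def constId (X : A) : (constFunctor I X X).obj (𝟙 X) ≅ 𝟙 (const I X) :=
  Pseudofunctor.StrongTrans.isoMk (fun _ => Iso.refl _) (fun {a b} u => by
    change 𝟙 X ◁ 𝟙 (𝟙 X) ≫ (ρ_ (𝟙 X)).hom ≫ (λ_ (𝟙 X)).inv =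
      ((λ_ (𝟙 X)).hom ≫ (ρ_ (𝟙 X)).inv) ≫ 𝟙 (𝟙 X) ▷ 𝟙 X
    simp [unitors_equal, unitors_inv_equal])

theorem constId_eq (X : A) : (constFunctor I X X).obj (𝟙 X) = 𝟙 (const I X) :=
  strongTrans_eq_of_modification (constId I X).hom (fun _ => rfl) fun _ => rfl

end Const

section Transport
variable {I : Type u₁} [Bicategory.{w₁, v₁} I] {A : Type u₂} [Bicategory.{w₂, v₂} A]

/-- The isomorphism `f ≅ e ≫ e' ≫ f` for `e ≫ e' = 𝟙`. -/
def unitIso {X Y Z : A} {e : X ⟶ Y} {e' : Y ⟶ X} (h : e ≫ e' = 𝟙 X) (f : X ⟶ Z) :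
    f ≅ e ≫ e' ≫ f :=
  (λ_ f).symm ≪≫ whiskerRightIso (eqToIso h.symm) f ≪≫ α_ _ _ _

theorem unitIso_naturality {X Y Z : A} {e : X ⟶ Y} {e' : Y ⟶ X} (h : e ≫ e' = 𝟙 X) {f g : X ⟶ Z}
    (α : f ⟶ g) : α ≫ (unitIso h g).hom = (unitIso h f).hom ≫ e ◁ e' ◁ α := by
  simp only [unitIso, Iso.trans_hom, Iso.symm_hom, whiskerRightIso_hom, Category.assoc]
  rw [← associator_naturality_right, ← whisker_exchange_assoc, leftUnitor_inv_naturality_assoc]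

theorem whiskerLeft_id_comp_associator_inv {W X Y Z : A} (l : W ⟶ X) (e : X ⟶ Y) {f g : Y ⟶ Z}
    (α : f ⟶ g) : l ◁ e ◁ α ≫ l ◁ 𝟙 (e ≫ g) ≫ (α_ l e g).inv =
      (l ◁ 𝟙 (e ≫ f) ≫ (α_ l e f).inv) ≫ (l ≫ e) ◁ α := by
  simp

theorem precomp_isEquivalence {X Y : A} {e : X ⟶ Y} {e' : Y ⟶ X} (h : e' ≫ e = 𝟙 Y)
    (h' : e ≫ e' = 𝟙 X) (Z : A) : (precomp Z e).IsEquivalence :=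
  (CategoryTheory.Equivalence.mk (precomp Z e) (precomp Z e')
    (NatIso.ofComponents (F := 𝟭 _) (G := precomp Z e ⋙ precomp Z e') (unitIso h)
      (fun {f g} α => unitIso_naturality h α))
    (NatIso.ofComponents (F := precomp Z e' ⋙ precomp Z e) (G := 𝟭 _)
      (fun f => (unitIso h' f).symm)
      (fun {f g} α => by
        exact (Iso.comp_inv_eq _).2 (by
          rw [Category.assoc]
          exact (Iso.eq_inv_comp _).2 (unitIso_naturality h' α).symm)))).isEquivalence_functor

variable [Strict A] {F G : Pseudofunctor I A} {L L' : A}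

/-- Pseudocolimits are transported along invertible 2-natural transformations. -/
theorem IsPseudocolimit.precomp {σ : F ⟶ G} {σ' : G ⟶ F} (h : σ' ≫ σ = 𝟙 G) (h' : σ ≫ σ' = 𝟙 F)
    {l : G ⟶ const I L} (hl : IsPseudocolimit l) : IsPseudocolimit (σ ≫ l) := fun Z => by
  have := (hl Z).isEquivalence
  have := precomp_isEquivalence h h' (const I Z)
  refine IsIsoOfCategories.of_iso (F := (constFunctor I L Z ⋙ Bicategory.precomp (const I Z) l) ⋙
    Bicategory.precomp (const I Z) σ) (NatIso.ofComponents
      (fun f => (α_ σ l ((constFunctor I L Z).obj f)).symm) (fun {f g} α => by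
        exact associator_inv_naturality_right σ l ((constFunctor I L Z).map α))) ?_
  -- On objects the comparison is the old one followed by composition with `σ`, since composition of
  -- transformations is strictly associative when `A` is strict.
  have e : (constFunctor I L Z ⋙ Bicategory.precomp (const I Z) (σ ≫ l)).obj =
      (fun t => σ ≫ t) ∘ (constFunctor I L Z ⋙ Bicategory.precomp (const I Z) l).obj :=
    funext fun f => strongTrans_assoc σ l _
  rw [e]
  refine Function.Bijective.comp (Function.bijective_iff_has_inverse.2
    ⟨fun t => σ' ≫ t, fun t => ?_, fun t => ?_⟩) (hl Z).bijective
  · exact (strongTrans_assoc _ _ _).symm.trans ((congrArg (· ≫ t) h).trans (strongTrans_id_comp t))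
  · exact (strongTrans_assoc _ _ _).symm.trans ((congrArg (· ≫ t) h').trans (strongTrans_id_comp t))

/-- Any object isomorphic to a pseudocolimit is a pseudocolimit. -/
theorem IsPseudocolimit.comp_const {e : L ⟶ L'} {e' : L' ⟶ L} (h : e' ≫ e = 𝟙 L')
    (h' : e ≫ e' = 𝟙 L) {l : F ⟶ const I L} (hl : IsPseudocolimit l) :
    IsPseudocolimit (l ≫ (constFunctor I L L').obj e) := fun Z => by
  have := (hl Z).isEquivalence
  have := precomp_isEquivalence h h' Z
  refine IsIsoOfCategories.of_iso (F := Bicategory.precomp Z e ⋙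
    (constFunctor I L Z ⋙ Bicategory.precomp (const I Z) l)) (NatIso.ofComponents
      (fun f => whiskerLeftIso l (constComp I e f).symm ≪≫ (α_ _ _ _).symm) (fun {f g} α => by
        refine Pseudofunctor.StrongTrans.homCategory.ext fun i => ?_
        exact whiskerLeft_id_comp_associator_inv (l.app i) e α)) ?_
  have e₁ : (constFunctor I L' Z ⋙ Bicategory.precomp (const I Z)
      (l ≫ (constFunctor I L L').obj e)).obj =
      (constFunctor I L Z ⋙ Bicategory.precomp (const I Z) l).obj ∘ (fun t => e ≫ t) :=
    funext fun f => (strongTrans_assoc l _ _).trans (congrArg (l ≫ ·) (constComp_eq I e f))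
  rw [e₁]
  refine Function.Bijective.comp (hl Z).bijective (Function.bijective_iff_has_inverse.2
    ⟨fun t => e' ≫ t, fun t => ?_, fun t => ?_⟩)
  · exact (Strict.assoc _ _ _).symm.trans ((congrArg (· ≫ t) h).trans (Strict.id_comp t))
  · exact (Strict.assoc _ _ _).symm.trans ((congrArg (· ≫ t) h').trans (Strict.id_comp t))

/-- Pseudocolimits are unique up to isomorphism. -/
theorem IsPseudocolimit.exists_iso {l : F ⟶ const I L} (hl : IsPseudocolimit l)
    {l' : F ⟶ const I L'} (hl' : IsPseudocolimit l') :
    ∃ (e : L ⟶ L') (e' : L' ⟶ L), e' ≫ e = 𝟙 L' ∧ e ≫ e' = 𝟙 L := by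
  obtain ⟨e, he⟩ := (hl L').bijective.2 l'
  obtain ⟨e', he'⟩ := (hl' L).bijective.2 l
  -- Both `d ≫ d'` and `𝟙 M` carry `m` to itself, and the comparison for `m` is injective on
  -- objects. The same argument serves for both composites.
  have aux : ∀ {M M' : A} {m : F ⟶ const I M} {m' : F ⟶ const I M'} (_ : IsPseudocolimit m)
      {d : M ⟶ M'} {d' : M' ⟶ M} (_ : m ≫ (constFunctor I M M').obj d = m')
      (_ : m' ≫ (constFunctor I M' M).obj d' = m), d ≫ d' = 𝟙 M := by
    intro M M' m m' hm d d' hd hd'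
    refine (hm M).bijective.1 ?_
    change m ≫ (constFunctor I M M).obj (d ≫ d') = m ≫ (constFunctor I M M).obj (𝟙 M)
    rw [← constComp_eq, constId_eq, strongTrans_comp_id, ← strongTrans_assoc, hd, hd']
  exact ⟨e, e', aux hl' he' he, aux hl he he'⟩

end Transport

end TwoPro

/-! ### Replacing the values of a 2-functor by isomorphic objects. -/

namespace TwoPro

section HEq
variable {A : Type u₂} [Bicategory.{w₂, v₂} A]

/-- The 2-functor laws for `conj` compare 2-cells between 1-cells that are equal only by a proof.
They are established as heterogeneous equalities and converted to `eqToHom` form at the end. -/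
theorem whiskerLeft_heq {X Y Z : A} {k k' : X ⟶ Y} (hk : k = k') {f f' g g' : Y ⟶ Z} (hf : f = f')
    (hg : g = g') {θ : f ⟶ g} {θ' : f' ⟶ g'} (h : θ ≍ θ') : k ◁ θ ≍ k' ◁ θ' := by
  subst hk hf hg h
  rfl

theorem whiskerRight_heq {X Y Z : A} {k k' : Y ⟶ Z} (hk : k = k') {f f' g g' : X ⟶ Y} (hf : f = f')
    (hg : g = g') {θ : f ⟶ g} {θ' : f' ⟶ g'} (h : θ ≍ θ') : θ ▷ k ≍ θ' ▷ k' := by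
  subst hk hf hg h
  rfl

variable [Strict A]

theorem whiskerLeft_whiskerLeft_heq {W X Y Z : A} (h : W ⟶ X) (f : X ⟶ Y) {g g' : Y ⟶ Z}
    (η : g ⟶ g') : (h ≫ f) ◁ η ≍ h ◁ f ◁ η := by
  simp [Strict.associator_eqToIso]

theorem whiskerRight_whiskerRight_heq {W X Y Z : A} {f g : W ⟶ X} (η : f ⟶ g) (h : X ⟶ Y)
    (k : Y ⟶ Z) : η ▷ (h ≫ k) ≍ η ▷ h ▷ k := by
  simp [Strict.associator_eqToIso]

theorem whiskerLeft_whiskerRight_heq {W X Y Z : A} (k : W ⟶ X) {f g : X ⟶ Y} (η : f ⟶ g)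
    (h : Y ⟶ Z) : (k ◁ η) ▷ h ≍ k ◁ η ▷ h := by
  simp [Strict.associator_eqToIso]

theorem id_whiskerLeft_heq {X Y : A} {f g : X ⟶ Y} (η : f ⟶ g) : 𝟙 X ◁ η ≍ η := by
  simp [Strict.leftUnitor_eqToIso]

theorem whiskerRight_id_heq {X Y : A} {f g : X ⟶ Y} (η : f ⟶ g) : η ▷ 𝟙 Y ≍ η := by
  simp [Strict.rightUnitor_eqToIso]

theorem whiskerLeft_whiskerLeft_heq_self {X Y Z : A} {e : X ⟶ Y} {e' : Y ⟶ X}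
    (h : e ≫ e' = 𝟙 X) {f g : X ⟶ Z} (θ : f ⟶ g) : e ◁ e' ◁ θ ≍ θ :=
  (whiskerLeft_whiskerLeft_heq e e' θ).symm.trans
    ((whiskerLeft_heq h rfl rfl HEq.rfl).trans (id_whiskerLeft_heq θ))

theorem whiskerRight_whiskerRight_heq_self {X Y Z : A} {e : X ⟶ Y} {e' : Y ⟶ X}
    (h : e ≫ e' = 𝟙 X) {f g : Z ⟶ X} (θ : f ⟶ g) : θ ▷ e ▷ e' ≍ θ :=
  (whiskerRight_whiskerRight_heq θ e e').symm.trans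
    ((whiskerRight_heq h rfl rfl HEq.rfl).trans (whiskerRight_id_heq θ))

end HEq

section Conj
variable {J : Type u₁} [Bicategory.{w₁, v₁} J] [Strict J] {A : Type u₂} [Bicategory.{w₂, v₂} A]
  (F : StrictPseudofunctor J A)

theorem map₂_whiskerLeft_heq {i j k : J} (f : i ⟶ j) {g g' : j ⟶ k} (η : g ⟶ g') :
    F.map₂ (f ◁ η) ≍ F.map f ◁ F.map₂ η := by
  rw [F.map₂_whisker_left]
  simp [F.mapComp_eq_eqToIso]

theorem map₂_whiskerRight_heq {i j k : J} {f f' : i ⟶ j} (η : f ⟶ f') (g : j ⟶ k) :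
    F.map₂ (η ▷ g) ≍ F.map₂ η ▷ F.map g := by
  rw [F.map₂_whisker_right]
  simp [F.mapComp_eq_eqToIso]

variable [Strict A] {L : J → A} {e : ∀ j, L j ⟶ F.obj j}
  {e' : ∀ j, F.obj j ⟶ L j} (h : ∀ j, e' j ≫ e j = 𝟙 _) (h' : ∀ j, e j ≫ e' j = 𝟙 _)

include h in
theorem conj_map_comp {i j k : J} (f : i ⟶ j) (g : j ⟶ k) :
    e i ≫ F.map (f ≫ g) ≫ e' k = (e i ≫ F.map f ≫ e' j) ≫ e j ≫ F.map g ≫ e' k := by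
  rw [F.map_comp, Strict.assoc, Strict.assoc, Strict.assoc, ← Strict.assoc (e' j) (e j), h,
    Strict.id_comp]

include h in
theorem comp_comp_map_comp {j k : J} (g : j ⟶ k) :
    e' j ≫ e j ≫ F.map g ≫ e' k = F.map g ≫ e' k := by
  rw [← Strict.assoc, h, Strict.id_comp]

include h in
theorem map_comp_comp {j k : J} (g : j ⟶ k) : (F.map g ≫ e' k) ≫ e k = F.map g := by
  rw [Strict.assoc, h, Strict.comp_id]

include h in
-- On the right the inner factor `e' j ≫ e j` is an identity; removing it leaves the image of `f ◁
-- η` under the 2-functor `F`, whiskered by the outer isomorphisms.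
theorem whisker_map₂_whiskerLeft_heq {i j k : J} (f : i ⟶ j) {g g' : j ⟶ k} (η : g ⟶ g') :
    e i ◁ F.map₂ (f ◁ η) ▷ e' k ≍ (e i ≫ F.map f ≫ e' j) ◁ e j ◁ F.map₂ η ▷ e' k := by
  have h₁ : e i ◁ F.map₂ (f ◁ η) ▷ e' k ≍ e i ◁ F.map f ◁ F.map₂ η ▷ e' k :=
    whiskerLeft_heq rfl (by rw [F.map_comp, Strict.assoc]) (by rw [F.map_comp, Strict.assoc])
      ((whiskerRight_heq rfl (F.map_comp f g) (F.map_comp f g') (map₂_whiskerLeft_heq F f η)).trans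
        (whiskerLeft_whiskerRight_heq (F.map f) (F.map₂ η) (e' k)))
  have h₂ : (F.map f ≫ e' j) ◁ e j ◁ F.map₂ η ▷ e' k ≍ F.map f ◁ F.map₂ η ▷ e' k :=
    (whiskerLeft_whiskerLeft_heq _ _ _).trans (whiskerLeft_heq rfl (comp_comp_map_comp F h g)
      (comp_comp_map_comp F h g') (whiskerLeft_whiskerLeft_heq_self (h j) (F.map₂ η ▷ e' k)))
  refine h₁.trans ((whiskerLeft_whiskerLeft_heq (e i) _ _).trans
    (whiskerLeft_heq rfl ?_ ?_ h₂)).symm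
  · rw [Strict.assoc, comp_comp_map_comp F h g]
  · rw [Strict.assoc, comp_comp_map_comp F h g']

include h in
theorem whisker_map₂_whiskerRight_heq {i j k : J} {f f' : i ⟶ j} (η : f ⟶ f') (g : j ⟶ k) :
    e i ◁ F.map₂ (η ▷ g) ▷ e' k ≍ (e i ◁ F.map₂ η ▷ e' j) ▷ (e j ≫ F.map g ≫ e' k) := by
  have h₁ : e i ◁ F.map₂ (η ▷ g) ▷ e' k ≍ e i ◁ F.map₂ η ▷ (F.map g ≫ e' k) :=
    whiskerLeft_heq rfl (by rw [F.map_comp, Strict.assoc]) (by rw [F.map_comp, Strict.assoc])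
      ((whiskerRight_heq rfl (F.map_comp f g) (F.map_comp f' g) (map₂_whiskerRight_heq F η g)).trans
        (whiskerRight_whiskerRight_heq (F.map₂ η) (F.map g) (e' k)).symm)
  have h₂ : F.map₂ η ▷ e' j ▷ (e j ≫ F.map g ≫ e' k) ≍ F.map₂ η ▷ (F.map g ≫ e' k) :=
    (whiskerRight_whiskerRight_heq _ _ _).trans (whiskerRight_heq rfl (map_comp_comp F h f)
      (map_comp_comp F h f') (whiskerRight_whiskerRight_heq_self (h j) (F.map₂ η)))
  refine h₁.trans ((whiskerLeft_whiskerRight_heq (e i) _ _).trans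
    (whiskerLeft_heq rfl ?_ ?_ h₂)).symm
  · rw [← Strict.assoc, map_comp_comp F h f]
  · rw [← Strict.assoc, map_comp_comp F h f']

/-- The 2-functor isomorphic to `F` along given isomorphisms of the values. -/
def conj : StrictPseudofunctor J A := StrictPseudofunctor.mk''
  { obj := L
    map := fun {j k} a => e j ≫ F.map a ≫ e' k
    map₂ := fun {j k} {a b} α => e j ◁ F.map₂ α ▷ e' k
    map₂_id := fun a => by simp
    map₂_comp := fun α β => by simp
    map_id := fun j => by rw [F.map_id, Strict.id_comp, h']
    map_comp := conj_map_comp F h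
    map₂_whisker_left := fun {j k l} f g g' η =>
      (conj_eqToHom_iff_heq _ _ (conj_map_comp F h f g) (conj_map_comp F h f g')).2
        (whisker_map₂_whiskerLeft_heq F h f η)
    map₂_whisker_right := fun {j k l} {f f'} η g =>
      (conj_eqToHom_iff_heq _ _ (conj_map_comp F h f g) (conj_map_comp F h f' g)).2
        (whisker_map₂_whiskerRight_heq F h η g) }

theorem toConj_nat {j k : J} (a : j ⟶ k) : F.map a ≫ e' k = e' j ≫ (conj F h h').map a :=
  (comp_comp_map_comp F h a).symm

theorem ofConj_nat {j k : J} (a : j ⟶ k) : (conj F h h').map a ≫ e k = e j ≫ F.map a :=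
  (Strict.assoc _ _ _).trans (congrArg (e j ≫ ·) (map_comp_comp F h a))

/-- The comparison with `conj`. -/
def toConj : F ⟶ conj F h h' :=
  TwoNatTrans.mk' e' (toConj_nat F h h') (fun {j k} {f g} η =>
    (conj_eqToHom_iff_heq _ _ (toConj_nat F h h' f) (toConj_nat F h h' g)).2
      (whiskerLeft_whiskerLeft_heq_self (h j) (F.map₂ η ▷ e' k)).symm)

/-- The comparison with `conj`. -/
def ofConj : conj F h h' ⟶ F :=
  TwoNatTrans.mk' e (ofConj_nat F h h') (fun {j k} {f g} η =>
    (conj_eqToHom_iff_heq _ _ (ofConj_nat F h h' f) (ofConj_nat F h h' g)).2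
      ((whiskerLeft_whiskerRight_heq (e j) (F.map₂ η ▷ e' k) (e k)).trans
        (whiskerLeft_heq rfl (map_comp_comp F h f) (map_comp_comp F h g)
          (whiskerRight_whiskerRight_heq_self (h k) (F.map₂ η)))))

theorem toConj_ofConj : toConj F h h' ≫ ofConj F h h' = 𝟙 F := TwoNatTrans.ext' fun j => h j

theorem ofConj_toConj : ofConj F h h' ≫ toConj F h h' = 𝟙 _ := TwoNatTrans.ext' fun j => h' j

end Conj

/-! ### Closure of `IsFC` under 2-filtered pseudocolimits. -/

section Closure
variable {C : Type u} [Bicategory.{w, w} C] [Strict C] {J : Type w} [Bicategory.{w, w} J] [Strict J]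

/-- The diagram of 2-pro-objects determined by a 2-functor isomorphic to `j ↦ L X_j`. -/
def ProDiagram.ofConj {X : J → TwoProObj C} (F : StrictPseudofunctor J (StrictPseudofunctor C Cat.{w, w}))
    {e : ∀ j, (X j).L ⟶ F.obj j} {e' : ∀ j, F.obj j ⟶ (X j).L} (h : ∀ j, e' j ≫ e j = 𝟙 _)
    (h' : ∀ j, e j ≫ e' j = 𝟙 _) : ProDiagram J C where
  obj := X
  map := (conj F h h').map
  map₂ := (conj F h h').map₂
  mapId := (conj F h h').mapId
  mapComp := (conj F h h').mapComp
  map₂_id := (conj F h h').map₂_id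
  map₂_comp := (conj F h h').map₂_comp
  map₂_whisker_left := (conj F h h').map₂_whisker_left
  map₂_whisker_right := (conj F h h').map₂_whisker_right
  map₂_associator := (conj F h h').map₂_associator
  map₂_left_unitor := (conj F h h').map₂_left_unitor
  map₂_right_unitor := (conj F h h').map₂_right_unitor

theorem isFC_of_iso {G G' : StrictPseudofunctor C Cat.{w, w}} {e : G ⟶ G'} {e' : G' ⟶ G}
    (h : e' ≫ e = 𝟙 G') (h' : e ≫ e' = 𝟙 G) (hG : IsFC G) : IsFC G' := by
  obtain ⟨X, l, hl⟩ := hG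
  exact ⟨X, _, hl.comp_const h h'⟩

/-- The diagram is replaced by an isomorphic one whose values are of the form `L X_j`, to which the
total 2-pro-object applies; the resulting pseudocone is transported back. -/
theorem exists_isPseudocolimit_isFC (hJ : IsTwoFiltered J)
    (F : StrictPseudofunctor J (StrictPseudofunctor C Cat.{w, w})) (hF : ∀ j, IsFC (F.obj j)) :
    ∃ (G : StrictPseudofunctor C Cat.{w, w}) (l : F.toPseudofunctor ⟶ const J G),
      IsPseudocolimit l ∧ IsFC G := by
  choose X l hl using hF
  -- Both `L X_j` and `F j` are pseudocolimits of the same diagram of representables, hence are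
  -- isomorphic on the nose.
  choose e e' h h' using fun j => (X j).isPseudocolimit_cocone.exists_iso (hl j)
  let P := ProDiagram.ofConj F h h'
  have h₁ : (toConj F h h').trans ≫ (TwoPro.ofConj F h h').trans = 𝟙 F.toPseudofunctor :=
    congrArg TwoNatTrans.trans (toConj_ofConj F h h')
  have h₂ : (TwoPro.ofConj F h h').trans ≫ (toConj F h h').trans = 𝟙 P.toPseudofunctor :=
    congrArg TwoNatTrans.trans (ofConj_toConj F h h')
  exact ⟨_, (show F.toPseudofunctor ⟶ P.toPseudofunctor from (toConj F h h').trans) ≫ P.cocone hJ,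
    (P.isPseudocolimit_cocone hJ).precomp h₂ h₁, P.total hJ, _,
    (P.total hJ).isPseudocolimit_cocone⟩

/-- `Hom(C, Cat)_fc` is closed under small 2-filtered pseudocolimits. -/
theorem isFC_of_isPseudocolimit (hJ : IsTwoFiltered J)
    {F : StrictPseudofunctor J (StrictPseudofunctor C Cat.{w, w})} (hF : ∀ j, IsFC (F.obj j))
    {G : StrictPseudofunctor C Cat.{w, w}} {l : F.toPseudofunctor ⟶ const J G}
    (hl : IsPseudocolimit l) : IsFC G := by
  obtain ⟨G', l', hl', hG'⟩ := exists_isPseudocolimit_isFC hJ F hF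
  obtain ⟨e, e', h, h'⟩ := hl'.exists_iso hl
  exact isFC_of_iso h h' hG'

end Closure

end TwoPro

/-! ### Duality between pseudocones in `A` and in its opposite. -/

namespace TwoPro

/-- The opposite keeps the direction of 2-cells, yet the structure cells of a cone and of a cocone
then point in opposite directions. Dualizing therefore inverts them, and every axiom has to be
rewritten for the inverses. -/
theorem Iso.square_iff {A : Type u₁} [Category.{v₁} A] {a b c d : A} {n : a ≅ b} {m : c ≅ d}
    {p : a ⟶ c} {q : b ⟶ d} : n.hom ≫ q = p ≫ m.hom ↔ n.inv ≫ p = q ≫ m.inv := by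
  rw [Iso.inv_comp_eq, ← Category.assoc, Iso.eq_comp_inv, eq_comm]

section Dual
variable {A : Type u₂} [Bicategory.{w₂, v₂} A] {B : Type u₁} (L : B → A)

/-- The 2-category with objects `B` and hom-categories `A(L y, L x)`. -/
abbrev OpInduced := InducedBicategory Aᵒᵖ fun x : B => op (L x)

variable {L} {x y : OpInduced L}

/-- The 1-cell given by a 1-cell of `A`. -/
abbrev OpInduced.homMk (f : L y ⟶ L x) : x ⟶ y := InducedBicategory.mkHom f.op

/-- The 1-cell of `A` underlying a 1-cell. -/
abbrev OpInduced.un (f : x ⟶ y) : L y ⟶ L x := f.hom.unop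

/-- The 2-cell of `A` underlying a 2-cell. -/
abbrev OpInduced.un₂ {f g : x ⟶ y} (η : f ⟶ g) : un f ⟶ un g := η.hom.unop2

/-- The 2-cell given by a 2-cell of `A`. -/
abbrev OpInduced.cellMk {f g : x ⟶ y} (η : un f ⟶ un g) : f ⟶ g :=
  ⟨Bicategory.Opposite.Hom2.op2' η⟩

/-- `un` as a functor. -/
def OpInduced.unFunctor (x y : OpInduced L) : (x ⟶ y) ⥤ (L y ⟶ L x) where
  obj f := un f
  map η := un₂ η

/-- The inverse of `unFunctor`. -/
def OpInduced.mkFunctor (x y : OpInduced L) : (L y ⟶ L x) ⥤ (x ⟶ y) where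
  obj f := homMk f
  map η := cellMk η

theorem OpInduced.isIso_unFunctor (x y : OpInduced L) : IsIsoOfCategories (unFunctor x y) :=
  ⟨mkFunctor x y, rfl, rfl⟩

/-- An invertible 2-cell from one of `A`. -/
abbrev OpInduced.isoMk {f g : x ⟶ y} (e : un f ≅ un g) : f ≅ g where
  hom := cellMk e.hom
  inv := cellMk e.inv
  hom_inv_id := InducedBicategory.hom₂_ext (congrArg Bicategory.Opposite.Hom2.op2' e.hom_inv_id)
  inv_hom_id := InducedBicategory.hom₂_ext (congrArg Bicategory.Opposite.Hom2.op2' e.inv_hom_id)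

/-- The invertible 2-cell of `A` underlying an invertible 2-cell. -/
abbrev OpInduced.unIso {f g : x ⟶ y} (e : f ≅ g) : un f ≅ un g where
  hom := un₂ e.hom
  inv := un₂ e.inv
  hom_inv_id := congrArg un₂ e.hom_inv_id
  inv_hom_id := congrArg un₂ e.inv_hom_id

theorem OpInduced.cell_ext {f g : x ⟶ y} {η θ : f ⟶ g} (h : un₂ η = un₂ θ) : η = θ :=
  InducedBicategory.hom₂_ext (congrArg Bicategory.Opposite.Hom2.op2' h)

theorem OpInduced.un₂_eqToHom {f g : x ⟶ y} (h : f = g) :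
    un₂ (eqToHom h) = eqToHom (congrArg un h) := by
  subst h
  rfl

open OpInduced

theorem comp_square_iff {i j k : A} {Z : A} {f : i ⟶ j} {g : j ⟶ k} {fg : i ⟶ k} {ti : i ⟶ Z}
    {tj : j ⟶ Z} {tk : k ⟶ Z} {n : fg ≫ tk ≅ ti ≫ 𝟙 Z} {nf : f ≫ tj ≅ ti ≫ 𝟙 Z}
    {ng : g ≫ tk ≅ tj ≫ 𝟙 Z} {m : fg ⟶ f ≫ g} :
    n.hom ≫ ti ◁ (λ_ (𝟙 Z)).inv = m ▷ tk ≫ (α_ _ _ _).hom ≫ f ◁ ng.hom ≫ (α_ _ _ _).inv ≫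
      nf.hom ▷ 𝟙 Z ≫ (α_ _ _ _).hom ↔
    n.inv ≫ m ▷ tk = ti ◁ (ρ_ (𝟙 Z)).inv ≫ (α_ _ _ _).inv ≫ nf.inv ▷ 𝟙 Z ≫ (α_ _ _ _).hom ≫
      f ◁ ng.inv ≫ (α_ _ _ _).inv := by
  have h := Iso.square_iff (n := n) (p := m ▷ tk) (q := ti ◁ (λ_ (𝟙 Z)).inv)
    (m := α_ _ _ _ ≪≫ whiskerLeftIso f ng ≪≫ (α_ _ _ _).symm ≪≫ whiskerRightIso nf (𝟙 Z) ≪≫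
      α_ _ _ _)
  -- The constant 2-functor is defined with the left unitor, which becomes a right unitor in the
  -- opposite; at `𝟙 Z` the two coincide.
  rw [← unitors_inv_equal]
  simpa using h

theorem whiskerRight_conj_inv {i j Z W : A} {f : i ⟶ j} {ti : i ⟶ Z} {tj : j ⟶ Z}
    (n : f ≫ tj ≅ ti ≫ 𝟙 Z) (g : Z ⟶ W) :
    (((α_ _ _ _).symm ≪≫ whiskerRightIso n g ≪≫ α_ _ _ _ ≪≫
      whiskerLeftIso ti (λ_ g ≪≫ (ρ_ g).symm) ≪≫ (α_ _ _ _).symm)).inv =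
    (α_ _ _ _).hom ≫ ti ◁ ((ρ_ g).hom ≫ (λ_ g).inv) ≫ (α_ _ _ _).inv ≫ n.inv ▷ g ≫
      (α_ _ _ _).hom := by
  simp

theorem whisker_id_square {i j Z : A} {r : i ⟶ Z} {s : Z ⟶ Z} {f : i ⟶ j} {g : j ⟶ Z}
    {p q : r ≫ s ⟶ f ≫ g} (h : q = p) : 𝟙 r ▷ s ≫ p = q ≫ f ◁ 𝟙 g := by
  simp [h]

theorem comp_id_eq_id_comp {A : Type u₁} [Category.{v₁} A] {x y : A} (p : x ⟶ y) :
    p ≫ 𝟙 y = 𝟙 x ≫ p := by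
  simp

variable [Strict A] {J : Type w} [Bicategory.{w₁, v₁} J] [Strict J]
  (X : StrictPseudofunctor Jᵒᵖ (OpInduced L))

/-- The diagram in `A` underlying a diagram `X`. -/
def unDiagram : StrictPseudofunctor J A := StrictPseudofunctor.mk''
  { obj := fun j => L (X.obj (op j))
    map := fun a => un (X.map a.op)
    map₂ := fun α => un₂ (X.map₂ (Bicategory.Opposite.op2 α))
    map₂_id := fun a => congrArg un₂ (X.map₂_id a.op)
    map₂_comp := fun α β => congrArg un₂ (X.map₂_comp (Bicategory.Opposite.op2 α)
      (Bicategory.Opposite.op2 β))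
    map_id := fun j => congrArg un (X.map_id (op j))
    map_comp := fun a b => congrArg un (X.map_comp b.op a.op)
    map₂_whisker_left := fun f g g' η => by
      have h := congrArg un₂ (X.map₂_whisker_right (Bicategory.Opposite.op2 η) f.op)
      rw [X.mapComp_eq_eqToIso, X.mapComp_eq_eqToIso, eqToIso.hom, eqToIso.inv] at h
      refine h.trans ?_
      change un₂ (eqToHom _) ≫ _ ≫ un₂ (eqToHom _) = _
      rw [un₂_eqToHom, un₂_eqToHom]
      rfl
    map₂_whisker_right := fun {_ _ _ f f'} η g => by
      have h := congrArg un₂ (X.map₂_whisker_left g.op (Bicategory.Opposite.op2 η))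
      rw [X.mapComp_eq_eqToIso, X.mapComp_eq_eqToIso, eqToIso.hom, eqToIso.inv] at h
      refine h.trans ?_
      change un₂ (eqToHom _) ≫ _ ≫ un₂ (eqToHom _) = _
      rw [un₂_eqToHom, un₂_eqToHom]
      rfl }

theorem unDiagram_mapId (j : J) : ((unDiagram X).mapId j).hom = un₂ (X.mapId (op j)).hom := by
  rw [X.mapId_eq_eqToIso, eqToIso.hom, un₂_eqToHom]
  rfl

theorem unDiagram_mapComp {i j k : J} (a : i ⟶ j) (b : j ⟶ k) :
    ((unDiagram X).mapComp a b).hom = un₂ (X.mapComp b.op a.op).hom := by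
  rw [X.mapComp_eq_eqToIso, eqToIso.hom, un₂_eqToHom]
  rfl

variable {X}
/-- The cone in `OpInduced L` determined by a cocone in `A`. -/
def dualCone (t : (unDiagram X).toPseudofunctor ⟶ const J (L y)) :
    const Jᵒᵖ y ⟶ X.toPseudofunctor where
  app j := homMk (t.app j.unop)
  naturality a := OpInduced.isoMk (t.naturality a.unop).symm
  naturality_naturality {j k a b} η := cell_ext
    (Iso.square_iff.1 (t.naturality_naturality η.unop2).symm).symm
  naturality_id j := cell_ext (by
    have h := t.naturality_id j.unop
    rw [unDiagram_mapId] at h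
    exact (Iso.square_iff (m := λ_ _ ≪≫ (ρ_ _).symm)).1 h)
  naturality_comp {i j k} a b := cell_ext (by
    have h := t.naturality_comp b.unop a.unop
    rw [unDiagram_mapComp] at h
    exact comp_square_iff.1 h)

/-- The cocone in `A` determined by a cone in `OpInduced L`. -/
def undualCone (s : const Jᵒᵖ y ⟶ X.toPseudofunctor) :
    (unDiagram X).toPseudofunctor ⟶ const J (L y) where
  app j := un (s.app (op j))
  naturality a := (unIso (s.naturality a.op)).symm
  naturality_naturality {j k a b} η := by
    have h := congrArg un₂ (s.naturality_naturality (Bicategory.Opposite.op2 η))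
    exact (Iso.square_iff (n := (unIso (s.naturality a.op)).symm)
      (m := (unIso (s.naturality b.op)).symm)).2 h.symm |>.symm
  naturality_id j := by
    have h := congrArg un₂ (s.naturality_id (op j))
    rw [unDiagram_mapId]
    exact (Iso.square_iff (n := (unIso (s.naturality (𝟙 j).op)).symm)
      (m := λ_ _ ≪≫ (ρ_ _).symm)).2 h
  naturality_comp {i j k} a b := by
    have h := congrArg un₂ (s.naturality_comp b.op a.op)
    rw [unDiagram_mapComp]
    exact (comp_square_iff (n := (unIso (s.naturality (a ≫ b).op)).symm)
      (nf := (unIso (s.naturality a.op)).symm) (ng := (unIso (s.naturality b.op)).symm)).2 h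

/-- `dualCone` as a functor. -/
def dualConeFunctor (X : StrictPseudofunctor Jᵒᵖ (OpInduced L)) (y : OpInduced L) :
    ((unDiagram X).toPseudofunctor ⟶ const J (L y)) ⥤ (const Jᵒᵖ y ⟶ X.toPseudofunctor) where
  obj t := dualCone t
  map m := Pseudofunctor.StrongTrans.Hom.of
    { app := fun j => cellMk (m.as.app j.unop)
      naturality := fun a => cell_ext (Iso.square_iff.1 (m.as.naturality a.unop).symm).symm }

/-- `undualCone` as a functor. -/
def undualConeFunctor (X : StrictPseudofunctor Jᵒᵖ (OpInduced L)) (y : OpInduced L) :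
    (const Jᵒᵖ y ⟶ X.toPseudofunctor) ⥤ ((unDiagram X).toPseudofunctor ⟶ const J (L y)) where
  obj s := undualCone s
  map {s s'} m := Pseudofunctor.StrongTrans.Hom.of
    { app := fun j => un₂ (m.as.app (op j))
      naturality := fun a => by
        have h := congrArg un₂ (m.as.naturality a.op)
        exact ((Iso.square_iff (n := (unIso (s.naturality a.op)).symm)
          (m := (unIso (s'.naturality a.op)).symm)).2 h.symm).symm }

theorem isIso_dualConeFunctor (X : StrictPseudofunctor Jᵒᵖ (OpInduced L)) (y : OpInduced L) :
    IsIsoOfCategories (dualConeFunctor X y) :=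
  ⟨undualConeFunctor X y, rfl, rfl⟩

theorem IsIsoOfCategories.comp {X : Type*} [Category* X] {Y : Type*} [Category* Y] {Z : Type*}
    [Category* Z] {F : X ⥤ Y} {G : Y ⥤ Z} (hF : IsIsoOfCategories F) (hG : IsIsoOfCategories G) :
    IsIsoOfCategories (F ⋙ G) := by
  have := hF.isEquivalence
  have := hG.isEquivalence
  exact isIsoOfCategories_of (F ⋙ G) (hG.bijective.comp hF.bijective)

/-- Dualization is compatible with composition. -/
def dualConeCompConst {l : OpInduced L} (t : (unDiagram X).toPseudofunctor ⟶ const J (L l))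
    (f : y ⟶ l) : dualCone (t ≫ (constFunctor J (L l) (L y)).obj (un f)) ≅
      (constFunctor Jᵒᵖ y l).obj f ≫ dualCone t :=
  Pseudofunctor.StrongTrans.isoMk (fun _ => Iso.refl _) (fun {j k} a => cell_ext
    (by
      have h := whiskerRight_conj_inv (Z := L l) (t.naturality a.unop) (un (L := L) f)
      exact whisker_id_square h))

theorem dualConeCompConst_eq {l : OpInduced L}
    (t : (unDiagram X).toPseudofunctor ⟶ const J (L l)) (f : y ⟶ l) :
    dualCone (t ≫ (constFunctor J (L l) (L y)).obj (un f)) =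
      (constFunctor Jᵒᵖ y l).obj f ≫ dualCone t :=
  strongTrans_eq_of_modification (dualConeCompConst t f).hom (fun _ => rfl) fun _ => rfl

/-- A pseudocolimit in `A` gives a pseudolimit in `OpInduced L`. -/
theorem IsPseudocolimit.dualCone {l : OpInduced L}
    {t : (unDiagram X).toPseudofunctor ⟶ const J (L l)} (ht : IsPseudocolimit t) :
    IsPseudolimit (dualCone t) := fun y => by
  -- Three isomorphisms of categories are composed: passage to `A`, the universal property of `t`,
  -- and dualization of pseudocones. The comparison functor for the dual cone is isomorphic to this
  -- composite and equal to it on objects.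
  have h : IsIsoOfCategories (unFunctor y l ⋙ (constFunctor J (L l) (L y) ⋙
      Bicategory.precomp (const J (L y)) t) ⋙ dualConeFunctor X y) :=
    (isIso_unFunctor y l).comp ((ht (L y)).comp (isIso_dualConeFunctor X y))
  have := h.isEquivalence
  refine IsIsoOfCategories.of_iso (NatIso.ofComponents (dualConeCompConst t) (fun {f g} η => ?_)) ?_
    (F := unFunctor y l ⋙ (constFunctor J (L l) (L y) ⋙
      Bicategory.precomp (const J (L y)) t) ⋙ dualConeFunctor X y)
  · exact Pseudofunctor.StrongTrans.homCategory.ext fun j => cell_ext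
      (comp_id_eq_id_comp (t.app j.unop ◁ (un₂ (L := L) η : un (L := L) f ⟶ un (L := L) g)))
  · have e : (constFunctor Jᵒᵖ y l ⋙ postcomp (const Jᵒᵖ y) (TwoPro.dualCone t)).obj =
      (unFunctor y l ⋙ (constFunctor J (L l) (L y) ⋙
        Bicategory.precomp (const J (L y)) t) ⋙ dualConeFunctor X y).obj :=
      funext fun f => (dualConeCompConst_eq t f).symm
    rw [e]
    exact h.bijective

end Dual

end TwoPro

/-! ### Pseudolimits of 2-pro-objects and the theorem. -/

namespace TwoPro
section Limits
variable {C : Type u} [Bicategory.{w, w} C] [Strict C] {J : Type w} [Bicategory.{w, w} J] [Strict J]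

/-- The diagram of 2-pro-objects underlying a 2-functor to `TwoProCat C`. -/
def ProDiagram.ofTwoProCat (X : StrictPseudofunctor Jᵒᵖ (TwoProCat C)) : ProDiagram J C where
  obj j := X.obj (op j)
  map := (unDiagram X).map
  map₂ := (unDiagram X).map₂
  mapId := (unDiagram X).mapId
  mapComp := (unDiagram X).mapComp
  map₂_id := (unDiagram X).map₂_id
  map₂_comp := (unDiagram X).map₂_comp
  map₂_whisker_left := (unDiagram X).map₂_whisker_left
  map₂_whisker_right := (unDiagram X).map₂_whisker_right
  map₂_associator := (unDiagram X).map₂_associator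
  map₂_left_unitor := (unDiagram X).map₂_left_unitor
  map₂_right_unitor := (unDiagram X).map₂_right_unitor

/-- `TwoProCat C` is closed under small 2-cofiltered pseudolimits. -/
theorem exists_isPseudolimit (hJ : IsTwoFiltered J) (X : StrictPseudofunctor Jᵒᵖ (TwoProCat C)) :
    ∃ (L : TwoProCat C) (p : const Jᵒᵖ L ⟶ X.toPseudofunctor), IsPseudolimit p :=
  -- The underlying diagram already has values `L X_j`, so no replacement is needed, and the vertex
  -- of its pseudocolimit is `L` of an object of `TwoProCat C`.
  ⟨(ProDiagram.ofTwoProCat X).total hJ, _, IsPseudocolimit.dualCone (X := X)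
    ((ProDiagram.ofTwoProCat X).isPseudocolimit_cocone hJ)⟩

end Limits
end TwoPro

theorem mainTheorem4 (C : Type u) [Bicategory.{w, w} C] [Strict C] :
    (∀ (J : Type w) [Bicategory.{w, w} J] [Strict J], TwoPro.IsTwoFiltered J →
      ∀ X : StrictPseudofunctor Jᵒᵖ (TwoPro.TwoProCat C),
        ∃ (L : TwoPro.TwoProCat C) (p : TwoPro.const Jᵒᵖ L ⟶ X.toPseudofunctor),
          TwoPro.IsPseudolimit p) ∧
    (∀ (J : Type w) [Bicategory.{w, w} J] [Strict J], TwoPro.IsTwoFiltered J →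
      ∀ F : StrictPseudofunctor J (StrictPseudofunctor C Cat.{w, w}),
        (∀ j, TwoPro.IsFC (F.obj j)) →
          (∃ (G : StrictPseudofunctor C Cat.{w, w}) (l : F.toPseudofunctor ⟶ TwoPro.const J G),
            TwoPro.IsPseudocolimit l) ∧
          ∀ (G : StrictPseudofunctor C Cat.{w, w}) (l : F.toPseudofunctor ⟶ TwoPro.const J G),
            TwoPro.IsPseudocolimit l → TwoPro.IsFC G) := by
  refine ⟨fun J _ _ hJ X => TwoPro.exists_isPseudolimit hJ X, fun J _ _ hJ F hF => ⟨?_, ?_⟩⟩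
  · obtain ⟨G, l, hl, -⟩ := TwoPro.exists_isPseudocolimit_isFC hJ F hF
    exact ⟨G, l, hl⟩
  · exact fun G l hl => TwoPro.isFC_of_isPseudocolimit hJ hF hl
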